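/- Let $M=\mathbb H^3/\Gamma$ be a complete orientable hyperbolic $3$-manifold of finite volume, with $\Gamma\subset\mathrm{PSL}_2(\mathbb C)$ discrete and acting freely. For each cusp of $M$ choose an oriented essential simple closed curve (a \emph{meridian}) in its cusp torus, and take the horospherical cross-section of the cusp in which the meridian has length $1$. Consider the horospheres in $\mathbb H^3$ that are lifts of these cross-sections. Each of them has an affine complex structure in which the meridional translation is $1$. For horospheres $H_1\neq H_2$ let $\gamma(H_1,H_2)$ be the shortest geodesic arc between them, let $d$ be its length, and let $\theta$ be the angle by which one has to rotate in $H_2$ to take the meridional direction of $H_1$, parallel translated along $\gamma(H_1,H_2)$, to that of $H_2$. The \emph{intercusp parameter} is $w(H_1,H_2)=e^{-(d+i\theta)}$. For horospheres $H_1\ne H_2\ne H_3$ the \emph{translation parameter} $u(H_1,H_2,H_3)\in\mathbb C$ is the translation of $H_2$ that takes its intersection with the geodesic joining the centers of $H_1$ and $H_2$ to its intersection with the geodesic joining the centers of $H_2$ and $H_3$. An \emph{intercusp arc} of $M$ is the image of an arc $\gamma(H_1,H_2)$ if this image is embedded. A finite collection of intercusp arcs is a \emph{tunnel collection} if the arcs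 can be isotoped fixing their endpoints so that they are disjoint and the result of removing from $M$ open horoball neighbourhoods of the cusps and open tubular neighbourhoods of the arcs is a handlebody. (Here the cross-sections are pushed slightly into the cusps, and the arcs prolonged accordingly, so that the cross-sections are disjoint and embedded.) The \emph{invariant trace field} $k(M)\subset\mathbb C$ is the field generated over $\mathbb Q$ by the traces (determined up to sign) of the elements of the group $\langle\gamma^2\mid\gamma\in\Gamma\rangle$. Suppose that $M$ has a tunnel collection consisting of $k$ intercusp arcs, the images of $\gamma(H_j,H_j')$ for $j=1,\dots,k$. Then there are $2k$ translation parameters $u(A_l,B_l,C_l)$, $l=1,\dots,2k$, where $\gamma(A_l,B_l)$ and $\gamma(B_l,C_l)$ are lifts of arcs of the collection, such that $$k(M)=\mathbb Q\bigl(w(H_1,H_1'),\dots,w(H_k,H_k'),\,u(A_1,B_1,C_1),\dots,u(A_{2k},B_{2k},C_{2k})\bigr).$$ In particular $3k$ parameters generate $k(M)$. -/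

import Mathlib

open scoped MatrixGroups OnePoint
open Set MeasureTheory

noncomputable section

namespace HypThree

/-! ### Hyperbolic 3-space and its orientation preserving isometries -/

/-- The upper half space model `ℂ × ℝ_{>0}` of hyperbolic 3-space. -/
@[ext] structure H3 where
  /-- the horizontal coordinate -/
  z : ℂ
  /-- the height -/
  t : ℝ
  pos : 0 < t

namespace H3

/-- The inclusion of the upper half space in `ℂ × ℝ`. -/
def toProd (x : H3) : ℂ × ℝ := (x.z, x.t)

instance : TopologicalSpace H3 := TopologicalSpace.induced toProd inferInstance

instance : MeasurableSpace H3 := MeasurableSpace.comap toProd inferInstance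

/-- Hyperbolic volume, `dx dy dt / t ^ 3`. -/
def vol : Measure H3 :=
  Measure.comap toProd ((volume : Measure (ℂ × ℝ)).withDensity
    (fun p => ENNReal.ofReal (1 / p.2 ^ 3)))

/-- Hyperbolic distance: `sinh (d / 2) = |x - y| / (2 √(t t'))`. -/
def hdist (x y : H3) : ℝ :=
  2 * Real.arsinh (Real.sqrt (‖x.z - y.z‖ ^ 2 + (x.t - y.t) ^ 2) / (2 * Real.sqrt (x.t * y.t)))

/-- The denominator `|cz + d|² + |c|² t²` of the Poincaré extension. -/
def den (A : SL(2, ℂ)) (x : H3) : ℝ :=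
  Complex.normSq (A.1 1 0 * x.z + A.1 1 1) + Complex.normSq (A.1 1 0) * x.t ^ 2

theorem den_pos (A : SL(2, ℂ)) (x : H3) : 0 < den A x := by
  have hdet := A.2
  rw [Matrix.det_fin_two] at hdet
  have ht := x.pos
  unfold den
  by_cases hc : A.1 1 0 = 0
  · have hd : A.1 1 1 ≠ 0 := by
      intro hd
      rw [hc, hd] at hdet
      simp at hdet
    have := Complex.normSq_pos.2 hd
    simpa [hc] using this
  · have h1 := Complex.normSq_pos.2 hc
    have h2 := Complex.normSq_nonneg (A.1 1 0 * x.z + A.1 1 1)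
    positivity

open ComplexConjugate in
/-- The Poincaré extension to upper half space of the Möbius action of `SL(2, ℂ)`. -/
def act (A : SL(2, ℂ)) (x : H3) : H3 where
  z := ((A.1 0 0 * x.z + A.1 0 1) * conj (A.1 1 0 * x.z + A.1 1 1)
      + A.1 0 0 * conj (A.1 1 0) * (x.t : ℂ) ^ 2) / (den A x : ℂ)
  t := x.t / den A x
  pos := div_pos x.pos (den_pos A x)

open ComplexConjugate in
/-- The positive definite Hermitian matrix of determinant one that represents a point. -/
def herm (x : H3) : Matrix (Fin 2) (Fin 2) ℂ :=
  !![(x.z * conj x.z + (x.t : ℂ) ^ 2) / x.t, x.z / x.t; conj x.z / x.t, 1 / x.t]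

theorem herm_injective : Function.Injective herm := by
  intro x y h
  have hx : (x.t : ℂ) ≠ 0 := Complex.ofReal_ne_zero.2 x.pos.ne'
  have hy : (y.t : ℂ) ≠ 0 := Complex.ofReal_ne_zero.2 y.pos.ne'
  have h1 : (1 : ℂ) / x.t = 1 / y.t := by simpa [herm] using congrFun (congrFun h 1) 1
  have h2 : x.z / x.t = y.z / y.t := by simpa [herm] using congrFun (congrFun h 0) 1
  have ht : (x.t : ℂ) = y.t := by
    field_simp at h1
    exact h1.symm
  have hz : x.z = y.z := by
    rw [ht] at h2
    field_simp at h2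
    exact h2
  exact H3.ext hz (Complex.ofReal_injective ht)

open ComplexConjugate in
theorem herm_act (A : SL(2, ℂ)) (x : H3) :
    herm (act A x) = A.1 * herm x * A.1.conjTranspose := by
  have hdet := A.2
  rw [Matrix.det_fin_two] at hdet
  have hdet' := congrArg conj hdet
  simp only [map_sub, map_mul, map_one] at hdet'
  have hx : (x.t : ℂ) ≠ 0 := Complex.ofReal_ne_zero.2 x.pos.ne'
  have hD : (den A x : ℂ) ≠ 0 := Complex.ofReal_ne_zero.2 (den_pos A x).ne'
  have hDe : (den A x : ℂ) = (A.1 1 0 * x.z + A.1 1 1) * (conj (A.1 1 0) * conj x.z + conj (A.1 1 1))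
      + A.1 1 0 * conj (A.1 1 0) * (x.t : ℂ) ^ 2 := by
    simp only [den, Complex.ofReal_add, Complex.ofReal_mul, Complex.ofReal_pow,
      Complex.normSq_eq_conj_mul_self, map_add, map_mul]
    ring
  have hDc : conj (den A x : ℂ) = den A x := Complex.conj_ofReal _
  generalize hDg : (den A x : ℂ) = D at *
  ext i j
  fin_cases i <;> fin_cases j <;>
    simp only [herm, act, Matrix.mul_apply, Fin.sum_univ_two, Matrix.conjTranspose_apply,
      Matrix.of_apply, Matrix.cons_val', Matrix.cons_val_zero, Matrix.cons_val_one,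
      Matrix.cons_val_fin_one, Fin.zero_eta, Fin.mk_one, Fin.isValue, RCLike.star_def, map_div₀,
      map_add, map_mul, map_pow, Complex.conj_conj, Complex.conj_ofReal, hDg, hDc,
      Complex.ofReal_div] <;>
    generalize (x.t : ℂ) = t at * <;> generalize conj x.z = zc at * <;>
    generalize x.z = z at * <;>
    generalize conj (A.1 0 0) = a' at * <;> generalize conj (A.1 0 1) = b' at * <;>
    generalize conj (A.1 1 0) = c' at * <;> generalize conj (A.1 1 1) = d' at * <;>
    generalize A.1 0 0 = a at * <;> generalize A.1 0 1 = b at * <;>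
    generalize A.1 1 0 = c at * <;> generalize A.1 1 1 = d at *
  all_goals field_simp
  · linear_combination (-(t ^ 2 * (a' * d' - b' * c'))) * hdet - t ^ 2 * hdet'
      - (a' * (a * (z * zc + t ^ 2) + b * zc) + (a * z + b) * b') * hDe
  · ring
  · ring
  · rw [hDe]
    ring

instance : MulAction SL(2, ℂ) H3 where
  smul := act
  one_smul x := by
    apply herm_injective
    change herm (act 1 x) = _
    rw [herm_act]
    simp
  mul_smul A B x := by
    apply herm_injective
    change herm (act (A * B) x) = herm (act A (act B x))
    rw [herm_act, herm_act, herm_act]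
    simp [Matrix.mul_assoc]

end H3

/-- The projection `SL(2, ℂ) → PSL(2, ℂ)`. -/
def toPSL : SL(2, ℂ) →* PSL(2, ℂ) := QuotientGroup.mk' _

/-- The full preimage in `SL(2, ℂ)` of a subgroup of `PSL(2, ℂ)`. -/
def preim (Γ : Subgroup PSL(2, ℂ)) : Subgroup SL(2, ℂ) := Γ.comap toPSL

/-- `Γ` is a discrete group that acts freely and with finite covolume on hyperbolic space, that is,
`ℍ³ / Γ` is a complete orientable hyperbolic 3-manifold of finite volume. -/
structure IsHyperbolicManifoldGroup (Γ : Subgroup PSL(2, ℂ)) : Prop where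
  discrete : DiscreteTopology (preim Γ)
  free : ∀ A ∈ preim Γ, ∀ x : H3, A • x = x → toPSL A = 1
  finite_volume : ∃ F : Set H3, MeasurableSet F ∧ H3.vol F < ⊤ ∧ ∀ x : H3, ∃ A ∈ preim Γ, A • x ∈ F

/-- The quotient manifold `M = ℍ³ / Γ`. -/
abbrev Mfd (Γ : Subgroup PSL(2, ℂ)) : Type := MulAction.orbitRel.Quotient (preim Γ) H3

/-- The covering projection `ℍ³ → M`. -/
def proj (Γ : Subgroup PSL(2, ℂ)) (x : H3) : Mfd Γ := Quotient.mk'' x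

/-- The subgroup `Γ²` generated by the squares of the elements of `Γ`. -/
def squares (Γ : Subgroup PSL(2, ℂ)) : Subgroup PSL(2, ℂ) :=
  Subgroup.closure {x | ∃ γ ∈ Γ, x = γ ^ 2}

/-- The invariant trace field of `ℍ³ / Γ`: the extension of `ℚ` generated by the traces (which are
determined up to sign) of the elements of `Γ²`. -/
def invariantTraceField (Γ : Subgroup PSL(2, ℂ)) : IntermediateField ℚ ℂ :=
  IntermediateField.adjoin ℚ {x | ∃ A : SL(2, ℂ), toPSL A ∈ squares Γ ∧ x = A.1.trace}

/-! ### Horospheres with a meridian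

A horosphere `H` with a meridional translation of length one is encoded by that translation, a
parabolic element `m` of `PSL(2, ℂ)`: if `g` conjugates `m` to `z ↦ z + 1`, then `H` is the
`g`-preimage of the plane `t = 1`. -/

/-- The translation `z ↦ z + 1`. -/
def translOne : SL(2, ℂ) := ⟨!![1, 1; 0, 1], by simp⟩

/-- The isometry `g` positions the horosphere as the plane `t = 1`, with meridional translation
`z ↦ z + 1`. Such a `g` is unique up to sign and up to horizontal translation. -/
def IsPosition (m : PSL(2, ℂ)) (g : SL(2, ℂ)) : Prop :=
  toPSL g * m * (toPSL g)⁻¹ = toPSL translOne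

/-- Parabolic isometries are the conjugates of `z ↦ z + 1`. -/
def IsParabolic (m : PSL(2, ℂ)) : Prop := ∃ g, IsPosition m g

/-- A choice of position for the horosphere of `m`. -/
def position (m : PSL(2, ℂ)) : SL(2, ℂ) := Classical.epsilon (IsPosition m)

/-- The center of the horosphere, a point of the sphere at infinity. -/
def center (m : PSL(2, ℂ)) : OnePoint ℂ :=
  ((position m)⁻¹ : GL (Fin 2) ℂ) • (∞ : OnePoint ℂ)

/-- The height of `x` after positioning the horosphere of `m` as the plane `t = 1`. -/
def heightAt (m : PSL(2, ℂ)) (x : H3) : ℝ := (position m • x).t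

/-- `g` positions the horosphere of `m` as the plane `t = 1`, with meridional translation
`z ↦ z + 1`, and the center of the horosphere of `m'` at `0`. Such a `g` is unique up to sign. -/
def IsAdapted (m m' : PSL(2, ℂ)) (g : SL(2, ℂ)) : Prop :=
  IsPosition m g ∧ (g : GL (Fin 2) ℂ) • center m' = ((0 : ℂ) : OnePoint ℂ)

/-- The position of the horosphere of `m` in which the horosphere of `m'` is centered at `0`. -/
def adapted (m m' : PSL(2, ℂ)) : SL(2, ℂ) := Classical.epsilon (IsAdapted m m')

/-- The hyperbolic distance between two horospheres. -/
def horoDist (m m' : PSL(2, ℂ)) : ℝ :=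
  sInf {r | ∃ x y : H3, heightAt m x = 1 ∧ heightAt m' y = 1 ∧ r = H3.hdist x y}

/-- The geodesic between the horospheres of `m` and `m'`, prolonged by length `log s` into both
horoballs: in adapted position this is the vertical segment above `0` from height `s` down to
height `exp (-d) / s`, where `d` is the distance between the horospheres. -/
def geodArc (s : ℝ) (m m' : PSL(2, ℂ)) (r : ℝ) : H3 :=
  (adapted m m')⁻¹ •
    (⟨0, Real.exp ((1 - r) * Real.log s - r * (horoDist m m' + Real.log s)), Real.exp_pos _⟩ : H3)

/-- The angle `θ` by which one has to rotate in the horosphere of `m'`, with its affine complex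
structure, to take the meridional direction of `m`, parallel translated along the shortest geodesic
arc, to the meridional direction of `m'`. In adapted position the arc is vertical, so that the
translated direction at its lower end `(0, exp (-d))` is the direction of the positive real axis;
positioning the horosphere of `m'` as the plane `t = 1`, this becomes a horizontal direction, whose
argument is `-θ` since the meridional direction becomes `1`. -/
def rotAngle (m m' : PSL(2, ℂ)) : ℝ :=
  -Complex.arg (deriv (fun x : ℝ => ((position m' * (adapted m m')⁻¹) •
    (⟨x, Real.exp (-horoDist m m'), Real.exp_pos _⟩ : H3)).z) 0)

/-- The complex distance `δ = d + iθ` between two horospheres. -/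
def complexDistance (m m' : PSL(2, ℂ)) : ℂ := horoDist m m' + rotAngle m m' * Complex.I

/-- The intercusp parameter `w = exp (-δ)`. -/
def intercuspParameter (m m' : PSL(2, ℂ)) : ℂ := Complex.exp (-complexDistance m m')

/-- The point in which the horosphere of `m` meets the geodesic from the center of the horosphere of
`m` to the center of the horosphere of `m'`. -/
def foot (m m' : PSL(2, ℂ)) : H3 := (adapted m m')⁻¹ • (⟨0, 1, one_pos⟩ : H3)

/-- The translation parameter `u(H₁, H₂, H₃)`: the translation of `H₂`, as a complex number in its
affine complex structure, that takes its intersection with the geodesic from the center of `H₁` to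
its intersection with the geodesic to the center of `H₃`. -/
def translationParameter (m₁ m₂ m₃ : PSL(2, ℂ)) : ℂ :=
  (position m₂ • foot m₂ m₃).z - (position m₂ • foot m₂ m₁).z

/-! ### Cusps and meridians -/

/-- `μ` consists of one meridian for each cusp of `ℍ³ / Γ`, lifted to hyperbolic space: each `μ i`
is a parabolic element of `Γ` that is primitive (that is, represented by an essential simple closed
curve on the cusp torus), and each `Γ`-orbit of parabolic fixed points is represented once. -/
structure IsMeridianSystem (Γ : Subgroup PSL(2, ℂ)) {h : ℕ} (μ : Fin h → PSL(2, ℂ)) : Prop where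
  mem : ∀ i, μ i ∈ Γ
  parabolic : ∀ i, IsParabolic (μ i)
  primitive : ∀ i, ∀ ν ∈ Γ, ∀ n : ℤ, ν ^ n = μ i → n = 1 ∨ n = -1
  exhaustive : ∀ ν ∈ Γ, IsParabolic ν → ∃ i, ∃ γ ∈ Γ, center (γ * μ i * γ⁻¹) = center ν
  distinct : ∀ i j, ∀ γ ∈ Γ, center (γ * μ i * γ⁻¹) = center (μ j) → i = j

variable (Γ : Subgroup PSL(2, ℂ)) {h k : ℕ} (μ : Fin h → PSL(2, ℂ)) (H H' : Fin k → PSL(2, ℂ))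

/-- The horospheres in hyperbolic space that are lifts of the cusp cross-sections on which the
meridians `μ` have length one, each with its meridional translation. -/
def horospheres : Set PSL(2, ℂ) := {m | ∃ i, ∃ γ ∈ Γ, m = γ * μ i * γ⁻¹}

/-- The union of the open horoball neighbourhoods of the cusps bounded by the cusp cross-sections
pushed into the cusps by the distance `log s`. -/
def cuspNbhd (s : ℝ) : Set (Mfd Γ) := proj Γ '' {x | ∃ m ∈ horospheres Γ μ, s < heightAt m x}

/-- The union of the cusp cross-sections pushed into the cusps by the distance `log s`. -/
def cuspTori (s : ℝ) : Set (Mfd Γ) := proj Γ '' {x | ∃ m ∈ horospheres Γ μ, heightAt m x = s}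

/-! ### Isotopies, tubular neighbourhoods, handlebodies -/

/-- The arcs `a` and `c`, parametrized by `[0, 1]`, are isotopic through embedded arcs with fixed
endpoints. -/
def ArcIsotopic {X : Type} [TopologicalSpace X] (a c : ℝ → X) : Prop :=
  ∃ F : ℝ × ℝ → X, ContinuousOn F (Icc 0 1 ×ˢ Icc 0 1) ∧
    (∀ τ ∈ Icc (0 : ℝ) 1, InjOn (fun r => F (τ, r)) (Icc 0 1)) ∧
    (∀ r ∈ Icc (0 : ℝ) 1, F (0, r) = a r ∧ F (1, r) = c r) ∧
    (∀ τ ∈ Icc (0 : ℝ) 1, F (τ, 0) = a 0 ∧ F (τ, 1) = a 1)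

/-- The standard handlebody of genus `g`: the product of a disc with `g` holes and `[0, 1]`. -/
def stdHandlebody (g : ℕ) : Set (ℂ × ℝ) :=
  {v : ℂ | ‖v‖ ≤ g + 1 ∧ ∀ i < g, 1 / 4 ≤ ‖v - (i : ℂ)‖} ×ˢ Icc 0 1

/-- The subset `E` of a space is a handlebody that is bounded by its frontier. -/
def IsHandlebody {X : Type} [TopologicalSpace X] (E : Set X) : Prop :=
  ∃ g : ℕ, ∃ φ : stdHandlebody g ≃ₜ E,
    ∀ p : stdHandlebody g, (p : ℂ × ℝ) ∈ frontier (stdHandlebody g) ↔ (φ p : X) ∈ frontier E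

/-- `T` parametrizes, by the product of the closed unit disc and `[0, 1]`, a tubular neighbourhood
of the arc `c` in the complement of the open cusp neighbourhoods, meeting the bounding tori exactly
in the two end discs. -/
structure IsTube (s : ℝ) (c : ℝ → Mfd Γ) (T : ℂ × ℝ → Mfd Γ) : Prop where
  cont : ContinuousOn T (Metric.closedBall 0 1 ×ˢ Icc 0 1)
  inj : InjOn T (Metric.closedBall 0 1 ×ˢ Icc 0 1)
  core : ∀ r ∈ Icc (0 : ℝ) 1, T (0, r) = c r
  outside : ∀ v ∈ Metric.closedBall (0 : ℂ) 1, ∀ r ∈ Icc (0 : ℝ) 1, T (v, r) ∉ cuspNbhd Γ μ s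
  ends : ∀ v ∈ Metric.closedBall (0 : ℂ) 1, ∀ r ∈ Icc (0 : ℝ) 1,
    T (v, r) ∈ cuspTori Γ μ s ↔ r = 0 ∨ r = 1

/-- The intercusp arcs that are the images in `M` of the geodesics between the horospheres `H j` and
`H' j` form a tunnel collection: they can be isotoped, with fixed endpoints, so that they have
disjoint tubular neighbourhoods, and so that removing open horoball neighbourhoods of the cusps and
the open tubular neighbourhoods leaves a handlebody. The cusp cross-sections are first
pushed slightly into the cusps, and the arcs prolonged accordingly, because the cross-sections with
meridians of length one may touch. -/
structure IsTunnelCollection : Prop where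
  mem_left : ∀ j, H j ∈ horospheres Γ μ
  mem_right : ∀ j, H' j ∈ horospheres Γ μ
  ne : ∀ j, H j ≠ H' j
  isotopy : ∃ s : ℝ, 1 < s ∧ ∃ (c : Fin k → ℝ → Mfd Γ) (T : Fin k → ℂ × ℝ → Mfd Γ),
    (∀ j, ArcIsotopic (fun r => proj Γ (geodArc s (H j) (H' j) r)) (c j)) ∧
    (∀ j, IsTube Γ μ s (c j) (T j)) ∧
    (∀ i j, i ≠ j → Disjoint (T i '' (Metric.closedBall 0 1 ×ˢ Icc 0 1))
      (T j '' (Metric.closedBall 0 1 ×ˢ Icc 0 1))) ∧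
    IsHandlebody ((cuspNbhd Γ μ s ∪ ⋃ j, T j '' (Metric.ball 0 1 ×ˢ Icc 0 1))ᶜ)

/-- The geodesic between the horospheres `A` and `B` is a lift of one of the arcs, in either
direction. -/
def IsLiftOfArc (A B : PSL(2, ℂ)) : Prop :=
  ∃ j, ∃ γ ∈ Γ, (A = γ * H j * γ⁻¹ ∧ B = γ * H' j * γ⁻¹) ∨ (A = γ * H' j * γ⁻¹ ∧ B = γ * H j * γ⁻¹)

end HypThree

end

noncomputable section

namespace HypThree

/-! ### Lifts to `SL(2, ℂ)` -/

/-! Put a horosphere in position `g`. Up to sign, its data are the bottom row of `g`, and the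
symplectic pairing `br` of bottom rows governs everything: w = -1/br² and u = br₁₃/(br₁₂ br₂₃)
(`intercuspParameter_eq`, `translationParameter_eq`). The first formula needs |br| ≥ 1, so that the
open horoballs are disjoint; this follows from Shimizu's lemma (`one_le_norm_br`).

The parameters lie in k(M) because squares of meridians are conjugates of z ↦ z + 2. Traces of
products of two or three of them yield br² and br₁₂ br₂₃ br₁₃ (`trace_two`, `trace_three`), and w
and u are quotients of such elements.

Conversely, let F contain the parameters w and u of all lifts of arcs. Each oriented lift has a
frame, a basis of ℂ² made of the two bottom rows. Reversing the arc or turning to another arc at the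
same horosphere changes the frame by a matrix over F, up to a scalar (`frame_swap`, `frame_turn`).
Since any two horospheres are joined by a chain of lifts, every element of Γ is, in one fixed frame,
a matrix over F up to a scalar. The square of the scalar lies in F by comparison of determinants, so
the squares generate a group with traces in F (`sq_mem_rationalSubgroup`, `invariantTraceField_le`).

Chains exist because the preimage in ℍ³ of the closed complement of the handlebody, that is, of
horoballs and tubes, is connected (`isPreconnected_preimage_closure_compl`): the preimage of the
handlebody can be pushed into its boundary by lifting a contraction, without changing sides of a
hypothetical separation. If a set of horospheres were closed under lifts of arcs and proper, it
would separate horoballs and tubes into two closed pieces (`horospheres_subset_of_closed`).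

Finally, 2k values of u suffice, one per oriented arc (`exists_translationParameters`). Among the
oriented arcs leaving equivalent horospheres one is the root. It contributes a translation τ such
that all translations of the horosphere in Γ lie in ℚ + ℚτ; each other arc contributes its
displacement from the root. Every translation parameter is a difference of displacements plus such a
translation. -/

theorem eq_one_or_eq_neg_one_of_sq {r : ℂ} (h : r ^ 2 = 1) : r = 1 ∨ r = -1 := by
  simpa using h

theorem det_eq (A : SL(2, ℂ)) : A.1 0 0 * A.1 1 1 - A.1 0 1 * A.1 1 0 = 1 := by
  have h := A.2
  rwa [Matrix.det_fin_two] at h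

@[simp] theorem mul_entry (A B : SL(2, ℂ)) (i j : Fin 2) :
    (A * B).1 i j = A.1 i 0 * B.1 0 j + A.1 i 1 * B.1 1 j := by
  change (A.1 * B.1) i j = _
  rw [Matrix.mul_apply, Fin.sum_univ_two]

@[simp] theorem neg_entry (A : SL(2, ℂ)) (i j : Fin 2) : (-A).1 i j = -A.1 i j := rfl

theorem inv_val (A : SL(2, ℂ)) :
    (A⁻¹).1 = !![A.1 1 1, -A.1 0 1; -A.1 1 0, A.1 0 0] := by
  rw [Matrix.SpecialLinearGroup.SL2_inv_expl]; rfl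

@[simp] theorem inv_entry_zero_zero (A : SL(2, ℂ)) : (A⁻¹).1 0 0 = A.1 1 1 := by rw [inv_val]; rfl
@[simp] theorem inv_entry_zero_one (A : SL(2, ℂ)) : (A⁻¹).1 0 1 = -A.1 0 1 := by rw [inv_val]; rfl
@[simp] theorem inv_entry_one_zero (A : SL(2, ℂ)) : (A⁻¹).1 1 0 = -A.1 1 0 := by rw [inv_val]; rfl
@[simp] theorem inv_entry_one_one (A : SL(2, ℂ)) : (A⁻¹).1 1 1 = A.1 0 0 := by rw [inv_val]; rfl

theorem sl_ext {A B : SL(2, ℂ)} (h₀₀ : A.1 0 0 = B.1 0 0) (h₀₁ : A.1 0 1 = B.1 0 1)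
    (h₁₀ : A.1 1 0 = B.1 1 0) (h₁₁ : A.1 1 1 = B.1 1 1) : A = B := by
  ext i j; fin_cases i <;> fin_cases j <;> assumption

theorem toPSL_surjective : Function.Surjective toPSL := QuotientGroup.mk'_surjective _

theorem toPSL_eq_one_iff {A : SL(2, ℂ)} : toPSL A = 1 ↔ A = 1 ∨ A = -1 := by
  change (QuotientGroup.mk A : SL(2, ℂ) ⧸ _) = 1 ↔ _
  rw [QuotientGroup.eq_one_iff, Matrix.SpecialLinearGroup.mem_center_iff]
  constructor
  · rintro ⟨r, hr, h⟩
    have hr' : r ^ 2 = 1 := by simpa using hr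
    rcases eq_one_or_eq_neg_one_of_sq hr' with rfl | rfl
    · left; ext i j; rw [← h]; simp
    · right; apply sl_ext <;> rw [← h] <;> simp [Matrix.scalar_apply]
  · rintro (rfl | rfl)
    · exact ⟨1, by simp, by simp⟩
    · exact ⟨-1, by simp, by
        ext i j; fin_cases i <;> fin_cases j <;> simp [Matrix.scalar_apply]⟩

theorem toPSL_eq_iff {A B : SL(2, ℂ)} : toPSL A = toPSL B ↔ A = B ∨ A = -B := by
  rw [← mul_inv_eq_one, ← map_inv, ← map_mul, toPSL_eq_one_iff, mul_inv_eq_one,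
    mul_inv_eq_iff_eq_mul, neg_one_mul]

theorem mem_preim {Γ : Subgroup PSL(2, ℂ)} {A : SL(2, ℂ)} : A ∈ preim Γ ↔ toPSL A ∈ Γ := Iff.rfl

/-- The translation `z ↦ z + b`. -/
def transl (b : ℂ) : SL(2, ℂ) := ⟨!![1, b; 0, 1], by simp⟩

theorem transl_one : transl 1 = translOne := rfl

@[simp] theorem transl_entry_zero_zero (b : ℂ) : (transl b).1 0 0 = 1 := rfl
@[simp] theorem transl_entry_zero_one (b : ℂ) : (transl b).1 0 1 = b := rfl
@[simp] theorem transl_entry_one_zero (b : ℂ) : (transl b).1 1 0 = 0 := rfl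
@[simp] theorem transl_entry_one_one (b : ℂ) : (transl b).1 1 1 = 1 := rfl

@[simp] theorem transl_zero : transl 0 = 1 := by
  apply sl_ext <;> simp

theorem transl_mul (a b : ℂ) : transl a * transl b = transl (a + b) := by
  apply sl_ext <;> simp [add_comm]

theorem transl_inv (a : ℂ) : (transl a)⁻¹ = transl (-a) := by
  rw [inv_eq_iff_mul_eq_one, transl_mul]; simp

/-- The symplectic pairing of the bottom rows of two matrices. -/
def br (g g' : SL(2, ℂ)) : ℂ := g.1 1 0 * g'.1 1 1 - g.1 1 1 * g'.1 1 0

theorem mul_inv_apply_one_zero (g g' : SL(2, ℂ)) : (g * g'⁻¹).1 1 0 = br g g' := by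
  simp [br]; ring

theorem br_mul_right (g g' A : SL(2, ℂ)) : br (g * A) (g' * A) = br g g' := by
  rw [← mul_inv_apply_one_zero, ← mul_inv_apply_one_zero]; simp [mul_assoc]

theorem br_transl_left (b : ℂ) (g g' : SL(2, ℂ)) : br (transl b * g) g' = br g g' := by
  simp [br]

theorem br_neg_left (g g' : SL(2, ℂ)) : br (-g) g' = -br g g' := by
  simp [br]; ring

theorem br_swap (g g' : SL(2, ℂ)) : br g g' = -br g' g := by
  simp [br]; ring

@[simp] theorem br_self (g : SL(2, ℂ)) : br g g = 0 := by
  simp [br]; ring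

/-- Two matrices commute up to sign with a translation only if they are translations up to sign. -/
theorem eq_transl_of_commute {B : SL(2, ℂ)}
    (h : toPSL B * toPSL translOne = toPSL translOne * toPSL B) :
    ∃ b, B = transl b ∨ B = -transl b := by
  rw [← transl_one] at h
  rw [← map_mul, ← map_mul, toPSL_eq_iff] at h
  have hd := det_eq B
  have hc : B.1 1 0 = 0 ∧ B.1 0 0 = B.1 1 1 := by
    rcases h with h | h
    · have h0 : B.1 0 0 + B.1 0 1 = B.1 0 1 + B.1 1 1 := by
        simpa using congrArg (fun X : SL(2, ℂ) => X.1 0 1) h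
      have h1 : B.1 0 0 = B.1 0 0 + B.1 1 0 := by
        simpa using congrArg (fun X : SL(2, ℂ) => X.1 0 0) h
      exact ⟨by linear_combination -h1, by linear_combination h0⟩
    -- Anticommuting matrices would have vanishing first column, against determinant one.
    · have h0 : B.1 0 0 = -B.1 1 0 + -B.1 0 0 := by
        simpa using congrArg (fun X : SL(2, ℂ) => X.1 0 0) h
      have h1 : B.1 1 0 = -B.1 1 0 := by
        simpa using congrArg (fun X : SL(2, ℂ) => X.1 1 0) h
      have h2 : B.1 1 0 = 0 := by linear_combination h1 / 2
      have h3 : B.1 0 0 = 0 := by linear_combination h0 / 2 - h2 / 2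
      rw [h2, h3] at hd
      simp at hd
  obtain ⟨hc, ha⟩ := hc
  have hs : B.1 1 1 ^ 2 = 1 := by rw [hc, ha] at hd; linear_combination hd
  rcases eq_one_or_eq_neg_one_of_sq hs with h1 | h1
  · refine ⟨B.1 0 1, Or.inl ?_⟩
    apply sl_ext <;> simp [ha, hc, h1]
  · refine ⟨-B.1 0 1, Or.inr ?_⟩
    apply sl_ext <;> simp [ha, hc, h1]

/-! ### Positions, centers and the bracket of two horospheres -/

variable {m m' m₁ m₂ m₃ : PSL(2, ℂ)} {g g' g₁ g₂ g₃ : SL(2, ℂ)}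

theorem IsParabolic.position_spec (hm : IsParabolic m) : IsPosition m (position m) :=
  Classical.epsilon_spec hm

theorem IsPosition.eq (hg : IsPosition m g) : m = toPSL (g⁻¹ * translOne * g) := by
  rw [map_mul, map_mul, ← hg, map_inv]; group

theorem isPosition_iff : IsPosition m g ↔ m = toPSL (g⁻¹ * translOne * g) := by
  refine ⟨IsPosition.eq, ?_⟩
  rintro rfl
  simp only [IsPosition, map_mul, map_inv]; group

theorem IsPosition.isParabolic (hg : IsPosition m g) : IsParabolic m := ⟨g, hg⟩

/-- Both positions conjugate `m` to the same translation, so their quotient commutes with it in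
PSL(2, ℂ) and is itself a translation up to sign. -/
theorem IsPosition.unique (hg : IsPosition m g) (hg' : IsPosition m g') :
    ∃ b, g' = transl b * g ∨ g' = -(transl b * g) := by
  have h : toPSL (g' * g⁻¹) * toPSL translOne = toPSL translOne * toPSL (g' * g⁻¹) := by
    unfold IsPosition at hg hg'
    have h1 : toPSL g * m = toPSL translOne * toPSL g := mul_inv_eq_iff_eq_mul.1 hg
    have h2 : toPSL g' * m = toPSL translOne * toPSL g' := mul_inv_eq_iff_eq_mul.1 hg'
    have h3 : toPSL translOne = toPSL g * m * (toPSL g)⁻¹ := hg.symm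
    rw [map_mul, map_inv, ← mul_assoc, ← h2, h3]; group
  obtain ⟨b, hb | hb⟩ := eq_transl_of_commute h
  · exact ⟨b, Or.inl (mul_inv_eq_iff_eq_mul.1 hb)⟩
  · exact ⟨b, Or.inr (by rw [mul_inv_eq_iff_eq_mul.1 hb, neg_mul])⟩

theorem IsPosition.transl_mul (hg : IsPosition m g) (b : ℂ) : IsPosition m (transl b * g) := by
  rw [isPosition_iff] at hg ⊢
  have : (transl b)⁻¹ * translOne * transl b = translOne := by
    rw [transl_inv, ← transl_one, HypThree.transl_mul, HypThree.transl_mul]; refine congrArg HypThree.transl ?_; ring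
  rw [hg]; refine congrArg toPSL ?_
  calc g⁻¹ * translOne * g = g⁻¹ * ((transl b)⁻¹ * translOne * transl b) * g := by rw [this]
    _ = _ := by group

theorem IsPosition.conj (hg : IsPosition m g) (A : SL(2, ℂ)) :
    IsPosition (toPSL A * m * (toPSL A)⁻¹) (g * A⁻¹) := by
  rw [isPosition_iff] at hg ⊢
  rw [hg]; simp only [map_mul, map_inv]; group

theorem IsParabolic.conj (hm : IsParabolic m) (γ : PSL(2, ℂ)) : IsParabolic (γ * m * γ⁻¹) := by
  obtain ⟨g, hg⟩ := hm
  obtain ⟨A, rfl⟩ := toPSL_surjective γ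
  exact ⟨_, hg.conj A⟩

theorem IsPosition.br_eq_or (hg : IsPosition m g) (hg' : IsPosition m g') (x : SL(2, ℂ)) :
    br g' x = br g x ∨ br g' x = -br g x := by
  obtain ⟨b, rfl | rfl⟩ := hg.unique hg'
  · exact Or.inl (br_transl_left _ _ _)
  · exact Or.inr (by rw [br_neg_left, br_transl_left])

/-- The bracket of two positions, up to sign, depends on the horospheres only. -/
theorem br_sq_eq (h₁ : IsPosition m₁ g₁) (h₁' : IsPosition m₁ g) (h₂ : IsPosition m₂ g₂)
    (h₂' : IsPosition m₂ g') : br g g' ^ 2 = br g₁ g₂ ^ 2 := by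
  rcases h₁.br_eq_or h₁' g' with e | e <;> rcases h₂.br_eq_or h₂' g₁ with e' | e' <;>
    rw [e, br_swap, e', br_swap] <;> ring

theorem br_ne_zero_of (h₁ : IsPosition m₁ g₁) (h₁' : IsPosition m₁ g) (h₂ : IsPosition m₂ g₂)
    (h₂' : IsPosition m₂ g') (h : br g₁ g₂ ≠ 0) : br g g' ≠ 0 := by
  have := br_sq_eq h₁ h₁' h₂ h₂'
  intro h0
  rw [h0, zero_pow two_ne_zero, eq_comm, sq_eq_zero_iff] at this
  exact h this

theorem gl_smul_eq {A : SL(2, ℂ)} {i j : Fin 2} : (A : GL (Fin 2) ℂ) i j = A.1 i j := rfl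

/-- Frees `center` from the chosen position: two positions differ by an element that fixes ∞. -/
theorem IsPosition.smul_center_eq (hg : IsPosition m g) (x : SL(2, ℂ)) :
    (x : GL (Fin 2) ℂ) • center m =
      ((x * g⁻¹ : SL(2, ℂ)) : GL (Fin 2) ℂ) • (∞ : OnePoint ℂ) := by
  have key : ((position m * g⁻¹ : SL(2, ℂ)) : GL (Fin 2) ℂ) • (∞ : OnePoint ℂ) = ∞ := by
    rw [OnePoint.smul_infty_eq_self_iff, gl_smul_eq, mul_inv_apply_one_zero]
    rcases hg.br_eq_or hg.isParabolic.position_spec g with h | h <;> simp [h]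
  have : center m = ((g⁻¹ : SL(2, ℂ)) : GL (Fin 2) ℂ) • (∞ : OnePoint ℂ) := by
    rw [center, inv_smul_eq_iff, smul_smul]
    simpa using key.symm
  rw [this, smul_smul]; simp

theorem center_eq_center_iff (hg : IsPosition m g) (hg' : IsPosition m' g') :
    center m = center m' ↔ br g g' = 0 := by
  rw [← (MulAction.injective (g : GL (Fin 2) ℂ)).eq_iff, hg.smul_center_eq, hg'.smul_center_eq,
    mul_inv_cancel]
  simp only [map_one, one_smul]
  rw [eq_comm, OnePoint.smul_infty_eq_self_iff, gl_smul_eq, mul_inv_apply_one_zero]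

/-- The image of ∞ is the quotient of the entries of the first column, and the upper left entry of a
matrix is the lower right entry of its inverse. -/
theorem smul_center_eq_zero_iff (hg' : IsPosition m' g') (x : SL(2, ℂ)) :
    (x : GL (Fin 2) ℂ) • center m' = ((0 : ℂ) : OnePoint ℂ) ↔ (g' * x⁻¹).1 1 1 = 0 := by
  have hx : (g' * x⁻¹).1 1 1 = (x * g'⁻¹).1 0 0 := by
    simp; ring
  rw [hg'.smul_center_eq, hx]
  have hd := det_eq (x * g'⁻¹)
  rw [OnePoint.smul_infty_eq_ite, gl_smul_eq, gl_smul_eq]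
  split_ifs with h
  · simp only [OnePoint.infty_ne_coe, false_iff]
    intro h0
    rw [h, h0] at hd
    simp at hd
  · rw [OnePoint.coe_eq_coe, div_eq_zero_iff, or_iff_left h]

/-- Horospheres with different centers have an adapted position. -/
theorem exists_isAdapted (hg : IsPosition m g) (hg' : IsPosition m' g') (h : br g' g ≠ 0) :
    IsAdapted m m' (transl ((g' * g⁻¹).1 1 1 / br g' g) * g) := by
  -- In position `g` the center of `m'` is the pole -d/c of `g' * g⁻¹`, whose lower left entry c is
  -- `br g' g`; the translation by d/c moves it to 0.
  refine ⟨hg.transl_mul _, (smul_center_eq_zero_iff hg' _).2 ?_⟩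
  rw [mul_inv_rev, ← mul_assoc, transl_inv]
  have := mul_inv_apply_one_zero g' g
  generalize g' * g⁻¹ = B at *
  rw [← this] at h ⊢
  simp
  field_simp
  ring

theorem adapted_spec (hg : IsPosition m g) (hg' : IsPosition m' g') (h : br g g' ≠ 0) :
    IsAdapted m m' (adapted m m') :=
  Classical.epsilon_spec ⟨_, exists_isAdapted hg hg' (by rwa [br_swap, neg_ne_zero])⟩

end HypThree

end

noncomputable section

namespace HypThree

/-! ### Heights and distances -/

theorem smul_t (A : SL(2, ℂ)) (x : H3) : (A • x).t = x.t / H3.den A x := rfl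

open ComplexConjugate in
theorem smul_z (A : SL(2, ℂ)) (x : H3) :
    (A • x).z = ((A.1 0 0 * x.z + A.1 0 1) * conj (A.1 1 0 * x.z + A.1 1 1)
      + A.1 0 0 * conj (A.1 1 0) * (x.t : ℂ) ^ 2) / (H3.den A x : ℂ) := rfl

theorem herm_smul (A : SL(2, ℂ)) (x : H3) :
    H3.herm (A • x) = A.1 * H3.herm x * A.1.conjTranspose := H3.herm_act A x

@[simp] theorem neg_smul_H3 (A : SL(2, ℂ)) (x : H3) : (-A) • x = A • x := by
  apply H3.herm_injective
  rw [herm_smul, herm_smul]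
  have : (-A).1 = -A.1 := rfl
  simp [this]

theorem smul_eq_of_toPSL_eq {A B : SL(2, ℂ)} (h : toPSL A = toPSL B) (x : H3) : A • x = B • x := by
  rcases toPSL_eq_iff.1 h with rfl | rfl <;> simp

theorem transl_smul (b : ℂ) (x : H3) : transl b • x = ⟨x.z + b, x.t, x.pos⟩ := by
  have : H3.den (transl b) x = 1 := by simp [H3.den]
  apply H3.ext
  · rw [smul_z, this]; simp
  · rw [smul_t, this]; simp

variable {m m' m₁ m₂ m₃ : PSL(2, ℂ)} {g g' g₁ g₂ g₃ p : SL(2, ℂ)}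

theorem IsPosition.smul_t_eq (hg : IsPosition m g) (hg' : IsPosition m g') (x : H3) :
    (g' • x).t = (g • x).t := by
  obtain ⟨b, rfl | rfl⟩ := hg.unique hg'
  · rw [mul_smul, transl_smul]
  · rw [neg_smul_H3, mul_smul, transl_smul]

theorem IsPosition.heightAt_eq (hg : IsPosition m g) (x : H3) : heightAt m x = (g • x).t :=
  hg.smul_t_eq hg.isParabolic.position_spec x

theorem heightAt_conj_smul (hm : IsParabolic m) (A : SL(2, ℂ)) (x : H3) :
    heightAt (toPSL A * m * (toPSL A)⁻¹) (A • x) = heightAt m x := by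
  obtain ⟨g, hg⟩ := hm
  rw [(hg.conj A).heightAt_eq, hg.heightAt_eq, mul_smul, inv_smul_smul]

/-- Two horoballs whose bracket has norm at least one are tangent or disjoint. -/
theorem heightAt_mul_heightAt_le (hg : IsPosition m g) (hg' : IsPosition m' g')
    (h : 1 ≤ ‖br g g'‖) (x : H3) : heightAt m x * heightAt m' x ≤ 1 := by
  rw [hg.heightAt_eq, hg'.heightAt_eq]
  have e : g' • x = (g' * g⁻¹) • g • x := by rw [mul_smul, inv_smul_smul]
  rw [e]
  generalize g • x = y
  rw [smul_t, ← mul_div_assoc, div_le_one (H3.den_pos _ _), H3.den, mul_inv_apply_one_zero,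
    br_swap, Complex.normSq_neg, Complex.normSq_eq_norm_sq (br g g')]
  have h1 := Complex.normSq_nonneg (-br g g' * y.z + (g' * g⁻¹).1 1 1)
  have h2 : 1 ≤ ‖br g g'‖ ^ 2 := one_le_pow₀ h
  nlinarith [mul_le_mul_of_nonneg_right h2 (sq_nonneg y.t)]

/-- `2 cosh` of the distance as the trace form of Hermitian matrices. -/
theorem trace_herm (x y : H3) :
    ((H3.herm x * (H3.herm y).adjugate).trace : ℂ) =
      (((‖x.z - y.z‖ ^ 2 + (x.t - y.t) ^ 2) / (x.t * y.t) + 2 : ℝ) : ℂ) := by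
  have hx : (x.t : ℂ) ≠ 0 := Complex.ofReal_ne_zero.2 x.pos.ne'
  have hy : (y.t : ℂ) ≠ 0 := Complex.ofReal_ne_zero.2 y.pos.ne'
  push_cast
  rw [← Complex.mul_conj', Matrix.adjugate_fin_two, Matrix.trace_fin_two]
  simp [H3.herm, Matrix.mul_apply]
  field_simp
  ring

/-- The distance is a function of the trace of h(x) adj(h(y)), which is invariant because A of
determinant one acts on Hermitian matrices by h ↦ A h A*. -/
theorem hdist_smul (A : SL(2, ℂ)) (x y : H3) : H3.hdist (A • x) (A • y) = H3.hdist x y := by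
  have key : ∀ x y : H3, H3.hdist x y =
      2 * Real.arsinh (Real.sqrt ((‖x.z - y.z‖ ^ 2 + (x.t - y.t) ^ 2) / (x.t * y.t)) / 2) := by
    intro x y
    rw [H3.hdist, Real.sqrt_div' _ (mul_pos x.pos y.pos).le]
    congr 2
    ring
  have h : ((H3.herm (A • x) * (H3.herm (A • y)).adjugate).trace : ℂ) =
      (H3.herm x * (H3.herm y).adjugate).trace := by
    rw [herm_smul, herm_smul, Matrix.adjugate_mul_distrib, Matrix.adjugate_mul_distrib]
    have hA : A.1.conjTranspose * A.1.conjTranspose.adjugate = 1 := by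
      rw [Matrix.mul_adjugate, Matrix.det_conjTranspose, A.2]; simp
    have hA' : A.1.adjugate * A.1 = 1 := by
      rw [Matrix.adjugate_mul, A.2]; simp
    calc _ = (A.1 * (H3.herm x * (A.1.conjTranspose * A.1.conjTranspose.adjugate) *
              (H3.herm y).adjugate * A.1.adjugate)).trace := by simp only [Matrix.mul_assoc]
      _ = _ := by rw [Matrix.trace_mul_comm, hA, Matrix.mul_assoc, hA']; simp
  rw [trace_herm, trace_herm, Complex.ofReal_inj, add_left_inj] at h
  rw [key, key, h]

theorem hdist_vertical {a : ℝ} (ha : 0 ≤ a) :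
    H3.hdist ⟨0, 1, one_pos⟩ ⟨0, Real.exp (-a), Real.exp_pos _⟩ = a := by
  have h1 : Real.exp (-a) ≤ 1 := Real.exp_le_one_iff.2 (by linarith)
  have h2 : Real.sqrt (Real.exp (-a)) = Real.exp (-(a / 2)) := by
    rw [← Real.exp_half]; congr 1; ring
  have h3 : Real.exp (-a) = Real.exp (-(a / 2)) * Real.exp (-(a / 2)) := by
    rw [← Real.exp_add]; congr 1; ring
  have h4 : (1 - Real.exp (-a)) / (2 * Real.exp (-(a / 2))) = Real.sinh (a / 2) := by
    rw [Real.sinh_eq, h3, div_eq_div_iff (by positivity) two_ne_zero, sub_mul, sub_mul]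
    have : Real.exp (a / 2) * Real.exp (-(a / 2)) = 1 := by rw [← Real.exp_add]; simp
    linear_combination (-2) * this
  simp only [H3.hdist, sub_self, norm_zero, one_mul]
  rw [zero_pow two_ne_zero, zero_add, Real.sqrt_sq (by linarith), h2, h4, Real.arsinh_sinh]
  ring

/-- Dropping the horizontal displacement only shortens the distance, and a vertical segment has the
logarithm of the ratio of heights as its length. -/
theorem le_hdist {a : ℝ} (ha : 0 ≤ a) {x y : H3} (hx : x.t = 1) (hy : y.t ≤ Real.exp (-a)) :
    a ≤ H3.hdist x y := by
  obtain ⟨b, hb⟩ : ∃ b, y.t = Real.exp (-b) := ⟨-Real.log y.t, by rw [neg_neg, Real.exp_log y.pos]⟩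
  have hab : a ≤ b := by
    rw [hb, Real.exp_le_exp] at hy; linarith
  refine hab.trans ?_
  rw [← hdist_vertical (ha.trans hab), H3.hdist, H3.hdist, hx, hb]
  gcongr
  simp

/-! ### Intercusp parameters in terms of the bracket -/

theorem den_of_entry_eq_zero {B : SL(2, ℂ)} (hB : B.1 1 1 = 0) (y : H3) :
    H3.den B y = ‖B.1 1 0‖ ^ 2 * (‖y.z‖ ^ 2 + y.t ^ 2) := by
  simp [H3.den, hB, Complex.normSq_eq_norm_sq]; ring

theorem IsAdapted.entry_eq_zero (h : IsAdapted m m' g) (hg' : IsPosition m' g') :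
    (g' * g⁻¹).1 1 1 = 0 := (smul_center_eq_zero_iff hg' g).1 h.2

/-- In adapted position the horosphere of `m'` is a sphere tangent to the boundary at 0 with top at
height |br|⁻². The bound on |br| keeps this top below the plane t = 1; otherwise the logarithm would
be negative. -/
theorem horoDist_eq_of_isAdapted (h : IsAdapted m m' g) (hg' : IsPosition m' g')
    (h1 : 1 ≤ ‖br g' g‖) : horoDist m m' = Real.log (‖br g' g‖ ^ 2) := by
  have h2 : 1 ≤ ‖br g' g‖ ^ 2 := one_le_pow₀ h1
  have hd : 0 ≤ Real.log (‖br g' g‖ ^ 2) := Real.log_nonneg h2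
  have he : Real.exp (-Real.log (‖br g' g‖ ^ 2)) = (‖br g' g‖ ^ 2)⁻¹ := by
    rw [Real.exp_neg, Real.exp_log (by linarith)]
  have hB := h.entry_eq_zero hg'
  have hc := mul_inv_apply_one_zero g' g
  have hht : ∀ y, heightAt m' y = ((g' * g⁻¹) • g • y).t := by
    intro y; rw [hg'.heightAt_eq, mul_smul, inv_smul_smul]
  refine IsLeast.csInf_eq ⟨⟨g⁻¹ • ⟨0, 1, one_pos⟩,
    g⁻¹ • ⟨0, Real.exp (-Real.log (‖br g' g‖ ^ 2)), Real.exp_pos _⟩, ?_, ?_, ?_⟩, ?_⟩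
  · rw [h.1.heightAt_eq, smul_inv_smul]
  · rw [hht, smul_inv_smul, smul_t, den_of_entry_eq_zero hB, hc]
    simp only [he]
    field_simp
    simp
  · rw [hdist_smul, hdist_vertical hd]
  · rintro r ⟨x, y, hx, hy, rfl⟩
    rw [← hdist_smul g]
    rw [h.1.heightAt_eq] at hx
    refine le_hdist hd hx ?_
    rw [hht, smul_t, den_of_entry_eq_zero hB, hc, div_eq_one_iff_eq] at hy
    · rw [he, ← one_div, le_div_iff₀ (by linarith)]
      have := (g • y).pos
      nlinarith [mul_nonneg (zero_le_one.trans h2) (sq_nonneg ‖(g • y).z‖)]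
    · have := (g • y).pos
      positivity

/-- With vanishing lower right entry, the map along the horizontal line at height y is x ↦ a/c - c⁻²
x/(x² + y²). -/
theorem deriv_smul_z {B : SL(2, ℂ)} (hB : B.1 1 1 = 0) (d : ℝ) :
    deriv (fun x : ℝ => (B • (⟨x, Real.exp d, Real.exp_pos _⟩ : H3)).z) 0 =
      ((1 / Real.exp d ^ 2 : ℝ) : ℂ) * (-1 / B.1 1 0 ^ 2) := by
  set q := B.1 1 0
  have hdet := det_eq B
  have h0 : q ≠ 0 := by
    rintro h0
    change B.1 0 0 * B.1 1 1 - B.1 0 1 * q = 1 at hdet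
    rw [hB, h0] at hdet
    simp at hdet
  have hb : B.1 0 1 = -1 / q := by
    rw [hB] at hdet
    rw [eq_div_iff h0]; linear_combination -hdet
  have hq : (starRingEnd ℂ) q ≠ 0 := by simpa using h0
  have hf : (fun x : ℝ => (B • (⟨x, Real.exp d, Real.exp_pos _⟩ : H3)).z) =
      fun x : ℝ => B.1 0 0 / q + (-1 / q ^ 2) * ((x / (x ^ 2 + Real.exp d ^ 2) : ℝ) : ℂ) := by
    funext x
    have hpos : (0 : ℝ) < x ^ 2 + Real.exp d ^ 2 := by positivity
    have hne : ((x : ℂ) ^ 2 + (Real.exp d : ℂ) ^ 2) ≠ 0 := by exact_mod_cast hpos.ne'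
    have hden : (H3.den B ⟨x, Real.exp d, Real.exp_pos _⟩ : ℂ) =
        q * (starRingEnd ℂ) q * ((x : ℂ) ^ 2 + (Real.exp d : ℂ) ^ 2) := by
      rw [den_of_entry_eq_zero hB, Complex.mul_conj']
      push_cast
      rw [← Complex.mul_conj' (x : ℂ), Complex.conj_ofReal]
      ring
    rw [smul_z, hden, hb, hB]
    simp only [add_zero, map_mul, Complex.conj_ofReal]
    push_cast
    change ((B.1 0 0 * x + -1 / q) * ((starRingEnd ℂ) q * x) + B.1 0 0 * (starRingEnd ℂ) q *
      (Complex.exp d) ^ 2) / _ = _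
    rw [Complex.ofReal_exp] at hne
    field_simp
    ring
  have hder : HasDerivAt (fun x : ℝ => x / (x ^ 2 + Real.exp d ^ 2)) (1 / Real.exp d ^ 2) 0 := by
    have h1 : HasDerivAt (fun x : ℝ => x ^ 2 + Real.exp d ^ 2) 0 0 := by
      simpa using (hasDerivAt_pow 2 (0 : ℝ)).add_const (Real.exp d ^ 2)
    convert! (hasDerivAt_id (0 : ℝ)).div h1 (by positivity) using 1
    simp
    field_simp
  rw [hf, ((hder.ofReal_comp.const_mul (-1 / q ^ 2)).const_add (B.1 0 0 / q)).deriv, mul_comm]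

theorem rotAngle_eq_of_isAdapted (hp : IsPosition m' (position m'))
    (h : IsAdapted m m' (adapted m m')) :
    rotAngle m m' = -Complex.arg (-1 / br (position m') (adapted m m') ^ 2) := by
  rw [rotAngle, deriv_smul_z (h.entry_eq_zero hp), Complex.arg_real_mul _ (by positivity),
    mul_inv_apply_one_zero]

/-- The distance gives the modulus |br|⁻² and the angle gives the argument of -1/br²; since br
enters squared, the choice of positions is irrelevant. -/
theorem intercuspParameter_eq (hg : IsPosition m g) (hg' : IsPosition m' g')
    (h : 1 ≤ ‖br g g'‖) : intercuspParameter m m' = -1 / br g g' ^ 2 := by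
  have h0 : br g g' ≠ 0 := by
    rintro h0
    rw [h0, norm_zero] at h
    linarith
  have had := adapted_spec hg hg' h0
  have hp := hg'.isParabolic.position_spec
  have e : br (position m') (adapted m m') ^ 2 = br g g' ^ 2 := by
    rw [← br_sq_eq hg had.1 hg' hp, br_swap]; ring
  have hn : ‖br (position m') (adapted m m')‖ = ‖br g g'‖ := by
    have := congrArg norm e
    rw [norm_pow, norm_pow] at this
    exact (pow_left_inj₀ (norm_nonneg _) (norm_nonneg _) two_ne_zero).1 this
  rw [intercuspParameter, complexDistance, horoDist_eq_of_isAdapted had hp (hn ▸ h),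
    rotAngle_eq_of_isAdapted hp had, hn, e]
  have key := Complex.norm_mul_exp_arg_mul_I (-1 / br g g' ^ 2)
  refine Eq.trans ?_ key
  rw [neg_add, Complex.exp_add, ← Complex.ofReal_neg, ← Complex.ofReal_exp, Real.exp_neg,
    Real.exp_log (by positivity)]
  congr 1
  · simp
  · congr 1; push_cast; ring

/-! ### Translation parameters -/

/-- The foot lies vertically above the center of `m'`, whose coordinate is the pole -d/c of `g' *
p⁻¹`. -/
theorem smul_foot_z (hp : IsPosition m p) (hg' : IsPosition m' g') (h : br g' p ≠ 0) :
    (p • foot m m').z = -(g' * p⁻¹).1 1 1 / br g' p := by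
  have had := adapted_spec hp hg' (by rwa [br_swap, neg_ne_zero])
  have hB := had.entry_eq_zero hg'
  rw [foot]
  obtain ⟨b, hb⟩ := had.1.unique hp
  have hz : (p • (adapted m m')⁻¹ • (⟨0, 1, one_pos⟩ : H3)).z = b := by
    rcases hb with hb | hb <;> rw [hb]
    · rw [mul_smul, smul_inv_smul, transl_smul]; simp
    · rw [neg_smul_H3, mul_smul, smul_inv_smul, transl_smul]; simp
  rw [hz, eq_div_iff h, ← mul_inv_apply_one_zero]
  have hB' : g'.1 1 1 * (adapted m m').1 0 0 = g'.1 1 0 * (adapted m m').1 0 1 := by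
    simp at hB; linear_combination hB
  rcases hb with hb | hb <;> rw [hb] <;> simp
  · linear_combination hB'
  · linear_combination -hB'

theorem translationParameter_eq (h₁ : IsPosition m₁ g₁) (h₂ : IsPosition m₂ g₂)
    (h₃ : IsPosition m₃ g₃) (h₁₂ : br g₁ g₂ ≠ 0) (h₂₃ : br g₂ g₃ ≠ 0) :
    translationParameter m₁ m₂ m₃ = br g₁ g₃ / (br g₁ g₂ * br g₂ g₃) := by
  have hp := h₂.isParabolic.position_spec
  have hne : ∀ g, br g g₂ ≠ 0 → br g (position m₂) ≠ 0 := by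
    intro g hg
    rcases h₂.br_eq_or hp g with e | e <;> rw [br_swap, e, br_swap] <;> simpa using hg
  have h1 : br g₁ (position m₂) ≠ 0 := hne _ h₁₂
  have h3 : br g₃ (position m₂) ≠ 0 := hne _ (by rwa [br_swap, neg_ne_zero])
  -- The middle position occurs in both factors, so its sign ambiguity cancels.
  have hprod : br g₁ g₂ * br g₂ g₃ = -(br g₁ (position m₂) * br g₃ (position m₂)) := by
    rw [br_swap g₁, br_swap g₁, br_swap g₃ (position m₂)]
    rcases h₂.br_eq_or hp g₁ with e | e
    · obtain ⟨b, hb | hb⟩ := h₂.unique hp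
      · rw [hb]; simp only [br_transl_left]; ring
      · rw [hb]; simp only [br_transl_left, br_neg_left]; ring
    · obtain ⟨b, hb | hb⟩ := h₂.unique hp
      · rw [hb]; simp only [br_transl_left]; ring
      · rw [hb]; simp only [br_transl_left, br_neg_left]; ring
  -- The difference of the two poles has the bracket of `g₁` and `g₃` as its numerator, computed
  -- after multiplying both by the inverse of the position of `m₂`.
  have hb13 : br g₁ g₃ = br g₁ (position m₂) * (g₃ * (position m₂)⁻¹).1 1 1 -
      (g₁ * (position m₂)⁻¹).1 1 1 * br g₃ (position m₂) := by
    rw [← br_mul_right g₁ g₃ (position m₂)⁻¹, br, mul_inv_apply_one_zero, mul_inv_apply_one_zero]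
  rw [translationParameter, smul_foot_z hp h₃ h3, smul_foot_z hp h₁ h1, hprod, hb13]
  field_simp
  ring

/-! ### The geodesic arcs -/

theorem heightAt_geodArc_zero {s : ℝ} (hs : 0 < s) (h : IsAdapted m m' (adapted m m')) :
    heightAt m (geodArc s m m' 0) = s := by
  rw [h.1.heightAt_eq, geodArc, smul_inv_smul]
  simp [Real.exp_log hs]

/-- Above 0 in adapted position, a point at height y has height 1/(|br|² y) relative to `m'`, and
the arc ends at y = 1/(|br|² s). -/
theorem heightAt_geodArc_one {s : ℝ} (hs : 0 < s) (hg : IsPosition m g) (hg' : IsPosition m' g')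
    (h1 : 1 ≤ ‖br g g'‖) : heightAt m' (geodArc s m m' 1) = s := by
  have h0 : br g g' ≠ 0 := by
    rintro h0
    rw [h0, norm_zero] at h1
    linarith
  have had := adapted_spec hg hg' h0
  have hn : ‖br g' (adapted m m')‖ = ‖br g g'‖ := by
    rcases hg.br_eq_or had.1 g' with e | e <;> rw [br_swap, e] <;> simp
  rw [hg'.heightAt_eq, geodArc, ← mul_smul, smul_t, den_of_entry_eq_zero (had.entry_eq_zero hg'),
    mul_inv_apply_one_zero]
  simp only [horoDist_eq_of_isAdapted had hg' (hn ▸ h1), hn]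
  have : (0 : ℝ) < ‖br g g'‖ ^ 2 := by positivity
  have e : Real.exp ((1 - 1) * Real.log s - 1 * (Real.log (‖br g g'‖ ^ 2) + Real.log s)) =
      (‖br g g'‖ ^ 2 * s)⁻¹ := by
    rw [← Real.log_mul this.ne' hs.ne', sub_self, zero_mul, zero_sub, one_mul, Real.exp_neg,
      Real.exp_log (by positivity)]
  simp only [e]
  simp
  field_simp

end HypThree

end

noncomputable section

namespace HypThree

/-! ### Discreteness -/

theorem isCompact_bounded (K : ℝ) : IsCompact {A : SL(2, ℂ) | ∀ i j, ‖A.1 i j‖ ≤ K} := by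
  have : IsCompact {M : Matrix (Fin 2) (Fin 2) ℂ | ∀ i j, ‖M i j‖ ≤ K} := by
    have h := isCompact_univ_pi (fun _ : Fin 2 => isCompact_univ_pi
      (fun _ : Fin 2 => isCompact_closedBall (0 : ℂ) K))
    convert! h using 1
    ext M
    exact ⟨fun h i _ j _ => by simpa using h i j, fun h i j => by
      simpa using h i trivial j trivial⟩
  exact Matrix.SpecialLinearGroup.isClosedEmbedding_val.isCompact_preimage this

variable {Γ : Subgroup PSL(2, ℂ)}

theorem finite_bounded (hΓ : DiscreteTopology (preim Γ)) (K : ℝ) :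
    {A : SL(2, ℂ) | A ∈ preim Γ ∧ ∀ i j, ‖A.1 i j‖ ≤ K}.Finite := by
  have hc : IsClosed (preim Γ : Set SL(2, ℂ)) := Subgroup.isClosed_of_discrete
  have h := (isCompact_bounded K).inter_left hc
  exact h.finite (IsDiscrete.mono (s := (preim Γ : Set SL(2, ℂ))) ⟨hΓ⟩ inter_subset_left)

theorem finite_bounded_conj (hΓ : DiscreteTopology (preim Γ)) (g : SL(2, ℂ)) (K : ℝ) :
    {B : SL(2, ℂ) | toPSL (g⁻¹ * B * g) ∈ Γ ∧ ∀ i j, ‖B.1 i j‖ ≤ K}.Finite := by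
  have hc : IsClosed (preim Γ : Set SL(2, ℂ)) := Subgroup.isClosed_of_discrete
  have hcont : Continuous fun B : SL(2, ℂ) => g⁻¹ * B * g := by fun_prop
  have h := ((isCompact_bounded K).image hcont).inter_left hc
  have hf := h.finite (IsDiscrete.mono (s := (preim Γ : Set SL(2, ℂ))) ⟨hΓ⟩ inter_subset_left)
  refine (hf.preimage (f := fun B : SL(2, ℂ) => g⁻¹ * B * g) ?_).subset ?_
  · intro B _ B' _ h
    simpa using h
  · rintro B ⟨hB, hK⟩
    exact ⟨hB, B, hK, rfl⟩

/-- **Shimizu's lemma.** -/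
theorem shimizu (hΓ : DiscreteTopology (preim Γ)) {g A : SL(2, ℂ)}
    (hT : toPSL (g⁻¹ * translOne * g) ∈ Γ) (hA : toPSL (g⁻¹ * A * g) ∈ Γ) (hc : A.1 1 0 ≠ 0) :
    1 ≤ ‖A.1 1 0‖ := by
  by_contra! hlt
  set r := ‖A.1 1 0‖ with hr
  have hr0 : 0 < r := norm_pos_iff.2 hc
  -- The iteration S ↦ S T S⁻¹ with T the unit translation replaces the lower left entry c by -c²,
  -- which tends to 0 without vanishing if 0 < |c| < 1.
  obtain ⟨S, hS0, hS⟩ : ∃ S : ℕ → SL(2, ℂ), S 0 = A ∧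
      ∀ n, S (n + 1) = S n * transl 1 * (S n)⁻¹ :=
    ⟨fun n => Nat.rec A (fun _ B => B * translOne * B⁻¹) n, rfl, fun n => rfl⟩
  have hmem : ∀ n, toPSL (g⁻¹ * S n * g) ∈ Γ := by
    intro n
    induction n with
    | zero => rwa [hS0]
    | succ n ih =>
      rw [hS]
      have := mul_mem (mul_mem ih hT) (inv_mem ih)
      rw [← map_mul, ← map_inv, ← map_mul] at this
      convert this using 2
      rw [transl_one]; group
  have h00 : ∀ n, (S (n + 1)).1 0 0 = 1 - (S n).1 0 0 * (S n).1 1 0 := by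
    intro n; rw [hS]; simp; linear_combination det_eq (S n)
  have h01 : ∀ n, (S (n + 1)).1 0 1 = (S n).1 0 0 ^ 2 := by
    intro n; rw [hS]; simp; ring
  have h10 : ∀ n, (S (n + 1)).1 1 0 = -(S n).1 1 0 ^ 2 := by
    intro n; rw [hS]; simp; ring
  have h11 : ∀ n, (S (n + 1)).1 1 1 = 1 + (S n).1 0 0 * (S n).1 1 0 := by
    intro n; rw [hS]; simp; linear_combination det_eq (S n)
  have hcn : ∀ n, 0 < ‖(S n).1 1 0‖ ∧ ‖(S n).1 1 0‖ ≤ r := by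
    intro n
    induction n with
    | zero => rw [hS0]; exact ⟨hr0, le_rfl⟩
    | succ n ih =>
      rw [h10, norm_neg, norm_pow]
      exact ⟨pow_pos ih.1 2, by nlinarith [ih.1, ih.2]⟩
  have hanti : StrictAnti fun n => ‖(S n).1 1 0‖ := by
    refine strictAnti_nat_of_succ_lt fun n => ?_
    simp only [h10, norm_neg, norm_pow]
    nlinarith [(hcn n).1, (hcn n).2]
  -- Chosen so that 1 + rK ≤ K, which makes the bound |a| ≤ K stable under a ↦ 1 - ac with |c| ≤ r.
  set K := ‖A.1 0 0‖ + 1 / (1 - r) with hK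
  have h1r : 0 < 1 - r := by linarith
  have hK1 : 1 + r * K ≤ K := by
    have : (1 - r) * (1 / (1 - r)) = 1 := by field_simp
    nlinarith [mul_nonneg h1r.le (norm_nonneg (A.1 0 0))]
  have hKpos : 0 < K := by positivity
  have han : ∀ n, ‖(S n).1 0 0‖ ≤ K := by
    intro n
    induction n with
    | zero =>
      have : 0 < 1 / (1 - r) := by positivity
      rw [hS0]
      linarith
    | succ n ih =>
      rw [h00]
      refine (norm_sub_le _ _).trans ?_
      rw [norm_one, norm_mul]
      have := mul_le_mul ih (hcn n).2 (norm_nonneg _) hKpos.le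
      linarith
  have hac : ∀ n, ‖(S n).1 0 0 * (S n).1 1 0‖ ≤ K := by
    intro n
    rw [norm_mul]
    have := mul_le_mul (han n) ((hcn n).2.trans hlt.le) (norm_nonneg _) hKpos.le
    linarith
  have hfin := finite_bounded_conj hΓ g (K ^ 2 + K + 1)
  -- The terms are distinct since |c| decreases strictly, yet their entries are bounded. The index
  -- starts at one because the right column of `A` itself is not controlled by `K`.
  refine (Set.infinite_range_of_injective
    (f := fun n => S (n + 1)) (fun a b hab => ?_)) (hfin.subset ?_)
  · have := hanti.injective (a₁ := a + 1) (a₂ := b + 1)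
      (congrArg (fun X : SL(2, ℂ) => ‖X.1 1 0‖) (show S (a + 1) = S (b + 1) from hab))
    omega
  · rintro _ ⟨n, rfl⟩
    refine ⟨hmem (n + 1), fun i j => ?_⟩
    have hKK := sq_nonneg K
    fin_cases i <;> fin_cases j
    · exact (han _).trans (by linarith)
    · change ‖(S (n + 1)).1 0 1‖ ≤ _
      rw [h01, norm_pow]
      have := pow_le_pow_left₀ (norm_nonneg _) (han n) 2
      linarith
    · exact (hcn (n + 1)).2.trans (by linarith)
    · change ‖(S (n + 1)).1 1 1‖ ≤ _
      rw [h11]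
      refine (norm_add_le _ _).trans ?_
      rw [norm_one]
      linarith [hac n]

theorem conj_transl {B : SL(2, ℂ)} (hB : B.1 1 0 = 0) (x : ℂ) :
    B * transl x * B⁻¹ = transl (B.1 0 0 ^ 2 * x) := by
  have hd := det_eq B
  rw [hB] at hd
  apply sl_ext <;> simp [hB]
  · linear_combination hd
  · ring
  · linear_combination hd

/-- A discrete set of translations is not invariant under a contraction. -/
theorem no_contraction (hΓ : DiscreteTopology (preim Γ)) {g : SL(2, ℂ)}
    (hT : toPSL (g⁻¹ * translOne * g) ∈ Γ) {B : SL(2, ℂ)} (hB : toPSL (g⁻¹ * B * g) ∈ Γ)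
    (h0 : B.1 1 0 = 0) : 1 ≤ ‖B.1 0 0‖ := by
  by_contra! hlt
  have hne : B.1 0 0 ≠ 0 := by
    intro h
    have := det_eq B
    rw [h, h0] at this
    simp at this
  have hpos := norm_pos_iff.2 hne
  -- Conjugating the unit translation repeatedly by B, which acts as z ↦ a²z + ab, gives
  -- translations by a²ⁿ that accumulate at 0 if |a| < 1.
  have hmem : ∀ n : ℕ, toPSL (g⁻¹ * transl ((B.1 0 0 ^ 2) ^ n) * g) ∈ Γ := by
    intro n
    induction n with
    | zero => simpa [transl_one] using hT
    | succ n ih =>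
      rw [pow_succ', ← conj_transl h0]
      have := mul_mem (mul_mem hB ih) (inv_mem hB)
      rw [← map_mul, ← map_inv, ← map_mul] at this
      convert this using 2
      group
  refine (Set.infinite_range_of_injective
    (f := fun n : ℕ => transl ((B.1 0 0 ^ 2) ^ n)) (fun a b hab => ?_))
    ((finite_bounded_conj hΓ g 1).subset ?_)
  · have h1 := congrArg (fun X : SL(2, ℂ) => ‖X.1 0 1‖) hab
    simp only [transl_entry_zero_one, norm_pow, ← pow_mul] at h1
    have := (pow_right_strictAnti₀ hpos hlt).injective h1
    omega
  · rintro _ ⟨n, rfl⟩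
    refine ⟨hmem n, fun i j => ?_⟩
    fin_cases i <;> fin_cases j <;> simp
    rw [← pow_mul]
    exact pow_le_one₀ (norm_nonneg _) hlt.le

open ComplexConjugate in
/-- In a discrete group that acts freely, the stabilizer of a parabolic fixed point consists of
translations. -/
theorem eq_transl_of_fixes (hΓ : IsHyperbolicManifoldGroup Γ) {g B : SL(2, ℂ)}
    (hT : toPSL (g⁻¹ * translOne * g) ∈ Γ) (hB : toPSL (g⁻¹ * B * g) ∈ Γ) (h0 : B.1 1 0 = 0) :
    ∃ b, B = transl b ∨ B = -transl b := by
  have hd := det_eq B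
  rw [h0, mul_zero, sub_zero] at hd
  have h1 := no_contraction hΓ.discrete hT hB h0
  have h2 : 1 ≤ ‖B.1 1 1‖ := by
    have hB' : toPSL (g⁻¹ * B⁻¹ * g) ∈ Γ := by
      have := inv_mem hB
      rw [← map_inv] at this
      convert this using 2
      group
    simpa using no_contraction hΓ.discrete hT hB' (by simpa using h0)
  have hn : ‖B.1 0 0‖ * ‖B.1 1 1‖ = 1 := by rw [← norm_mul, hd, norm_one]
  have hd1 : ‖B.1 1 1‖ = 1 := by nlinarith
  by_cases hsq : B.1 0 0 ^ 2 = 1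
  · have hda : B.1 1 1 = B.1 0 0 := by
      calc B.1 1 1 = B.1 0 0 ^ 2 * B.1 1 1 := by rw [hsq, one_mul]
        _ = _ := by linear_combination B.1 0 0 * hd
    rcases eq_one_or_eq_neg_one_of_sq hsq with h | h
    · exact ⟨B.1 0 1, Or.inl (by apply sl_ext <;> simp [h, h0, hda])⟩
    · exact ⟨-B.1 0 1, Or.inr (by apply sl_ext <;> simp [h, h0, hda])⟩
  · exfalso
    have hsub : (1 : ℂ) - B.1 0 0 ^ 2 ≠ 0 := sub_ne_zero.2 (Ne.symm hsq)
    have hdc : B.1 1 1 * conj (B.1 1 1) = 1 := by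
      rw [Complex.mul_conj', hd1]; simp
    have hconj : conj (B.1 1 1) = B.1 0 0 := by
      calc conj (B.1 1 1) = (B.1 0 0 * B.1 1 1) * conj (B.1 1 1) := by rw [hd, one_mul]
        _ = _ := by linear_combination B.1 0 0 * hdc
    -- When |a| = 1 and a² ≠ 1, z ↦ a²z + ab is a rotation; its extension fixes the vertical line
    -- above its fixed point, against freeness.
    set x : H3 := ⟨B.1 0 0 * B.1 0 1 / (1 - B.1 0 0 ^ 2), 1, one_pos⟩
    have hden : H3.den B x = 1 := by
      simp [H3.den, h0, Complex.normSq_eq_norm_sq, hd1]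
    have hfix : B • x = x := by
      apply H3.ext
      · rw [smul_z, hden, h0]
        simp only [zero_mul, zero_add, hconj, map_zero, mul_zero, add_zero, Complex.ofReal_one,
          div_one, x]
        field_simp
        ring
      · rw [smul_t, hden, div_one]
    have := hΓ.free _ hB (g⁻¹ • x) (by rw [mul_smul, mul_smul, smul_inv_smul, hfix])
    rw [toPSL_eq_one_iff] at this
    have hB1 : B = 1 ∨ B = -1 := by
      rcases this with h | h
      · left
        calc B = g * (g⁻¹ * B * g) * g⁻¹ := by group
          _ = 1 := by rw [h]; simp
      · right
        calc B = g * (g⁻¹ * B * g) * g⁻¹ := by group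
          _ = -1 := by rw [h]; simp
    rcases hB1 with h | h <;> rw [h] at hsq <;> simp at hsq

/-! ### Distinct horospheres of a meridian system -/

variable {h : ℕ} {μ : Fin h → PSL(2, ℂ)} {m m' : PSL(2, ℂ)} {g g' : SL(2, ℂ)}

theorem horospheres_mem (hμ : IsMeridianSystem Γ μ) (hm : m ∈ horospheres Γ μ) : m ∈ Γ := by
  obtain ⟨i, γ, hγ, rfl⟩ := hm
  exact mul_mem (mul_mem hγ (hμ.mem i)) (inv_mem hγ)

theorem horospheres_parabolic (hμ : IsMeridianSystem Γ μ) (hm : m ∈ horospheres Γ μ) :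
    IsParabolic m := by
  obtain ⟨i, γ, hγ, rfl⟩ := hm
  exact (hμ.parabolic i).conj γ

theorem horospheres_conj (hm : m ∈ horospheres Γ μ) {γ : PSL(2, ℂ)} (hγ : γ ∈ Γ) :
    γ * m * γ⁻¹ ∈ horospheres Γ μ := by
  obtain ⟨i, δ, hδ, rfl⟩ := hm
  exact ⟨i, γ * δ, mul_mem hγ hδ, by group⟩

/-- An element of `Γ` that fixes the center of a horosphere fixes its meridian. -/
theorem eq_transl_of_br_eq_zero (hΓ : IsHyperbolicManifoldGroup Γ) (hm : m ∈ Γ)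
    (hg : IsPosition m g) {A : SL(2, ℂ)} (hA : A ∈ preim Γ) (h0 : br (g * A) g = 0) :
    ∃ b, g * A * g⁻¹ = transl b ∨ g * A * g⁻¹ = -transl b := by
  refine eq_transl_of_fixes hΓ (g := g) (hg.eq ▸ hm) ?_ (by rwa [mul_inv_apply_one_zero])
  have : g⁻¹ * (g * A * g⁻¹) * g = A := by group
  rw [this]
  exact hA

theorem toPSL_conj_eq_of_transl (hg : IsPosition m g) {A : SL(2, ℂ)} {b : ℂ}
    (h : g * A * g⁻¹ = transl b ∨ g * A * g⁻¹ = -transl b) : toPSL A * m * (toPSL A)⁻¹ = m := by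
  have hA : toPSL A = toPSL (g⁻¹ * transl b * g) := by
    rw [toPSL_eq_iff]
    rcases h with h | h
    · left; rw [← h]; group
    · right
      calc A = g⁻¹ * (g * A * g⁻¹) * g := by group
        _ = _ := by rw [h]; simp
  rw [hg.eq, hA, ← map_inv, ← map_mul, ← map_mul]
  refine congrArg toPSL ?_
  have : transl b * translOne * (transl b)⁻¹ = translOne := by
    rw [transl_inv, ← transl_one, transl_mul, transl_mul]; refine congrArg transl ?_; ring
  calc _ = g⁻¹ * (transl b * translOne * (transl b)⁻¹) * g := by group
    _ = _ := by rw [this]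

/-- Different horospheres have different centers. -/
theorem br_ne_zero (hΓ : IsHyperbolicManifoldGroup Γ) (hμ : IsMeridianSystem Γ μ)
    (hm : m ∈ horospheres Γ μ) (hm' : m' ∈ horospheres Γ μ) (hne : m ≠ m')
    (hg : IsPosition m g) (hg' : IsPosition m' g') : br g g' ≠ 0 := by
  intro h0
  obtain ⟨i, γ, hγ, rfl⟩ := hm
  obtain ⟨j, γ', hγ', rfl⟩ := hm'
  obtain ⟨A, rfl⟩ := toPSL_surjective γ
  obtain ⟨A', rfl⟩ := toPSL_surjective γ'
  obtain ⟨p, hp⟩ := hμ.parabolic i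
  obtain ⟨p', hp'⟩ := hμ.parabolic j
  have h1 : br (p * A⁻¹ * A') p' = 0 := by
    by_contra hcon
    refine br_ne_zero_of (hp.conj A) hg (hp'.conj A') hg' ?_ h0
    rwa [← br_mul_right _ _ A', inv_mul_cancel_right]
  -- The quotient of the two conjugating elements carries the center of `μ i` to that of `μ j`.
  -- Hence i = j, so the quotient fixes that center; it is then a translation there and commutes
  -- with the meridian.
  have hC : IsPosition (toPSL (A'⁻¹ * A) * μ i * (toPSL (A'⁻¹ * A))⁻¹) (p * A⁻¹ * A') := by
    simpa [mul_assoc] using hp.conj (A'⁻¹ * A)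
  have hCm : toPSL (A'⁻¹ * A) ∈ Γ := by
    rw [map_mul, map_inv]; exact mul_mem (inv_mem hγ') hγ
  obtain rfl := hμ.distinct i j _ hCm ((center_eq_center_iff hC hp').2 h1)
  have h2 : br (p * A⁻¹ * A') p = 0 := by
    by_contra hcon
    exact br_ne_zero_of hC hC hp hp' hcon h1
  obtain ⟨b, hb⟩ := eq_transl_of_br_eq_zero hΓ (hμ.mem i) hp (A := A⁻¹ * A')
    (by have := inv_mem hCm; rwa [← map_inv, mul_inv_rev, inv_inv] at this) (by rwa [← mul_assoc])
  have h3 := toPSL_conj_eq_of_transl hp hb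
  rw [map_mul, map_inv] at h3
  apply hne
  calc _ = toPSL A * (((toPSL A)⁻¹ * toPSL A') * μ i * ((toPSL A)⁻¹ * toPSL A')⁻¹) *
        (toPSL A)⁻¹ := by rw [h3]
    _ = _ := by group

/-- Shimizu's lemma applies to the meridian of `m'` seen in the position of `m`: its lower left
entry is -br². -/
theorem one_le_norm_br (hΓ : IsHyperbolicManifoldGroup Γ) (hμ : IsMeridianSystem Γ μ)
    (hm : m ∈ horospheres Γ μ) (hm' : m' ∈ horospheres Γ μ) (hne : m ≠ m')
    (hg : IsPosition m g) (hg' : IsPosition m' g') : 1 ≤ ‖br g g'‖ := by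
  have h0 := br_ne_zero hΓ hμ hm hm' hne hg hg'
  set B := g * g'⁻¹ * translOne * (g * g'⁻¹)⁻¹
  have hB : B.1 1 0 = -br g g' ^ 2 := by
    have : B = g * g'⁻¹ * transl 1 * (g * g'⁻¹)⁻¹ := rfl
    rw [this, ← mul_inv_apply_one_zero]
    generalize g * g'⁻¹ = C
    simp; ring
  have h1 := shimizu hΓ.discrete (g := g) (A := B) (hg.eq ▸ horospheres_mem hμ hm) ?_ ?_
  · rw [hB, norm_neg, norm_pow] at h1
    by_contra! hlt
    exact absurd h1 (not_le.2 (pow_lt_one₀ (norm_nonneg _) hlt two_ne_zero))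
  · have : g⁻¹ * B * g = g'⁻¹ * translOne * g' := by simp only [B]; group
    rw [this]
    exact hg'.eq ▸ horospheres_mem hμ hm'
  · rw [hB]; simpa using h0

/-! ### The translations of a horosphere -/

/-- The lattice of translations `z ↦ z + b` in the stabilizer of a horosphere in position `g`. -/
def lattice (Γ : Subgroup PSL(2, ℂ)) (g : SL(2, ℂ)) : AddSubgroup ℂ where
  carrier := {b | toPSL (g⁻¹ * transl b * g) ∈ Γ}
  zero_mem' := by simp [one_mem]
  add_mem' := by
    intro a b ha hb
    change toPSL _ ∈ Γ at ha hb ⊢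
    have := mul_mem ha hb
    rw [← map_mul] at this
    convert this using 2
    rw [← transl_mul]; group
  neg_mem' := by
    intro a ha
    change toPSL _ ∈ Γ at ha ⊢
    have := inv_mem ha
    rw [← map_inv] at this
    convert this using 2
    rw [← transl_inv]; group

theorem mem_lattice {b : ℂ} : b ∈ lattice Γ g ↔ toPSL (g⁻¹ * transl b * g) ∈ Γ := Iff.rfl

theorem lattice_finite (hΓ : DiscreteTopology (preim Γ)) (g : SL(2, ℂ)) (K : ℝ) :
    {b | b ∈ lattice Γ g ∧ ‖b‖ ≤ K}.Finite := by
  refine ((finite_bounded_conj hΓ g (max K 1)).preimage (f := transl) ?_).subset ?_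
  · intro a _ b _ hab
    simpa using congrArg (fun X : SL(2, ℂ) => X.1 0 1) hab
  · rintro b ⟨hb, hK⟩
    refine ⟨hb, fun i j => ?_⟩
    fin_cases i <;> fin_cases j <;> simp [hK]

/-- A discrete subgroup of `ℂ` that contains `1` has rank at most two. -/
theorem exists_generator (L : AddSubgroup ℂ) (h1 : (1 : ℂ) ∈ L)
    (hL : ∀ K : ℝ, {b | b ∈ L ∧ ‖b‖ ≤ K}.Finite) :
    ∃ τ ∈ L, ∀ x ∈ L, ∃ n a b : ℤ, n ≠ 0 ∧ (n : ℂ) * x = a + b * τ := by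
  -- If the group is real, 0 serves as τ; otherwise any nonreal element spans ℂ over ℝ together with
  -- 1.
  obtain ⟨τ, hτ, hspan⟩ : ∃ τ ∈ L, ∀ x ∈ L, ∃ r s : ℝ, x = r + s * τ := by
    by_cases hre : ∀ x ∈ L, x.im = 0
    · exact ⟨0, zero_mem _, fun x hx => ⟨x.re, 0, by apply Complex.ext <;> simp [hre x hx]⟩⟩
    · push Not at hre
      obtain ⟨τ, hτ, him⟩ := hre
      refine ⟨τ, hτ, fun x _ => ⟨x.re - x.im / τ.im * τ.re, x.im / τ.im, ?_⟩⟩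
      apply Complex.ext
      · simp
      · simp; field_simp
  refine ⟨τ, hτ, fun x hx => ?_⟩
  obtain ⟨r, s, hrs⟩ := hspan x hx
  -- The remainders of the multiples n x modulo ℤ + ℤτ lie in a bounded, hence finite, part of the
  -- group. Two of them agree, so a nonzero multiple of x lies in ℤ + ℤτ.
  let f : ℕ → ℂ := fun n => n * x - (⌊n * r⌋ : ℂ) - (⌊n * s⌋ : ℂ) * τ
  have hf : ∀ n, f n = ((Int.fract (n * r) : ℝ) : ℂ) + ((Int.fract (n * s) : ℝ) : ℂ) * τ := by
    intro n
    simp only [f, hrs, Int.fract]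
    push_cast
    ring
  have hmem : ∀ n, f n ∈ L := by
    intro n
    refine sub_mem (sub_mem ?_ ?_) ?_
    · simpa using nsmul_mem hx n
    · simpa using zsmul_mem h1 ⌊n * r⌋
    · simpa using zsmul_mem hτ ⌊n * s⌋
  have hbd : ∀ n, ‖f n‖ ≤ 1 + ‖τ‖ := by
    intro n
    rw [hf]
    refine (norm_add_le _ _).trans (add_le_add ?_ ?_)
    · rw [Complex.norm_real, Real.norm_of_nonneg (Int.fract_nonneg _)]
      exact (Int.fract_lt_one _).le
    · rw [norm_mul, Complex.norm_real, Real.norm_of_nonneg (Int.fract_nonneg _)]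
      exact mul_le_of_le_one_left (norm_nonneg _) (Int.fract_lt_one _).le
  have hninj : ¬ Function.Injective f := fun hinj =>
    Set.infinite_range_of_injective hinj ((hL (1 + ‖τ‖)).subset (by
      rintro _ ⟨n, rfl⟩
      exact ⟨hmem n, hbd n⟩))
  simp only [Function.Injective, not_forall] at hninj
  obtain ⟨a, b, hab, hne⟩ := hninj
  refine ⟨a - b, ⌊a * r⌋ - ⌊b * r⌋, ⌊a * s⌋ - ⌊b * s⌋, by omega, ?_⟩
  simp only [f] at hab
  push_cast
  linear_combination hab

end HypThree

end

noncomputable section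

namespace HypThree

/-! ### The parameters lie in the invariant trace field -/

variable {Γ : Subgroup PSL(2, ℂ)} {m m' m₁ m₂ m₃ : PSL(2, ℂ)} {g g' g₁ g₂ g₃ : SL(2, ℂ)}

theorem trace_mem {A : SL(2, ℂ)} (h : toPSL A ∈ squares Γ) :
    A.1.trace ∈ invariantTraceField Γ :=
  IntermediateField.subset_adjoin _ _ ⟨A, h, rfl⟩

/-- The square of the meridian is translation by 2; this is how horospheres provide elements of Γ²
with computable traces. -/
theorem sq_mem_squares (hm : m ∈ Γ) (hg : IsPosition m g) :
    toPSL (g⁻¹ * transl 2 * g) ∈ squares Γ := by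
  refine Subgroup.subset_closure ⟨m, hm, ?_⟩
  rw [hg.eq, ← map_pow]
  refine congrArg toPSL ?_
  have : transl 2 = translOne * translOne := by rw [← transl_one, transl_mul]; norm_num
  rw [this, sq]; group

theorem conj_transl_entries (g : SL(2, ℂ)) (b : ℂ) :
    (g⁻¹ * transl b * g).1 = !![1 + b * g.1 1 0 * g.1 1 1, b * g.1 1 1 ^ 2;
      -b * g.1 1 0 ^ 2, 1 - b * g.1 1 0 * g.1 1 1] := by
  have hd := det_eq g
  ext i j
  fin_cases i <;> fin_cases j <;> simp
  · linear_combination hd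
  · ring
  · ring
  · linear_combination hd

theorem trace_two (g g' : SL(2, ℂ)) :
    (g⁻¹ * transl 2 * g * (g'⁻¹ * transl 2 * g')).1.trace = 2 - 4 * br g g' ^ 2 := by
  change (_ * _ : Matrix _ _ ℂ).trace = _
  rw [conj_transl_entries, conj_transl_entries, Matrix.trace_fin_two]
  simp [br]
  ring

theorem trace_three (g₁ g₂ g₃ : SL(2, ℂ)) :
    (g₁⁻¹ * transl 2 * g₁ * (g₂⁻¹ * transl 2 * g₂) * (g₃⁻¹ * transl 2 * g₃)).1.trace =
      2 - 4 * (br g₁ g₂ ^ 2 + br g₂ g₃ ^ 2 + br g₁ g₃ ^ 2) -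
        8 * (br g₁ g₂ * br g₂ g₃ * br g₁ g₃) := by
  change (_ * _ * _ : Matrix _ _ ℂ).trace = _
  rw [conj_transl_entries, conj_transl_entries, conj_transl_entries, Matrix.trace_fin_two]
  simp [br, Matrix.mul_apply]
  ring

theorem br_sq_mem (hm : m ∈ Γ) (hm' : m' ∈ Γ) (hg : IsPosition m g) (hg' : IsPosition m' g') :
    br g g' ^ 2 ∈ invariantTraceField Γ := by
  have h := trace_mem (A := g⁻¹ * transl 2 * g * (g'⁻¹ * transl 2 * g')) (Γ := Γ) (by
    rw [map_mul]; exact mul_mem (sq_mem_squares hm hg) (sq_mem_squares hm' hg'))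
  rw [trace_two] at h
  have e : br g g' ^ 2 = (2 - (2 - 4 * br g g' ^ 2)) / 4 := by ring
  rw [e]
  exact div_mem (sub_mem (ofNat_mem _ 2) h) (ofNat_mem _ 4)

/-- Once the squares of the brackets are known to lie in the field, the trace of a product of three
squared meridians isolates the triple product. -/
theorem br_triple_mem (h₁ : m₁ ∈ Γ) (h₂ : m₂ ∈ Γ) (h₃ : m₃ ∈ Γ) (hg₁ : IsPosition m₁ g₁)
    (hg₂ : IsPosition m₂ g₂) (hg₃ : IsPosition m₃ g₃) :
    br g₁ g₂ * br g₂ g₃ * br g₁ g₃ ∈ invariantTraceField Γ := by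
  have h := trace_mem (Γ := Γ)
    (A := g₁⁻¹ * transl 2 * g₁ * (g₂⁻¹ * transl 2 * g₂) * (g₃⁻¹ * transl 2 * g₃)) (by
    rw [map_mul, map_mul]
    exact mul_mem (mul_mem (sq_mem_squares h₁ hg₁) (sq_mem_squares h₂ hg₂))
      (sq_mem_squares h₃ hg₃))
  rw [trace_three] at h
  have hs := add_mem (add_mem (br_sq_mem h₁ h₂ hg₁ hg₂) (br_sq_mem h₂ h₃ hg₂ hg₃))
    (br_sq_mem h₁ h₃ hg₁ hg₃)
  have h4 := mul_mem (ofNat_mem (invariantTraceField Γ) 4) hs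
  have e : br g₁ g₂ * br g₂ g₃ * br g₁ g₃ =
      (2 - 4 * (br g₁ g₂ ^ 2 + br g₂ g₃ ^ 2 + br g₁ g₃ ^ 2) - (2 -
        4 * (br g₁ g₂ ^ 2 + br g₂ g₃ ^ 2 + br g₁ g₃ ^ 2) -
        8 * (br g₁ g₂ * br g₂ g₃ * br g₁ g₃))) / 8 := by ring
  rw [e]
  exact div_mem (sub_mem (sub_mem (ofNat_mem _ 2) h4) h) (ofNat_mem _ 8)

variable {h : ℕ} {μ : Fin h → PSL(2, ℂ)}

theorem intercuspParameter_mem (hΓ : IsHyperbolicManifoldGroup Γ) (hμ : IsMeridianSystem Γ μ)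
    (hm : m ∈ horospheres Γ μ) (hm' : m' ∈ horospheres Γ μ) (hne : m ≠ m') :
    intercuspParameter m m' ∈ invariantTraceField Γ := by
  have hg := (horospheres_parabolic hμ hm).position_spec
  have hg' := (horospheres_parabolic hμ hm').position_spec
  rw [intercuspParameter_eq hg hg' (one_le_norm_br hΓ hμ hm hm' hne hg hg')]
  exact div_mem (neg_mem (one_mem _))
    (br_sq_mem (horospheres_mem hμ hm) (horospheres_mem hμ hm') hg hg')

theorem translationParameter_mem (hΓ : IsHyperbolicManifoldGroup Γ) (hμ : IsMeridianSystem Γ μ)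
    (hm₁ : m₁ ∈ horospheres Γ μ) (hm₂ : m₂ ∈ horospheres Γ μ) (hm₃ : m₃ ∈ horospheres Γ μ)
    (h₁₂ : m₁ ≠ m₂) (h₂₃ : m₂ ≠ m₃) :
    translationParameter m₁ m₂ m₃ ∈ invariantTraceField Γ := by
  have hg₁ := (horospheres_parabolic hμ hm₁).position_spec
  have hg₂ := (horospheres_parabolic hμ hm₂).position_spec
  have hg₃ := (horospheres_parabolic hμ hm₃).position_spec
  have hm₁' := horospheres_mem hμ hm₁
  have hm₂' := horospheres_mem hμ hm₂
  have hm₃' := horospheres_mem hμ hm₃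
  have n₁₂ := br_ne_zero hΓ hμ hm₁ hm₂ h₁₂ hg₁ hg₂
  have n₂₃ := br_ne_zero hΓ hμ hm₂ hm₃ h₂₃ hg₂ hg₃
  rw [translationParameter_eq hg₁ hg₂ hg₃ n₁₂ n₂₃]
  -- Expanding by the product of the two denominators turns u into a triple product over squares of
  -- brackets.
  have e : ∀ a b c : ℂ, a ≠ 0 → b ≠ 0 → c / (a * b) = a * b * c / (a ^ 2 * b ^ 2) := by
    intro a b c ha hb
    field_simp
  rw [e _ _ _ n₁₂ n₂₃]
  exact div_mem (br_triple_mem hm₁' hm₂' hm₃' hg₁ hg₂ hg₃)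
    (mul_mem (br_sq_mem hm₁' hm₂' hg₁ hg₂) (br_sq_mem hm₂' hm₃' hg₂ hg₃))

/-! ### Frames and projective rationality -/

/-- The matrix with coefficients in a subfield, as a complex matrix. -/
abbrev cx {F : IntermediateField ℚ ℂ} (M : Matrix (Fin 2) (Fin 2) F) : Matrix (Fin 2) (Fin 2) ℂ :=
  M.map (algebraMap F ℂ)

/-- `P'` arises from `P` by a base change that is rational over `F` up to a scalar. -/
def ProjRational (F : IntermediateField ℚ ℂ) (P P' : Matrix (Fin 2) (Fin 2) ℂ) : Prop :=
  ∃ (c : ℂ) (M : Matrix (Fin 2) (Fin 2) F), P' = c • (cx M * P)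

variable {F : IntermediateField ℚ ℂ} {P P' P'' : Matrix (Fin 2) (Fin 2) ℂ}

theorem cx_mul (M N : Matrix (Fin 2) (Fin 2) F) : cx (M * N) = cx M * cx N :=
  Matrix.map_mul

theorem cx_one : cx (1 : Matrix (Fin 2) (Fin 2) F) = 1 :=
  Matrix.map_one _ (map_zero _) (map_one _)

theorem det_cx (M : Matrix (Fin 2) (Fin 2) F) : (cx M).det = algebraMap F ℂ M.det := by
  simp [Matrix.det_fin_two]

theorem ProjRational.trans (h : ProjRational F P P') (h' : ProjRational F P' P'') :
    ProjRational F P P'' := by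
  obtain ⟨c, M, rfl⟩ := h
  obtain ⟨c', M', rfl⟩ := h'
  refine ⟨c' * c, M' * M, ?_⟩
  rw [cx_mul, Matrix.mul_smul, smul_smul, Matrix.mul_assoc]

theorem ProjRational.of_entries {a b c d : ℂ} (s : ℂ) (ha : a ∈ F) (hb : b ∈ F) (hc : c ∈ F)
    (hd : d ∈ F) (h : P' = s • (!![a, b; c, d] * P)) : ProjRational F P P' := by
  refine ⟨s, !![⟨a, ha⟩, ⟨b, hb⟩; ⟨c, hc⟩, ⟨d, hd⟩], ?_⟩
  rw [h]
  congr 2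
  ext i j
  fin_cases i <;> fin_cases j <;> rfl

theorem ProjRational.neg_right (h : ProjRational F P P') : ProjRational F P (-P') := by
  obtain ⟨c, M, rfl⟩ := h
  exact ⟨-c, M, by rw [neg_smul]⟩

/-- The frame of a pair of horospheres in positions `g` and `g'`. -/
def frame (g g' : SL(2, ℂ)) : Matrix (Fin 2) (Fin 2) ℂ :=
  !![g.1 1 0, g.1 1 1; br g g' * g'.1 1 0, br g g' * g'.1 1 1]

/-- The frame is a basis exactly when the bracket is nonzero, that is, when the centers differ. -/
theorem det_frame (g g' : SL(2, ℂ)) : (frame g g').det = br g g' ^ 2 := by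
  rw [Matrix.det_fin_two, frame, br]; simp; ring

theorem frame_mul (g g' A : SL(2, ℂ)) : frame (g * A) (g' * A) = frame g g' * A.1 := by
  rw [frame, br_mul_right, frame]
  ext i j
  fin_cases i <;> fin_cases j <;> simp [Matrix.vecMul, dotProduct] <;> ring

/-- Up to the factor 1/br, the change of frame has the entries 0, 1, -br², 0. -/
theorem frame_swap (h0 : br g g' ≠ 0) (h : br g g' ^ 2 ∈ F) :
    ProjRational F (frame g g') (frame g' g) := by
  refine .of_entries (br g g')⁻¹ (zero_mem _) (one_mem _) (neg_mem h) (zero_mem _) ?_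
  rw [frame, frame, br_swap g' g]
  ext i j
  fin_cases i <;> fin_cases j <;> simp <;> field_simp

/-- The Plücker relation expresses the bottom row of `g₂` in those of `g` and `g₁`. Scaling the
second row of a frame by the bracket makes the coefficients u·br² and a quotient of squared
brackets, all in F. -/
theorem frame_turn (h0 : br g g₁ ≠ 0) (h1 : br g g₁ ^ 2 ∈ F) (h2 : br g g₂ ^ 2 ∈ F)
    (hn : br g g₂ ≠ 0) (hu : br g₁ g₂ / (br g₁ g * br g g₂) ∈ F) :
    ProjRational F (frame g g₁) (frame g g₂) := by
  refine .of_entries 1 (one_mem _) (zero_mem _)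
    (mul_mem hu h2) (div_mem h2 h1) ?_
  have h0' : br g₁ g ≠ 0 := by rwa [br_swap, neg_ne_zero]
  have e : ∀ j : Fin 2, br g g₂ * g₂.1 1 j =
      br g₁ g₂ / (br g₁ g * br g g₂) * br g g₂ ^ 2 * g.1 1 j +
        br g g₂ ^ 2 / br g g₁ ^ 2 * (br g g₁ * g₁.1 1 j) := by
    intro j
    rw [br_swap g₁ g]
    field_simp
    fin_cases j <;> simp [br] <;> ring
  rw [frame, frame, one_smul]
  ext i j
  fin_cases i
  · fin_cases j <;> simp
  · fin_cases j
    · simpa using e 0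
    · simpa using e 1

/-- The bottom rows of two positions of the same horosphere agree up to sign. -/
theorem IsPosition.row_eq (hg : IsPosition m g) (hg' : IsPosition m g') :
    (∀ j, g'.1 1 j = g.1 1 j) ∨ (∀ j, g'.1 1 j = -g.1 1 j) := by
  obtain ⟨b, rfl | rfl⟩ := hg.unique hg'
  · left; intro j; simp
  · right; intro j; simp

/-- The frame is odd in `g` but even in `g'`, so the sign ambiguity of positions gives at most a
global sign. -/
theorem frame_eq_or (h₁ : IsPosition m₁ g₁) (h₁' : IsPosition m₁ g) (h₂ : IsPosition m₂ g₂)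
    (h₂' : IsPosition m₂ g') : frame g g' = frame g₁ g₂ ∨ frame g g' = -frame g₁ g₂ := by
  rcases h₁.row_eq h₁' with e | e <;> rcases h₂.row_eq h₂' with e' | e'
  · left; simp [frame, br, e, e']
  · left; ext i j; fin_cases i <;> fin_cases j <;> simp [frame, br, e, e'] <;> ring
  · right; ext i j; fin_cases i <;> fin_cases j <;> simp [frame, br, e, e'] <;> ring
  · right; ext i j; fin_cases i <;> fin_cases j <;> simp [frame, br, e, e']

/-- The matrices that are rational over `F` in the frame `P`. -/
def rationalSubgroup (F : IntermediateField ℚ ℂ) (P : Matrix (Fin 2) (Fin 2) ℂ) (hP : P.det ≠ 0) :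
    Subgroup SL(2, ℂ) where
  carrier := {A | ∃ M : Matrix (Fin 2) (Fin 2) F, P * A.1 = cx M * P}
  one_mem' := ⟨1, by rw [cx_one]; simp⟩
  mul_mem' := by
    rintro A B ⟨M, hM⟩ ⟨N, hN⟩
    refine ⟨M * N, ?_⟩
    change P * (A.1 * B.1) = _
    rw [← Matrix.mul_assoc, hM, Matrix.mul_assoc, hN, cx_mul, Matrix.mul_assoc]
  inv_mem' := by
    rintro A ⟨M, hM⟩
    have hdet : (cx M).det = 1 := by
      have := congrArg Matrix.det hM
      rw [Matrix.det_mul, Matrix.det_mul, A.2, mul_one] at this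
      exact (mul_eq_right₀ hP).1 this.symm
    -- As the determinant is one, the adjugate is the inverse, and its entries stay in F.
    have hadj : cx M.adjugate = (cx M).adjugate := by
      rw [Matrix.adjugate_fin_two, Matrix.adjugate_fin_two]
      ext i j
      fin_cases i <;> fin_cases j <;> simp
    refine ⟨M.adjugate, ?_⟩
    have hA : A.1 * (A⁻¹).1 = 1 := by
      change (A * A⁻¹).1 = 1
      rw [mul_inv_cancel]; rfl
    calc P * (A⁻¹).1 = ((cx M).adjugate * cx M) * P * (A⁻¹).1 := by
          rw [Matrix.adjugate_mul, hdet]; simp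
      _ = (cx M).adjugate * (cx M * P) * (A⁻¹).1 := by simp only [Matrix.mul_assoc]
      _ = (cx M).adjugate * P * (A.1 * (A⁻¹).1) := by rw [← hM]; simp only [Matrix.mul_assoc]
      _ = _ := by rw [hA, hadj, Matrix.mul_one]

theorem trace_mem_of_mem_rationalSubgroup {hP : P.det ≠ 0} {A : SL(2, ℂ)}
    (hA : A ∈ rationalSubgroup F P hP) : A.1.trace ∈ F := by
  obtain ⟨M, hM⟩ := hA
  have : A.1.trace = (cx M).trace := by
    have hu : IsUnit P.det := isUnit_iff_ne_zero.2 hP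
    calc A.1.trace = (P⁻¹ * (P * A.1)).trace := by
          rw [← Matrix.mul_assoc, Matrix.nonsing_inv_mul _ hu, Matrix.one_mul]
      _ = (cx M * (P * P⁻¹)).trace := by rw [hM, Matrix.trace_mul_comm, Matrix.mul_assoc]
      _ = _ := by rw [Matrix.mul_nonsing_inv _ hu, Matrix.mul_one]
  rw [this, Matrix.trace_fin_two]
  exact add_mem (M 0 0).2 (M 1 1).2

/-- The scalar c need not lie in F, but determinants give c² det M = 1, so that c²M² has entries in
F. This is why squares, and the invariant trace field, appear. -/
theorem sq_mem_rationalSubgroup (hP : P.det ≠ 0) {A : SL(2, ℂ)}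
    (hA : ProjRational F P (P * A.1)) : A * A ∈ rationalSubgroup F P hP := by
  obtain ⟨c, M, hM⟩ := hA
  have hdet : c ^ 2 * algebraMap F ℂ M.det = 1 := by
    have := congrArg Matrix.det hM
    rw [Matrix.det_mul, Matrix.det_smul, Matrix.det_mul, A.2, mul_one, det_cx] at this
    simp only [Fintype.card_fin, ← mul_assoc] at this
    exact (mul_eq_right₀ hP).1 this.symm
  have hne : algebraMap F ℂ M.det ≠ 0 := by
    intro h
    rw [h, mul_zero] at hdet
    exact zero_ne_one hdet
  have hc : c ^ 2 = algebraMap F ℂ (M.det⁻¹) := by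
    rw [map_inv₀]; exact eq_inv_of_mul_eq_one_left hdet
  refine ⟨M.det⁻¹ • (M * M), ?_⟩
  have hs : cx (M.det⁻¹ • (M * M)) = c ^ 2 • (cx M * cx M) := by
    rw [← cx_mul, hc]
    ext i j
    simp only [Matrix.map_apply, Matrix.smul_apply, smul_eq_mul, map_mul]
  change P * (A.1 * A.1) = _
  rw [hs, ← Matrix.mul_assoc, hM, Matrix.smul_mul, Matrix.mul_assoc, hM, Matrix.mul_smul, smul_smul,
    ← sq, Matrix.smul_mul, Matrix.mul_assoc]

/-- If all elements of `Γ` are projectively rational over `F` in some frame, then `F` contains the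
invariant trace field. -/
theorem invariantTraceField_le (hP : P.det ≠ 0)
    (h : ∀ A ∈ preim Γ, ProjRational F P (P * A.1)) : invariantTraceField Γ ≤ F := by
  have hsq : squares Γ ≤ (rationalSubgroup F P hP).map toPSL := by
    refine (Subgroup.closure_le _).2 ?_
    rintro _ ⟨γ, hγ, rfl⟩
    obtain ⟨A, rfl⟩ := toPSL_surjective γ
    exact ⟨A * A, sq_mem_rationalSubgroup hP (h A hγ), by rw [map_mul, sq]⟩
  refine IntermediateField.adjoin_le_iff.2 ?_
  rintro _ ⟨A, hA, rfl⟩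
  obtain ⟨B, hB, hBA⟩ := hsq hA
  have hBt := trace_mem_of_mem_rationalSubgroup hB
  rcases toPSL_eq_iff.1 hBA with rfl | rfl
  · exact hBt
  · have e : (-A).1.trace = -A.1.trace := by
      change (-A.1).trace = _
      rw [Matrix.trace_neg]
    rw [e] at hBt
    simpa using neg_mem hBt

end HypThree

end

noncomputable section

namespace HypThree

/-! ### The choice of the translation parameters -/

variable {Γ : Subgroup PSL(2, ℂ)} {h k : ℕ} {μ : Fin h → PSL(2, ℂ)} {H H' : Fin k → PSL(2, ℂ)}
  {m m' m₁ m₂ m₃ X Y Z : PSL(2, ℂ)} {g g' g₁ g₂ g₃ p : SL(2, ℂ)}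

theorem IsLiftOfArc.symm (hl : IsLiftOfArc Γ H H' X Y) : IsLiftOfArc Γ H H' Y X := by
  obtain ⟨j, γ, hγ, hl | hl⟩ := hl
  · exact ⟨j, γ, hγ, Or.inr hl.symm⟩
  · exact ⟨j, γ, hγ, Or.inl hl.symm⟩

theorem IsLiftOfArc.conj (hl : IsLiftOfArc Γ H H' X Y) {δ : PSL(2, ℂ)} (hδ : δ ∈ Γ) :
    IsLiftOfArc Γ H H' (δ * X * δ⁻¹) (δ * Y * δ⁻¹) := by
  obtain ⟨j, γ, hγ, ⟨rfl, rfl⟩ | ⟨rfl, rfl⟩⟩ := hl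
  · exact ⟨j, δ * γ, mul_mem hδ hγ, Or.inl ⟨by group, by group⟩⟩
  · exact ⟨j, δ * γ, mul_mem hδ hγ, Or.inr ⟨by group, by group⟩⟩

theorem IsLiftOfArc.mem_left (hl : IsLiftOfArc Γ H H' X Y) (hH : ∀ j, H j ∈ horospheres Γ μ)
    (hH' : ∀ j, H' j ∈ horospheres Γ μ) : X ∈ horospheres Γ μ := by
  obtain ⟨j, γ, hγ, ⟨rfl, rfl⟩ | ⟨rfl, rfl⟩⟩ := hl
  exacts [horospheres_conj (hH j) hγ, horospheres_conj (hH' j) hγ]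

theorem IsLiftOfArc.ne (hl : IsLiftOfArc Γ H H' X Y) (hne : ∀ j, H j ≠ H' j) : X ≠ Y := by
  obtain ⟨j, γ, hγ, ⟨rfl, rfl⟩ | ⟨rfl, rfl⟩⟩ := hl
  · simpa using hne j
  · simpa using (hne j).symm

/-- The coordinate, in the chosen position of `m`, of the center of `m'`. -/
def coord (m m' : PSL(2, ℂ)) : ℂ := (position m • foot m m').z

theorem coord_translate (hm : IsParabolic m) (hg' : IsPosition m' g')
    (h0 : br g' (position m) ≠ 0) (b : ℂ) :
    coord m (toPSL ((position m)⁻¹ * transl b * position m) * m' *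
      (toPSL ((position m)⁻¹ * transl b * position m))⁻¹) = coord m m' + b := by
  have hp := hm.position_spec
  have hq := hg'.conj ((position m)⁻¹ * transl b * position m)
  have e : g' * ((position m)⁻¹ * transl b * position m)⁻¹ * (position m)⁻¹ =
      g' * (position m)⁻¹ * transl (-b) := by rw [← transl_inv]; group
  have e10 : br (g' * ((position m)⁻¹ * transl b * position m)⁻¹) (position m) =
      br g' (position m) := by
    rw [← mul_inv_apply_one_zero, e, ← mul_inv_apply_one_zero]
    generalize g' * (position m)⁻¹ = B
    simp
  rw [coord, coord, smul_foot_z hp hg' h0, smul_foot_z hp hq (by rwa [e10]), e10, e]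
  rw [← mul_inv_apply_one_zero] at h0 ⊢
  generalize g' * (position m)⁻¹ = B at *
  simp only [mul_entry, transl_entry_zero_one, transl_entry_one_one]
  field_simp
  ring

/-- Commuting with the meridian makes the image of a position another position of the same
horosphere, and positions differ by a translation up to sign. -/
theorem exists_transl_of_conj_eq (hm : IsParabolic m) {γ : PSL(2, ℂ)} (hγ : γ ∈ Γ)
    (h : γ * m * γ⁻¹ = m) : ∃ b ∈ lattice Γ (position m),
      γ = toPSL ((position m)⁻¹ * transl b * position m) := by
  obtain ⟨A, rfl⟩ := toPSL_surjective γ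
  have hp := hm.position_spec
  have hq : IsPosition m (position m * A⁻¹) := by simpa only [h] using hp.conj A
  obtain ⟨b, hb⟩ := hp.unique hq
  have key : toPSL A = toPSL ((position m)⁻¹ * transl (-b) * position m) := by
    rw [toPSL_eq_iff, ← transl_inv]
    rcases hb with hb | hb
    · left
      calc A = (position m * A⁻¹)⁻¹ * position m := by group
        _ = _ := by rw [hb]; group
    · right
      calc A = (position m * A⁻¹)⁻¹ * position m := by group
        _ = _ := by
          rw [hb]
          have : (-(transl b * position m))⁻¹ = -(transl b * position m)⁻¹ := by
            rw [inv_eq_iff_mul_eq_one, neg_mul_neg, mul_inv_cancel]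
          rw [this, neg_mul]; group
  exact ⟨-b, by rw [mem_lattice, ← key]; exact hγ, key⟩

theorem one_mem_lattice (hm : IsParabolic m) (hmΓ : m ∈ Γ) :
    (1 : ℂ) ∈ lattice Γ (position m) := by
  rw [mem_lattice, transl_one, ← hm.position_spec.eq]; exact hmΓ

theorem toPSL_transl_conj (hm : IsParabolic m) (b : ℂ) :
    toPSL ((position m)⁻¹ * transl b * position m) * m *
      (toPSL ((position m)⁻¹ * transl b * position m))⁻¹ = m := by
  refine toPSL_conj_eq_of_transl (b := b) hm.position_spec (Or.inl ?_)
  group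

theorem translationParameter_conj (hΓ : IsHyperbolicManifoldGroup Γ) (hμ : IsMeridianSystem Γ μ)
    (hm₁ : m₁ ∈ horospheres Γ μ) (hm₂ : m₂ ∈ horospheres Γ μ) (hm₃ : m₃ ∈ horospheres Γ μ)
    (h₁₂ : m₁ ≠ m₂) (h₂₃ : m₂ ≠ m₃) (γ : PSL(2, ℂ)) :
    translationParameter (γ * m₁ * γ⁻¹) (γ * m₂ * γ⁻¹) (γ * m₃ * γ⁻¹) =
      translationParameter m₁ m₂ m₃ := by
  obtain ⟨A, rfl⟩ := toPSL_surjective γ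
  have hg₁ := (horospheres_parabolic hμ hm₁).position_spec
  have hg₂ := (horospheres_parabolic hμ hm₂).position_spec
  have hg₃ := (horospheres_parabolic hμ hm₃).position_spec
  have n₁₂ := br_ne_zero hΓ hμ hm₁ hm₂ h₁₂ hg₁ hg₂
  have n₂₃ := br_ne_zero hΓ hμ hm₂ hm₃ h₂₃ hg₂ hg₃
  rw [translationParameter_eq hg₁ hg₂ hg₃ n₁₂ n₂₃,
    translationParameter_eq (hg₁.conj A) (hg₂.conj A) (hg₃.conj A) (by rwa [br_mul_right])
      (by rwa [br_mul_right]), br_mul_right, br_mul_right, br_mul_right]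

/-- The initial horosphere of an oriented arc. -/
def initial (H H' : Fin k → PSL(2, ℂ)) (e : Fin k × Bool) : PSL(2, ℂ) :=
  if e.2 then H' e.1 else H e.1

/-- The final horosphere of an oriented arc. -/
def final (H H' : Fin k → PSL(2, ℂ)) (e : Fin k × Bool) : PSL(2, ℂ) :=
  if e.2 then H e.1 else H' e.1

theorem isLiftOfArc_iff : IsLiftOfArc Γ H H' X Y ↔ ∃ e, ∃ γ ∈ Γ,
    X = γ * initial H H' e * γ⁻¹ ∧ Y = γ * final H H' e * γ⁻¹ := by
  constructor
  · rintro ⟨j, γ, hγ, hl | hl⟩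
    · exact ⟨(j, false), γ, hγ, hl⟩
    · exact ⟨(j, true), γ, hγ, hl⟩
  · rintro ⟨⟨j, b⟩, γ, hγ, hl⟩
    cases b
    · exact ⟨j, γ, hγ, Or.inl hl⟩
    · exact ⟨j, γ, hγ, Or.inr hl⟩

/-- Two translation parameters for each arc of the collection suffice to generate all
translation parameters between lifts of arcs. -/
theorem exists_translationParameters (hΓ : IsHyperbolicManifoldGroup Γ)
    (hμ : IsMeridianSystem Γ μ) (hH : ∀ j, H j ∈ horospheres Γ μ)
    (hH' : ∀ j, H' j ∈ horospheres Γ μ) (hne : ∀ j, H j ≠ H' j) :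
    ∃ A B C : Fin (2 * k) → PSL(2, ℂ),
      (∀ l, IsLiftOfArc Γ H H' (A l) (B l) ∧ IsLiftOfArc Γ H H' (B l) (C l)) ∧
      ∀ F : IntermediateField ℚ ℂ, (∀ l, translationParameter (A l) (B l) (C l) ∈ F) →
        ∀ X Y Z, IsLiftOfArc Γ H H' X Y → IsLiftOfArc Γ H H' Y Z →
          translationParameter X Y Z ∈ F := by
  classical
  set V := initial H H' with hV
  set O := final H H' with hO
  have hlift : ∀ e, ∀ γ ∈ Γ, IsLiftOfArc Γ H H' (γ * V e * γ⁻¹) (γ * O e * γ⁻¹) := fun e γ hγ =>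
    isLiftOfArc_iff.2 ⟨e, γ, hγ, rfl, rfl⟩
  have hlift1 : ∀ e, IsLiftOfArc Γ H H' (V e) (O e) := fun e => by
    simpa using hlift e 1 (one_mem _)
  have hhoro : ∀ {X Y}, IsLiftOfArc Γ H H' X Y → X ∈ horospheres Γ μ :=
    fun hl => hl.mem_left hH hH'
  have hpar : ∀ {X Y}, IsLiftOfArc Γ H H' X Y → IsParabolic X :=
    fun hl => horospheres_parabolic hμ (hhoro hl)
  -- Oriented arcs are grouped by the Γ-orbit of their initial horosphere; `ρ` picks the root of
  -- each class.
  let rel : Setoid (Fin k × Bool) :=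
    { r := fun e e' => ∃ γ ∈ Γ, γ * V e * γ⁻¹ = V e'
      iseqv :=
        { refl := fun e => ⟨1, one_mem _, by group⟩
          symm := by
            rintro e e' ⟨γ, hγ, he⟩
            exact ⟨γ⁻¹, inv_mem hγ, by rw [← he]; group⟩
          trans := by
            rintro e e' e'' ⟨γ, hγ, he⟩ ⟨γ', hγ', he'⟩
            exact ⟨γ' * γ, mul_mem hγ' hγ, by rw [← he', ← he]; group⟩ } }
  let ρ : Fin k × Bool → Fin k × Bool := fun e => (Quotient.mk rel e).out
  have hρ : ∀ e, ∃ γ ∈ Γ, γ * V e * γ⁻¹ = V (ρ e) := fun e =>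
    rel.symm (Quotient.exact (Quotient.out_eq (Quotient.mk rel e)))
  have hρeq : ∀ e e', (∃ γ ∈ Γ, γ * V e * γ⁻¹ = V e') → ρ e = ρ e' := fun e e' he =>
    congrArg Quotient.out (Quotient.sound he)
  have hρρ : ∀ e, ρ (ρ e) = ρ e := fun e => (hρeq _ _ (hρ e)).symm
  choose γ hγ hγV using hρ
  have hgen : ∀ e, ∃ τ ∈ lattice Γ (position (V e)), ∀ x ∈ lattice Γ (position (V e)),
      ∃ n a b : ℤ, n ≠ 0 ∧ (n : ℂ) * x = a + b * τ := fun e =>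
    exists_generator _ (one_mem_lattice (hpar (hlift1 e)) (horospheres_mem hμ (hhoro (hlift1 e))))
      (lattice_finite hΓ.discrete _)
  choose τ hτ hτgen using hgen
  let σ : Fin k × Bool → PSL(2, ℂ) := fun e =>
    toPSL ((position (V e))⁻¹ * transl (τ e) * position (V e))
  have hσ : ∀ e, σ e ∈ Γ := hτ
  -- A root is compared with its own translate by τ, any other arc with the root after moving its
  -- initial horosphere to that of the root.
  let C : Fin k × Bool → PSL(2, ℂ) := fun e =>
    if ρ e = e then σ e * O e * (σ e)⁻¹ else γ e * O e * (γ e)⁻¹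
  have hC : ∀ e, IsLiftOfArc Γ H H' (V (ρ e)) (C e) := by
    intro e
    by_cases he : ρ e = e
    · have := hlift e _ (hσ e)
      rw [toPSL_transl_conj (hpar (hlift1 e))] at this
      simpa only [C, he, if_true] using this
    · have := hlift e _ (hγ e)
      rw [hγV] at this
      simpa only [C, he, if_false] using this
  have hcard : Fintype.card (Fin k × Bool) = 2 * k := by simp [mul_comm]
  let ε := (Fintype.equivFinOfCardEq hcard).symm
  -- Each oriented arc supplies one parameter, hence 2k in all.
  refine ⟨fun l => O (ρ (ε l)), fun l => V (ρ (ε l)), fun l => C (ε l),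
    fun l => ⟨(hlift1 _).symm, hC _⟩, ?_⟩
  intro F hF
  replace hF : ∀ e, coord (V (ρ e)) (C e) - coord (V (ρ e)) (O (ρ e)) ∈ F := by
    intro e
    have := hF (ε.symm e)
    simp only [Equiv.apply_symm_apply] at this
    exact this
  have hshift : ∀ {X Y}, IsLiftOfArc Γ H H' X Y → ∀ η ∈ Γ, η * X * η⁻¹ = X →
      ∃ b ∈ lattice Γ (position X), coord X (η * Y * η⁻¹) = coord X Y + b := by
    intro X Y hl η hη hηX
    obtain ⟨b, hb, rfl⟩ := exists_transl_of_conj_eq (hpar hl) hη hηX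
    have hp := (hpar hl.symm).position_spec
    exact ⟨b, hb, coord_translate (hpar hl) hp (br_ne_zero hΓ hμ (hhoro hl.symm) (hhoro hl)
      (hl.symm.ne hne) hp (hpar hl).position_spec) b⟩
  have hlat : ∀ e, ∀ b ∈ lattice Γ (position (V (ρ e))), b ∈ F := by
    intro e b hb
    have hp := (hpar (hlift1 (ρ e)).symm).position_spec
    -- The parameter of a root is τ itself, which generates the lattice together with 1 up to
    -- rational multiples.
    have h1 := hF (ρ e)
    simp only [C, hρρ, if_true, σ] at h1
    rw [coord_translate (hpar (hlift1 (ρ e))) hp (br_ne_zero hΓ hμ (hhoro (hlift1 _).symm)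
      (hhoro (hlift1 _)) ((hlift1 _).symm.ne hne) hp (hpar (hlift1 _)).position_spec),
      add_sub_cancel_left] at h1
    obtain ⟨n, a, b', hn, hnb⟩ := hτgen _ b hb
    have hn' : (n : ℂ) ≠ 0 := Int.cast_ne_zero.2 hn
    rw [(eq_div_iff hn').2 ((mul_comm _ _).trans hnb)]
    exact div_mem (add_mem (intCast_mem _ _) (mul_mem (intCast_mem _ _) h1)) (intCast_mem _ _)
  have hdiff : ∀ e, coord (V (ρ e)) (γ e * O e * (γ e)⁻¹) - coord (V (ρ e)) (O (ρ e)) ∈ F := by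
    intro e
    -- For a root, `γ e` need not be trivial, but it stabilizes the horosphere and so shifts the
    -- coordinate by a lattice element.
    by_cases he : ρ e = e
    · have h1 : γ e * V e * (γ e)⁻¹ = V e := by rw [hγV, he]
      obtain ⟨b, hb, hbe⟩ := hshift (hlift1 e) _ (hγ e) h1
      have hb' := hlat e b (by rwa [he])
      rwa [he, hbe, add_sub_cancel_left]
    · simpa only [C, he, if_false] using hF e
  intro X Y Z hXY hYZ
  obtain ⟨e, δ, hδ, hY, hX⟩ := isLiftOfArc_iff.1 hXY.symm
  obtain ⟨e', δ', hδ', hY', hZ⟩ := isLiftOfArc_iff.1 hYZ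
  rw [← hV] at hY hY'
  rw [← hO] at hX hZ
  have hee : ρ e = ρ e' := hρeq _ _ ⟨δ'⁻¹ * δ, mul_mem (inv_mem hδ') hδ, by
    calc _ = δ'⁻¹ * (δ * V e * δ⁻¹) * δ' := by group
      _ = _ := by rw [← hY, hY']; group⟩
  -- Moves the middle horosphere to the root. The incoming arc then is the chosen lift of `e`; the
  -- outgoing one is the chosen lift of `e'` up to `η`, which stabilizes the root horosphere.
  rw [← translationParameter_conj hΓ hμ (hhoro hXY) (hhoro hYZ) (hhoro hYZ.symm) (hXY.ne hne)
    (hYZ.ne hne) (γ e * δ⁻¹)]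
  have e1 : γ e * δ⁻¹ * X * (γ e * δ⁻¹)⁻¹ = γ e * O e * (γ e)⁻¹ := by rw [hX]; group
  have e2 : γ e * δ⁻¹ * Y * (γ e * δ⁻¹)⁻¹ = V (ρ e) := by rw [hY, ← hγV]; group
  set η := γ e * δ⁻¹ * δ' * (γ e')⁻¹ with hη
  have hηΓ : η ∈ Γ := mul_mem (mul_mem (mul_mem (hγ e) (inv_mem hδ)) hδ') (inv_mem (hγ e'))
  have e3 : γ e * δ⁻¹ * Z * (γ e * δ⁻¹)⁻¹ = η * (γ e' * O e' * (γ e')⁻¹) * η⁻¹ := by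
    rw [hZ, hη]; group
  have e4 : η * V (ρ e) * η⁻¹ = V (ρ e) := by
    calc η * V (ρ e) * η⁻¹ = γ e * δ⁻¹ * (δ' * ((γ e')⁻¹ * V (ρ e') * γ e') * δ'⁻¹) *
          (γ e * δ⁻¹)⁻¹ := by rw [hη, hee]; group
      _ = γ e * δ⁻¹ * (δ' * V e' * δ'⁻¹) * (γ e * δ⁻¹)⁻¹ := by rw [← hγV e']; group
      _ = _ := by rw [← hY', e2]
  rw [e1, e2, e3]
  have hl : IsLiftOfArc Γ H H' (V (ρ e)) (γ e' * O e' * (γ e')⁻¹) := by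
    rw [hee, ← hγV]
    exact hlift e' _ (hγ e')
  obtain ⟨b, hb, hbe⟩ := hshift hl η hηΓ e4
  have h1 := hdiff e
  have h2 := hdiff e'
  rw [← hee] at h2
  change coord _ _ - coord _ _ ∈ F
  rw [hbe]
  have := add_mem (sub_mem h2 h1) (hlat e b hb)
  convert this using 1
  ring

end HypThree

end

noncomputable section

namespace HypThree

/-! ### The covering `ℍ³ → M` -/

open Topology

namespace H3

theorem isEmbedding_toProd : IsEmbedding toProd :=
  ⟨⟨rfl⟩, fun _ _ h => H3.ext (congrArg Prod.fst h) (congrArg Prod.snd h)⟩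

theorem range_toProd : range toProd = {p : ℂ × ℝ | 0 < p.2} := by
  ext p
  exact ⟨by rintro ⟨x, rfl⟩; exact x.pos, fun hp => ⟨⟨p.1, p.2, hp⟩, rfl⟩⟩

theorem isOpenEmbedding_toProd : IsOpenEmbedding toProd :=
  ⟨isEmbedding_toProd, by rw [range_toProd]; exact isOpen_lt continuous_const continuous_snd⟩

instance : T2Space H3 := isEmbedding_toProd.t2Space

instance : LocallyCompactSpace H3 := isOpenEmbedding_toProd.locallyCompactSpace

instance : PreconnectedSpace H3 := by
  refine ⟨isEmbedding_toProd.isInducing.isPreconnected_image.1 ?_⟩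
  rw [image_univ, range_toProd]
  exact ((convex_Ioi (0 : ℝ)).linear_preimage (LinearMap.snd ℝ ℂ ℝ)).isPreconnected

@[fun_prop]
theorem continuous_z : Continuous H3.z := continuous_fst.comp isEmbedding_toProd.continuous

@[fun_prop]
theorem continuous_t : Continuous H3.t := continuous_snd.comp isEmbedding_toProd.continuous

theorem continuous_iff {X : Type*} [TopologicalSpace X] {f : X → H3} :
    Continuous f ↔ Continuous (fun x => (f x).z) ∧ Continuous fun x => (f x).t := by
  rw [isEmbedding_toProd.continuous_iff]
  exact continuous_prodMk

@[fun_prop]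
theorem continuous_den (A : SL(2, ℂ)) : Continuous (den A) := by
  unfold den
  have := Complex.continuous_normSq
  fun_prop

instance : ContinuousConstSMul SL(2, ℂ) H3 where
  continuous_const_smul A := by
    rw [continuous_iff]
    have hne : ∀ x, (den A x : ℂ) ≠ 0 := fun x => Complex.ofReal_ne_zero.2 (den_pos A x).ne'
    constructor
    · simp only [smul_z]
      refine Continuous.div ?_ (Complex.continuous_ofReal.comp (continuous_den A)) hne
      have := Complex.continuous_conj
      have := Complex.continuous_ofReal.comp continuous_t
      simp only [Function.comp_def] at this
      fun_prop
    · simp only [smul_t]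
      exact continuous_t.div (continuous_den A) fun x => (den_pos A x).ne'

/-- The upper row of a matrix in terms of the image of a point. -/
theorem upper_row (A : SL(2, ℂ)) (x : H3) :
    ‖A.1 0 0 * x.z + A.1 0 1‖ ^ 2 + ‖A.1 0 0‖ ^ 2 * x.t ^ 2 =
      (‖(A • x).z‖ ^ 2 + (A • x).t ^ 2) * den A x := by
  have h := congrFun (congrFun (herm_smul A x) 0) 0
  have ht : (A • x).t * den A x = x.t := by
    rw [smul_t, div_mul_cancel₀ _ (den_pos A x).ne']
  have hx : (x.t : ℂ) ≠ 0 := Complex.ofReal_ne_zero.2 x.pos.ne'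
  have hy : ((A • x).t : ℂ) ≠ 0 := Complex.ofReal_ne_zero.2 (A • x).pos.ne'
  have ht' : ((A • x).t : ℂ) * (den A x : ℂ) = x.t := by exact_mod_cast ht
  simp [herm, Matrix.mul_apply, Fin.sum_univ_two] at h
  rw [← Complex.ofReal_inj]
  push_cast
  rw [← Complex.mul_conj', ← Complex.mul_conj', ← Complex.mul_conj']
  simp only [map_add, map_mul]
  field_simp at h
  have hd : (den A x : ℂ) ≠ 0 := Complex.ofReal_ne_zero.2 (den_pos A x).ne'
  apply mul_left_cancel₀ hy
  linear_combination (-1 : ℂ) * h - ((A • x).z * (starRingEnd ℂ) (A • x).z + (A • x).t ^ 2) * ht'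

/-- Since t is bounded below, the second summand bounds p; then q = (p z + q) - p z is bounded as
well. -/
theorem row_bound {p q z : ℂ} {t C R : ℝ} (hR : 1 ≤ R) (hz : ‖z‖ ≤ R) (ht : R⁻¹ ≤ t)
    (hC : 0 ≤ C) (h : ‖p * z + q‖ ^ 2 + ‖p‖ ^ 2 * t ^ 2 ≤ C ^ 2) :
    ‖p‖ ≤ C * R + C * R ^ 2 ∧ ‖q‖ ≤ C + C * R ^ 2 := by
  have hR0 : 0 < R := by linarith
  have ht0 : 0 < t := (inv_pos.2 hR0).trans_le ht
  have h1 : ‖p‖ * t ≤ C := by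
    refine abs_le_of_sq_le_sq' ?_ hC |>.2
    nlinarith [sq_nonneg ‖p * z + q‖]
  have h2 : ‖p * z + q‖ ≤ C := by
    refine abs_le_of_sq_le_sq' ?_ hC |>.2
    nlinarith [mul_nonneg (sq_nonneg ‖p‖) (sq_nonneg t)]
  have h3 : ‖p‖ ≤ C * R := by
    have : ‖p‖ * R⁻¹ ≤ C := (mul_le_mul_of_nonneg_left ht (norm_nonneg _)).trans h1
    rwa [← div_eq_mul_inv, div_le_iff₀ hR0] at this
  refine ⟨h3.trans (le_add_of_nonneg_right (by positivity)), ?_⟩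
  have h4 : ‖q‖ ≤ ‖p * z + q‖ + ‖p‖ * ‖z‖ := by
    rw [← norm_mul]
    simpa using norm_sub_le (p * z + q) (p * z)
  have h5 : ‖p‖ * ‖z‖ ≤ C * R * R := mul_le_mul h3 hz (norm_nonneg _) (by positivity)
  nlinarith

theorem exists_bound {K : Set H3} (hK : IsCompact K) :
    ∃ R : ℝ, 1 ≤ R ∧ ∀ x ∈ K, ‖x.z‖ ≤ R ∧ x.t ≤ R ∧ R⁻¹ ≤ x.t := by
  obtain ⟨a, ha⟩ := (hK.image continuous_z.norm).bddAbove
  obtain ⟨b, hb⟩ := (hK.image continuous_t).bddAbove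
  obtain ⟨c, hc⟩ := (hK.image (continuous_t.inv₀ fun x => x.pos.ne')).bddAbove
  refine ⟨max 1 (max a (max b c)), le_max_left _ _, fun x hx => ⟨?_, ?_, ?_⟩⟩
  · exact (ha ⟨x, hx, rfl⟩).trans ((le_max_left _ _).trans (le_max_right _ _))
  · exact (hb ⟨x, hx, rfl⟩).trans
      ((le_max_left _ _).trans ((le_max_right _ _).trans (le_max_right _ _)))
  · refine inv_le_of_inv_le₀ x.pos ((hc ⟨x, hx, rfl⟩).trans
      ((le_max_right _ _).trans ((le_max_right _ _).trans (le_max_right _ _))))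

end H3

/-! ### Proper discontinuity and the covering projection -/

variable {Γ : Subgroup PSL(2, ℂ)}

/-- The ratio of the heights of x and A x bounds the lower row of A on compact sets, and
`H3.upper_row` bounds the upper row. Bounded elements of a discrete group are finite in number. -/
theorem finite_meeting (hΓ : DiscreteTopology (preim Γ)) {K L : Set H3} (hK : IsCompact K)
    (hL : IsCompact L) : {A : SL(2, ℂ) | A ∈ preim Γ ∧ ∃ x ∈ K, A • x ∈ L}.Finite := by
  obtain ⟨R, hR, hKR⟩ := H3.exists_bound hK
  obtain ⟨S, hS, hLS⟩ := H3.exists_bound hL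
  set C := R * S * (R + S) with hC
  have hC0 : 0 ≤ C := by positivity
  refine (finite_bounded hΓ (C * R + C * R ^ 2 + C)).subset ?_
  rintro A ⟨hA, x, hx, hy⟩
  obtain ⟨hxz, hxt, hxt'⟩ := hKR x hx
  obtain ⟨hyz, hyt, hyt'⟩ := hLS _ hy
  have hden0 := H3.den_pos A x
  have hden : H3.den A x ≤ R * S := by
    have h1 : (A • x).t * H3.den A x = x.t := by
      rw [smul_t, div_mul_cancel₀ _ hden0.ne']
    have h2 : S⁻¹ * H3.den A x ≤ R :=
      (mul_le_mul_of_nonneg_right hyt' hden0.le).trans (h1.trans_le hxt)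
    rw [inv_mul_le_iff₀ (by linarith)] at h2
    linarith
  have hRS : 1 ≤ R * S := one_le_mul_of_one_le_of_one_le hR hS
  have hlow : ‖A.1 1 0 * x.z + A.1 1 1‖ ^ 2 + ‖A.1 1 0‖ ^ 2 * x.t ^ 2 ≤ C ^ 2 := by
    have e : ‖A.1 1 0 * x.z + A.1 1 1‖ ^ 2 + ‖A.1 1 0‖ ^ 2 * x.t ^ 2 = H3.den A x := by
      simp [H3.den, Complex.normSq_eq_norm_sq]
    rw [e]
    have h1 : R * S ≤ C := by rw [hC]; nlinarith
    have h2 : 1 ≤ C := hRS.trans h1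
    nlinarith
  have hup : ‖A.1 0 0 * x.z + A.1 0 1‖ ^ 2 + ‖A.1 0 0‖ ^ 2 * x.t ^ 2 ≤ C ^ 2 := by
    rw [H3.upper_row]
    have h1 : ‖(A • x).z‖ ^ 2 + (A • x).t ^ 2 ≤ S ^ 2 + S ^ 2 :=
      add_le_add (pow_le_pow_left₀ (norm_nonneg _) hyz 2)
        (pow_le_pow_left₀ (A • x).pos.le hyt 2)
    calc _ ≤ (S ^ 2 + S ^ 2) * (R * S) := mul_le_mul h1 hden hden0.le (by positivity)
      _ ≤ (R * S) ^ 2 * (R + S) ^ 2 := by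
        have h3 : S ^ 2 + S ^ 2 ≤ (R * S) * (R + S) ^ 2 := by nlinarith [sq_nonneg (R - S)]
        nlinarith [mul_le_mul_of_nonneg_left h3 (zero_le_one.trans hRS)]
      _ = _ := by rw [hC]; ring
  obtain ⟨hp, hq⟩ := H3.row_bound hR hxz hxt' hC0 hup
  obtain ⟨hp', hq'⟩ := H3.row_bound hR hxz hxt' hC0 hlow
  have hCR : 0 ≤ C * R := by positivity
  refine ⟨hA, fun i j => ?_⟩
  fin_cases i <;> fin_cases j
  · exact hp.trans (by linarith)
  · exact hq.trans (by linarith)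
  · exact hp'.trans (by linarith)
  · exact hq'.trans (by linarith)

theorem properlyDiscontinuousSMul_preim (hΓ : DiscreteTopology (preim Γ)) :
    ProperlyDiscontinuousSMul (preim Γ) H3 where
  finite_disjoint_inter_image := by
    intro K L hK hL
    refine ((finite_meeting hΓ hK hL).preimage Subtype.val_injective.injOn).subset ?_
    rintro ⟨A, hA⟩ ⟨_, ⟨x, hx, rfl⟩, hy⟩
    exact ⟨hA, x, hx, hy⟩

theorem t2Space_mfd (hΓ : DiscreteTopology (preim Γ)) : T2Space (Mfd Γ) := by
  have := properlyDiscontinuousSMul_preim hΓ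
  have : ContinuousConstSMul (preim Γ) H3 := ⟨fun A => continuous_const_smul A.1⟩
  exact t2Space_of_properlyDiscontinuousSMul_of_t2Space (Γ := preim Γ) (T := H3)

/-- The action of `PSL(2, ℂ)` on hyperbolic space. -/
@[reducible] def pslAction : MulAction PSL(2, ℂ) H3 where
  smul γ x := Function.surjInv toPSL_surjective γ • x
  one_smul x := by
    change Function.surjInv toPSL_surjective 1 • x = x
    rw [smul_eq_of_toPSL_eq (B := 1) (by rw [Function.surjInv_eq toPSL_surjective, map_one]), one_smul]
  mul_smul γ δ x := by
    change Function.surjInv toPSL_surjective _ • x = Function.surjInv toPSL_surjective _ •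
      Function.surjInv toPSL_surjective _ • x
    rw [← mul_smul]
    exact smul_eq_of_toPSL_eq (by simp only [map_mul, Function.surjInv_eq]) x

theorem proj_eq_proj_iff {x y : H3} : proj Γ x = proj Γ y ↔ ∃ A ∈ preim Γ, A • y = x := by
  change (Quotient.mk'' x : MulAction.orbitRel.Quotient _ _) = Quotient.mk'' y ↔ _
  rw [Quotient.eq'', MulAction.orbitRel_apply]
  constructor
  · rintro ⟨⟨A, hA⟩, rfl⟩; exact ⟨A, hA, rfl⟩
  · rintro ⟨A, hA, rfl⟩; exact ⟨⟨A, hA⟩, rfl⟩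

theorem proj_smul {A : SL(2, ℂ)} (hA : A ∈ preim Γ) (x : H3) : proj Γ (A • x) = proj Γ x :=
  proj_eq_proj_iff.2 ⟨A, hA, rfl⟩

/-- The argument passes to Γ in PSL(2, ℂ), because -1 acts trivially and the action of the preimage
in SL(2, ℂ) is not free. -/
theorem isCoveringMap_proj (hΓ : IsHyperbolicManifoldGroup Γ) : IsCoveringMap (proj Γ) := by
  let := pslAction
  have hsmul : ∀ (A : SL(2, ℂ)) (x : H3), toPSL A • x = A • x := fun A x =>
    smul_eq_of_toPSL_eq (Function.surjInv_eq _ _) x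
  have h1 : ContinuousConstSMul Γ H3 := ⟨fun γ => continuous_const_smul
    (Function.surjInv toPSL_surjective γ.1)⟩
  have h2 : ProperlyDiscontinuousSMul Γ H3 := by
    refine ⟨fun {K L} hK hL => ?_⟩
    refine (((finite_meeting hΓ.discrete hK hL).image toPSL).preimage
      Subtype.val_injective.injOn).subset ?_
    rintro ⟨γ, hγ⟩ ⟨_, ⟨x, hx, rfl⟩, hy⟩
    obtain ⟨A, rfl⟩ := toPSL_surjective γ
    exact ⟨A, ⟨hγ, x, hx, by rw [← hsmul]; exact hy⟩, rfl⟩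
  have h3 : IsCancelSMul Γ H3 := by
    rw [isCancelSMul_iff_eq_one_of_smul_eq]
    rintro ⟨γ, hγ⟩ x hx
    obtain ⟨A, rfl⟩ := toPSL_surjective γ
    refine Subtype.ext (hΓ.free A hγ x ?_)
    rw [← hsmul]; exact hx
  refine (IsQuotientMap.isQuotientCoveringMap_of_properlyDiscontinuousSMul (G := Γ) (f := proj Γ)
    isQuotientMap_quotient_mk' ?_).isCoveringMap
  intro x y
  rw [proj_eq_proj_iff]
  constructor
  · rintro ⟨A, hA, rfl⟩; exact ⟨⟨toPSL A, hA⟩, hsmul A y⟩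
  · rintro ⟨⟨γ, hγ⟩, rfl⟩
    obtain ⟨A, rfl⟩ := toPSL_surjective γ
    exact ⟨A, hγ, (hsmul A y).symm⟩

end HypThree

end

noncomputable section

namespace HypThree

/-! ### The complement of a handlebody in a covering space -/

open Topology

/-- The disc with `n` holes. -/
def holedDisc (n : ℕ) : Set ℂ := {v : ℂ | ‖v‖ ≤ n + 1 ∧ ∀ i < n, 1 / 4 ≤ ‖v - (i : ℂ)‖}

theorem stdHandlebody_eq (n : ℕ) : stdHandlebody n = holedDisc n ×ˢ Icc 0 1 := rfl

theorem isCompact_holedDisc (n : ℕ) : IsCompact (holedDisc n) := by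
  refine (isCompact_closedBall (0 : ℂ) (n + 1)).of_isClosed_subset ?_ fun v hv => by
    simpa using hv.1
  refine (isClosed_le continuous_norm continuous_const).inter ?_
  change IsClosed {v : ℂ | ∀ i < n, 1 / 4 ≤ ‖v - (i : ℂ)‖}
  simp only [ofPred_forall]
  exact isClosed_iInter fun i => isClosed_iInter fun _ =>
    isClosed_le continuous_const (by fun_prop)

theorem isCompact_stdHandlebody (n : ℕ) : IsCompact (stdHandlebody n) :=
  (isCompact_holedDisc n).prod isCompact_Icc

theorem mem_frontier_stdHandlebody {n : ℕ} {q : ℂ × ℝ} (hq : q ∈ stdHandlebody n) :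
    q ∈ frontier (stdHandlebody n) ↔ q.1 ∈ frontier (holedDisc n) ∨ q.2 = 0 ∨ q.2 = 1 := by
  rw [stdHandlebody_eq] at hq
  rw [stdHandlebody_eq, frontier_prod_eq, frontier_Icc zero_le_one,
    (isCompact_holedDisc n).isClosed.closure_eq, isClosed_Icc.closure_eq]
  simp only [mem_union, mem_prod, mem_insert_iff, mem_singleton_iff]
  have h1 := hq.1
  have h2 := hq.2
  tauto

theorem mem_frontier_holedDisc {n : ℕ} {v : ℂ} (hv : v ∈ holedDisc n) (h : ‖v‖ = n + 1) :
    v ∈ frontier (holedDisc n) := by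
  refine ⟨subset_closure hv, fun hint => ?_⟩
  have hsub : holedDisc n ⊆ Metric.closedBall 0 (n + 1) := fun w hw => by simpa using hw.1
  have := interior_mono hsub hint
  rw [interior_closedBall _ (by positivity)] at this
  simp [h] at this

/-- Every point of a disc with holes is joined to the outer circle. -/
theorem exists_path_to_frontier {n : ℕ} {v : ℂ} (hv : v ∈ holedDisc n) :
    ∃ c : C(unitInterval, ℂ), c 0 = v ∧ (∀ t, c t ∈ holedDisc n) ∧ c 1 ∈ frontier (holedDisc n) := by
  -- Moving vertically away from the real axis increases the distance from all hole centers, which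
  -- are real, so the path meets no hole before the outer circle.
  obtain ⟨σ, hσ, hσv⟩ : ∃ σ : ℝ, σ ^ 2 = 1 ∧ 0 ≤ σ * v.im := by
    rcases le_total 0 v.im with h | h
    · exact ⟨1, by norm_num, by linarith⟩
    · exact ⟨-1, by norm_num, by linarith⟩
  have hsq : ∀ (a s : ℝ), ‖v + ((s * σ : ℝ) : ℂ) * Complex.I - a‖ ^ 2 =
      ‖v - a‖ ^ 2 + 2 * s * (σ * v.im) + s ^ 2 := by
    intro a s
    rw [← Complex.normSq_eq_norm_sq, ← Complex.normSq_eq_norm_sq, Complex.normSq_apply,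
      Complex.normSq_apply]
    simp
    linear_combination s ^ 2 * hσ
  have hn : (0 : ℝ) ≤ (n + 1 : ℝ) ^ 2 - v.re ^ 2 := by
    have h1 := Complex.abs_re_le_norm v
    have h2 := hv.1
    have := sq_le_sq' (by linarith [neg_abs_le v.re, norm_nonneg v, abs_nonneg v.re])
      ((le_abs_self v.re).trans (h1.trans h2))
    linarith
  -- The vertical distance from v to the circle of radius n + 1.
  set ℓ := Real.sqrt ((n + 1 : ℝ) ^ 2 - v.re ^ 2) - σ * v.im with hℓ
  have hnv : ‖v‖ ^ 2 = v.re ^ 2 + (σ * v.im) ^ 2 := by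
    rw [← Complex.normSq_eq_norm_sq, Complex.normSq_apply]
    linear_combination (-v.im ^ 2) * hσ
  have hℓ0 : 0 ≤ ℓ := by
    refine sub_nonneg.2 (Real.le_sqrt_of_sq_le ?_)
    have := pow_le_pow_left₀ (norm_nonneg v) hv.1 2
    linarith
  have hend : ‖v + ((ℓ * σ : ℝ) : ℂ) * Complex.I‖ = n + 1 := by
    have h1 := hsq 0 ℓ
    have h2 := Real.sq_sqrt hn
    simp only [Complex.ofReal_zero, sub_zero, hnv] at h1
    refine (pow_left_inj₀ (norm_nonneg _) (by positivity) two_ne_zero).1 ?_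
    rw [h1]
    have : Real.sqrt ((n + 1 : ℝ) ^ 2 - v.re ^ 2) = ℓ + σ * v.im := by rw [hℓ]; ring
    rw [this] at h2
    linarith
  have hmem : ∀ s, 0 ≤ s → s ≤ ℓ → v + ((s * σ : ℝ) : ℂ) * Complex.I ∈ holedDisc n := by
    intro s hs hsℓ
    refine ⟨?_, fun i hi => ?_⟩
    · rw [← hend]
      refine (sq_le_sq₀ (norm_nonneg _) (norm_nonneg _)).1 ?_
      have h1 := hsq 0 s
      have h2 := hsq 0 ℓ
      simp only [Complex.ofReal_zero, sub_zero] at h1 h2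
      rw [h1, h2]
      have := mul_le_mul_of_nonneg_right hsℓ hσv
      nlinarith
    · refine (hv.2 i hi).trans ((sq_le_sq₀ (norm_nonneg _) (norm_nonneg _)).1 ?_)
      have h1 := hsq i s
      rw [Complex.ofReal_natCast] at h1
      rw [h1]
      nlinarith [mul_nonneg hs hσv, sq_nonneg s]
  refine ⟨⟨fun t => v + (((t : ℝ) * ℓ * σ : ℝ) : ℂ) * Complex.I, by fun_prop⟩, by simp,
    fun t => hmem _ (mul_nonneg t.2.1 hℓ0) (mul_le_of_le_one_left hℓ0 t.2.2), ?_⟩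
  have := hmem ℓ hℓ0 le_rfl
  simpa using mem_frontier_holedDisc this hend

variable {X M : Type} [TopologicalSpace X] [TopologicalSpace M] {p : X → M}

theorem joinedIn_of_map {W : Set X} (f : C(unitInterval, X)) (h : ∀ t, f t ∈ W) : JoinedIn W (f 0) (f 1) :=
  ⟨⟨f, rfl, rfl⟩, h⟩

/-- The vertical contraction of a handlebody to its bottom. -/
def stdDown (n : ℕ) : C(unitInterval × stdHandlebody n, stdHandlebody n) where
  toFun q := ⟨(q.2.1.1, (1 - (q.1 : ℝ)) * q.2.1.2), q.2.2.1,
    mul_nonneg (sub_nonneg.2 q.1.2.2) q.2.2.2.1,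
    mul_le_one₀ (sub_le_self _ q.1.2.1) q.2.2.2.1 q.2.2.2.2⟩
  continuous_toFun := by fun_prop

/-- The preimage of the closure of the complement of a handlebody under a covering by a connected
space is connected. -/
theorem isPreconnected_preimage_closure_compl (cov : IsCoveringMap p) [PreconnectedSpace X]
    [T2Space M] {E : Set M} (hE : IsHandlebody E) : IsPreconnected (p ⁻¹' closure Eᶜ) := by
  obtain ⟨n, φ, hφ⟩ := hE
  have hstd := isCompact_stdHandlebody n
  have : CompactSpace (stdHandlebody n) := isCompact_iff_compactSpace.1 hstd
  have hEcomp : IsCompact E := isCompact_iff_compactSpace.2 φ.compactSpace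
  have hEcl : IsClosed E := hEcomp.isClosed
  have hfr : ∀ y, y ∈ frontier E → y ∈ closure Eᶜ := fun y hy => by
    rw [frontier_eq_closure_inter_closure] at hy; exact hy.2
  have hfr' : ∀ y, y ∈ E → y ∈ closure Eᶜ → y ∈ frontier E := fun y hy hy' => by
    rw [frontier_eq_closure_inter_closure]; exact ⟨subset_closure hy, hy'⟩
  set W := p ⁻¹' closure Eᶜ with hW
  set Et := p ⁻¹' E with hEt
  have hp := cov.continuous
  let κ : C(Et, stdHandlebody n) := ⟨fun x => φ.symm ⟨p x, x.2⟩, by fun_prop⟩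
  have hκ : ∀ x : Et, (φ (κ x) : M) = p x := fun x => by simp [κ]
  let K : C(unitInterval × Et, M) := ⟨fun q => φ (stdDown n (q.1, κ q.2)), by fun_prop⟩
  have hK0 : ∀ x : Et, K (0, x) = p x := fun x => by
    rw [← hκ]
    change (φ (stdDown n (0, κ x)) : M) = _
    congr 2
    exact Subtype.ext (Prod.ext rfl (by simp [stdDown]))
  let Kt : C(unitInterval × Et, X) := cov.liftHomotopy K ⟨Subtype.val, continuous_subtype_val⟩ hK0
  have hKt : ∀ q, p (Kt q) = K q := fun q => congrFun (cov.liftHomotopy_lifts K _ hK0) q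
  have hKt0 : ∀ x : Et, Kt (0, x) = x := fun x => cov.liftHomotopy_zero K _ hK0 x
  have hWof : ∀ x, ∀ q : stdHandlebody n, p x = φ q → (q : ℂ × ℝ) ∈ frontier (stdHandlebody n) →
      x ∈ W := fun x q hx hq => hfr _ (by rw [hx]; exact (hφ q).1 hq)
  let r : Et → X := fun x => Kt (1, x)
  have hr : Continuous r := by fun_prop
  have hrW : ∀ x, r x ∈ W := fun x => hWof _ _ (hKt _) (by
    rw [mem_frontier_stdHandlebody (Subtype.prop _)]
    right; left
    simp [stdDown])
  -- Over the side or the bottom the contraction never leaves the frontier, so its track stays in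
  -- `W`.
  have hjoin1 : ∀ x : Et, ((κ x).1.1 ∈ frontier (holedDisc n) ∨ (κ x).1.2 = 0) →
      JoinedIn W x (r x) := by
    intro x hx
    have := joinedIn_of_map (W := W) ⟨fun t => Kt (t, x), by fun_prop⟩ (fun t =>
      hWof _ _ (hKt _) (by
        rw [mem_frontier_stdHandlebody (Subtype.prop _)]
        rcases hx with hx | hx
        · exact Or.inl hx
        · right; left
          simp [stdDown, hx]))
    simpa [hKt0] using this
  have hjoin : ∀ x : Et, (x : X) ∈ W → JoinedIn W x (r x) := by
    intro x hx
    have hfx : (κ x : ℂ × ℝ) ∈ frontier (stdHandlebody n) :=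
      (hφ _).2 (by rw [hκ]; exact hfr' _ x.2 hx)
    rw [mem_frontier_stdHandlebody (κ x).2] at hfx
    rcases hfx with h | h | h
    · exact hjoin1 x (Or.inl h)
    · exact hjoin1 x (Or.inr h)
    -- Over the top, first move within the top to the side and then descend; applying `r` to the
    -- path in the top joins the result to `r x`.
    · obtain ⟨c, hc0, hc, hc1⟩ := exists_path_to_frontier (κ x).2.1
      let cs : C(unitInterval, stdHandlebody n) := ⟨fun t => ⟨(c t, 1), hc t, zero_le_one, le_rfl⟩, by fun_prop⟩
      let d : C(unitInterval, M) := ⟨fun t => φ (cs t), by fun_prop⟩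
      have hcs0 : cs 0 = κ x := Subtype.ext (Prod.ext hc0 h.symm)
      have hd0 : d 0 = p x := by
        rw [← hκ, ← hcs0]; rfl
      obtain ⟨f, hf, hf0⟩ := cov.exists_path_lifts d x hd0
      have hf' : ∀ t, p (f t) = φ (cs t) := fun t => congrFun hf t
      have hfE : ∀ t, f t ∈ Et := fun t => by
        change p (f t) ∈ E
        rw [hf']; exact Subtype.prop _
      have hκf : ∀ t, κ ⟨f t, hfE t⟩ = cs t := fun t => by
        apply φ.injective
        apply Subtype.ext
        rw [hκ]; exact hf' t
      have j1 : JoinedIn W x (f 1) := by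
        have := joinedIn_of_map (W := W) f fun t => hWof _ _ (hf' t) (by
          rw [mem_frontier_stdHandlebody (Subtype.prop _)]
          exact Or.inr (Or.inr rfl))
        rwa [hf0] at this
      have j2 : JoinedIn W (f 1) (r ⟨f 1, hfE 1⟩) := hjoin1 ⟨f 1, hfE 1⟩ (by
        left
        rw [hκf]
        exact hc1)
      have j3 : JoinedIn W (r ⟨f 0, hfE 0⟩) (r ⟨f 1, hfE 1⟩) :=
        joinedIn_of_map (W := W) ⟨fun t => r ⟨f t, hfE t⟩, by fun_prop⟩ fun t => hrW _
      have e : (⟨f 0, hfE 0⟩ : Et) = x := Subtype.ext hf0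
      rw [e] at j3
      exact (j1.trans j2).trans j3.symm
  have hEtcl : IsClosed Et := hEcl.preimage hp
  have hWcl : IsClosed W := isClosed_closure.preimage hp
  rw [isPreconnected_closed_iff]
  intro t t' ht ht' hsub hne hne'
  by_contra hempty
  rw [not_nonempty_iff_eq_empty] at hempty
  have hnot : ∀ x ∈ W, x ∈ t → x ∉ t' := fun x hx h1 h2 => by
    have : x ∈ W ∩ (t ∩ t') := ⟨hx, h1, h2⟩
    rw [hempty] at this
    exact this
  have hside : ∀ x y, JoinedIn W x y → ¬ (x ∈ t ∧ y ∈ t') := by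
    rintro x y ⟨f, hf⟩ ⟨hx, hy⟩
    obtain ⟨z, ⟨s, rfl⟩, hz1, hz2⟩ := isPreconnected_closed_iff.1
      (isPreconnected_range f.continuous) t t' ht ht'
      (by rintro _ ⟨s, rfl⟩; exact hsub (hf s)) ⟨x, ⟨0, f.source⟩, hx⟩ ⟨y, ⟨1, f.target⟩, hy⟩
    exact hnot _ (hf s) hz1 hz2
  -- Each half of a separation of `W` is enlarged by the points that `r` sends into it. The two
  -- closed sets cover the connected space, so they meet, which joins the halves inside `W`.
  have hclosed : ∀ u : Set X, IsClosed u → IsClosed (W ∩ u ∪ Subtype.val '' (r ⁻¹' u)) := fun u hu =>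
    (hWcl.inter hu).union (hEtcl.isClosedEmbedding_subtypeVal.isClosedMap _ (hu.preimage hr))
  obtain ⟨x, -, hx, hx'⟩ := isPreconnected_closed_iff.1 (isPreconnected_univ (α := X)) _ _
    (hclosed t ht) (hclosed t' ht') (fun x _ => by
      by_cases hxW : x ∈ W
      · rcases hsub hxW with h | h
        · exact Or.inl (Or.inl ⟨hxW, h⟩)
        · exact Or.inr (Or.inl ⟨hxW, h⟩)
      · have hxE : x ∈ Et := by
          by_contra hxE
          exact hxW (subset_closure hxE)
        rcases hsub (hrW ⟨x, hxE⟩) with h | h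
        · exact Or.inl (Or.inr ⟨⟨x, hxE⟩, h, rfl⟩)
        · exact Or.inr (Or.inr ⟨⟨x, hxE⟩, h, rfl⟩))
    (by obtain ⟨x, hx⟩ := hne; exact ⟨x, trivial, Or.inl hx⟩)
    (by obtain ⟨x, hx⟩ := hne'; exact ⟨x, trivial, Or.inl hx⟩)
  rcases hx with ⟨hxW, hxt⟩ | ⟨x, hxt, rfl⟩
  · rcases hx' with ⟨-, hxt'⟩ | ⟨x, hxt', rfl⟩
    · exact hnot x hxW hxt hxt'
    · exact hside _ _ (hjoin x hxW) ⟨hxt, hxt'⟩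
  · rcases hx' with ⟨hxW, hxt'⟩ | ⟨y, hyt', hxy⟩
    · exact hside _ _ (hjoin x hxW).symm ⟨hxt, hxt'⟩
    · obtain rfl : y = x := Subtype.ext hxy
      exact hnot _ (hrW y) hxt hyt'

/-- A handlebody has nonempty frontier. -/
theorem IsHandlebody.frontier_nonempty {E : Set M} (hE : IsHandlebody E) :
    (frontier E).Nonempty := by
  obtain ⟨n, φ, hφ⟩ := hE
  have hv : ((n : ℂ) + 1) ∈ holedDisc n := by
    refine ⟨le_of_eq (by exact_mod_cast Complex.norm_natCast (n + 1)), fun i hi => ?_⟩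
    have : (n : ℂ) + 1 - i = ((n + 1 - i : ℕ) : ℂ) := by
      rw [Nat.cast_sub (by omega)]; push_cast; ring
    rw [this, Complex.norm_natCast]
    have : (1 : ℝ) ≤ ((n + 1 - i : ℕ) : ℝ) := by exact_mod_cast (by omega : 1 ≤ n + 1 - i)
    linarith
  have hq : ((n : ℂ) + 1, (0 : ℝ)) ∈ stdHandlebody n := ⟨hv, le_rfl, zero_le_one⟩
  exact ⟨_, (hφ ⟨_, hq⟩).1 ((mem_frontier_stdHandlebody hq).2 (Or.inr (Or.inl rfl)))⟩

end HypThree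

end

noncomputable section

namespace HypThree

/-! ### Lifting tubes -/

open Topology

variable {X M : Type} [TopologicalSpace X] [TopologicalSpace M] {p : X → M}

/-- A map on a star-shaped set lifts to a covering space. -/
theorem exists_lift_of_starConvex (cov : IsCoveringMap p) {V : Type} [NormedAddCommGroup V]
    [NormedSpace ℝ V] {K : Set V} {q₀ : V} (hK : StarConvex ℝ q₀ K) (hq₀ : q₀ ∈ K) {f : V → M}
    (hf : ContinuousOn f K) {x₀ : X} (hx₀ : p x₀ = f q₀) :
    ∃ f' : V → X, ContinuousOn f' K ∧ (∀ q ∈ K, p (f' q) = f q) ∧ f' q₀ = x₀ := by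
  classical
  have hmem : ∀ (t : unitInterval) (q : K), q₀ + (t : ℝ) • ((q : V) - q₀) ∈ K := fun t q =>
    hK.add_smul_sub_mem q.2 t.2.1 t.2.2
  have hfc : Continuous (K.domRestrict f) := continuousOn_iff_continuous_domRestrict.1 hf
  -- The radial homotopy from the constant map at `q₀`; its lift from a constant map ends in a lift
  -- of `f`.
  let F : C(unitInterval × K, M) :=
    ⟨fun a => K.domRestrict f ⟨q₀ + (a.1 : ℝ) • ((a.2 : V) - q₀), hmem a.1 a.2⟩, by fun_prop⟩
  have hF0 : ∀ q, F (0, q) = p (ContinuousMap.const K x₀ q) := fun q => by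
    simp [F, hx₀, Set.domRestrict_apply]
  let L := cov.liftHomotopy F (ContinuousMap.const K x₀) hF0
  have hL : ∀ a, p (L a) = F a := fun a => congrFun (cov.liftHomotopy_lifts F _ hF0) a
  have hL0 : ∀ q, L (0, q) = x₀ := fun q => cov.liftHomotopy_zero F _ hF0 q
  refine ⟨fun q => if h : q ∈ K then L (1, ⟨q, h⟩) else x₀, ?_, ?_, ?_⟩
  · rw [continuousOn_iff_continuous_domRestrict]
    have : K.domRestrict (fun q => if h : q ∈ K then L (1, ⟨q, h⟩) else x₀) = fun q => L (1, q) := by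
      funext q
      exact dif_pos q.2
    rw [this]
    fun_prop
  · intro q hq
    simp only [hq, dif_pos]
    rw [hL]
    simp [F, Set.domRestrict_apply]
  · simp only [hq₀, dif_pos]
    rw [← hL0 ⟨q₀, hq₀⟩]
    refine cov.const_of_comp (g := fun t : unitInterval => L (t, ⟨q₀, hq₀⟩)) (by fun_prop) ?_ 1 0
    intro t t'
    rw [hL, hL]
    simp [F]

/-- A tubular neighbourhood of an arc that is isotopic to the image of a path `a` has a lift that
joins the endpoints of `a`. -/
theorem exists_lift_of_tube (cov : IsCoveringMap p) {a : ℝ → X} (ha : Continuous a) {c : ℝ → M}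
    (hc : ArcIsotopic (fun r => p (a r)) c) {T : ℂ × ℝ → M}
    (hT : ContinuousOn T (Metric.closedBall 0 1 ×ˢ Icc 0 1))
    (hcore : ∀ r ∈ Icc (0 : ℝ) 1, T (0, r) = c r) :
    ∃ T' : ℂ × ℝ → X, ContinuousOn T' (Metric.closedBall 0 1 ×ˢ Icc 0 1) ∧
      (∀ q ∈ Metric.closedBall 0 1 ×ˢ Icc 0 1, p (T' q) = T q) ∧
      T' (0, 0) = a 0 ∧ T' (0, 1) = a 1 := by
  obtain ⟨F, hF, -, hF01, hFends⟩ := hc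
  have h0 : (0 : ℝ) ∈ Icc (0 : ℝ) 1 := by simp
  have h1 : (1 : ℝ) ∈ Icc (0 : ℝ) 1 := by simp
  have hI : IsPreconnected (Icc (0 : ℝ) 1) := isPreconnected_Icc
  obtain ⟨F', hF'c, hF', hF'0⟩ := exists_lift_of_starConvex cov (K := Icc (0 : ℝ) 1 ×ˢ Icc (0 : ℝ) 1)
    (q₀ := (0, 0)) (((convex_Icc 0 1).prod (convex_Icc 0 1)).starConvex ⟨h0, h0⟩) ⟨h0, h0⟩ hF
    (x₀ := a 0) (hF01 0 h0).1.symm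
  have hrow : ∀ τ ∈ Icc (0 : ℝ) 1, ContinuousOn (fun r => F' (τ, r)) (Icc 0 1) := fun τ hτ =>
    hF'c.comp (by fun_prop) fun r hr => ⟨hτ, hr⟩
  have hcol : ∀ r ∈ Icc (0 : ℝ) 1, ContinuousOn (fun τ => F' (τ, r)) (Icc 0 1) := fun r hr =>
    hF'c.comp (by fun_prop) fun τ hτ => ⟨hτ, hr⟩
  have e1 : F' (0, 1) = a 1 :=
    cov.eqOn_of_comp_eqOn hI (hrow 0 h0) ha.continuousOn
      (fun r hr => (hF' _ ⟨h0, hr⟩).trans (hF01 r hr).1) h0 hF'0 h1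
  have e2 : F' (1, 1) = a 1 := by
    -- The endpoints are fixed during the isotopy, so their lifts are constant, and the lifted final
    -- arc still joins the endpoints of `a`.
    rw [← e1]
    refine cov.constOn_of_comp hI (hcol 1 h1) (fun τ hτ τ' hτ' => ?_) h1 h0
    rw [hF' _ ⟨hτ, h1⟩, hF' _ ⟨hτ', h1⟩, (hFends τ hτ).2, (hFends τ' hτ').2]
  have e3 : F' (1, 0) = a 0 := by
    rw [← hF'0]
    refine cov.constOn_of_comp hI (hcol 0 h0) (fun τ hτ τ' hτ' => ?_) h1 h0
    rw [hF' _ ⟨hτ, h0⟩, hF' _ ⟨hτ', h0⟩, (hFends τ hτ).1, (hFends τ' hτ').1]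
  have hb0 : (0 : ℂ) ∈ Metric.closedBall (0 : ℂ) 1 := by simp
  obtain ⟨T', hT'c, hT', hT'0⟩ := exists_lift_of_starConvex cov
    (K := Metric.closedBall (0 : ℂ) 1 ×ˢ Icc (0 : ℝ) 1) (q₀ := (0, 0))
    (((convex_closedBall 0 1).prod (convex_Icc 0 1)).starConvex ⟨hb0, h0⟩) ⟨hb0, h0⟩ hT
    (x₀ := a 0) (by rw [hcore 0 h0, ← (hF01 0 h0).2, (hFends 1 h1).1])
  refine ⟨T', hT'c, hT', hT'0, ?_⟩
  rw [← e2]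
  refine cov.eqOn_of_comp_eqOn (g₁ := fun r => T' (0, r)) hI
    (hT'c.comp (by fun_prop) fun r hr => ⟨hb0, hr⟩) (hrow 1 h1) (fun r hr => ?_) h0
    (hT'0.trans e3.symm) h1
  change p (T' (0, r)) = p (F' (1, r))
  rw [hT' _ ⟨hb0, hr⟩, hF' _ ⟨h1, hr⟩, hcore r hr, (hF01 r hr).2]

/-! ### Unions of horoballs and tubes -/

theorem continuous_heightAt (m : PSL(2, ℂ)) : Continuous (heightAt m) :=
  H3.continuous_t.comp (continuous_const_smul _)

theorem continuous_geodArc (s : ℝ) (m m' : PSL(2, ℂ)) : Continuous (geodArc s m m') := by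
  refine (continuous_const_smul _).comp (H3.continuous_iff.2 ⟨continuous_const, ?_⟩)
  change Continuous fun r => Real.exp _
  fun_prop

/-- The factor depends on the points only and not on A, and tends to 1 as they approach each other;
hence heights vary equicontinuously over all isometries. -/
theorem H3.den_le (A : SL(2, ℂ)) (x y : H3) :
    H3.den A x ≤ H3.den A y *
      (1 + 2 * ‖x.z - y.z‖ / y.t + (‖x.z - y.z‖ / y.t) ^ 2 + |x.t ^ 2 - y.t ^ 2| / y.t ^ 2) := by
  have hy := y.pos
  set c := A.1 1 0 with hc
  set u := ‖c * y.z + A.1 1 1‖ with hu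
  set δ := ‖x.z - y.z‖ with hδ
  have hdy : H3.den A y = u ^ 2 + ‖c‖ ^ 2 * y.t ^ 2 := by
    simp [H3.den, Complex.normSq_eq_norm_sq, hu, hc]
  have hdx : H3.den A x = ‖c * x.z + A.1 1 1‖ ^ 2 + ‖c‖ ^ 2 * x.t ^ 2 := by
    simp [H3.den, Complex.normSq_eq_norm_sq, hc]
  have h1 : ‖c * x.z + A.1 1 1‖ ≤ u + ‖c‖ * δ := by
    rw [hu, hδ, ← norm_mul]
    refine (congrArg norm ?_).trans_le (norm_add_le _ _)
    ring
  have h2 : ‖c * x.z + A.1 1 1‖ ^ 2 ≤ (u + ‖c‖ * δ) ^ 2 := pow_le_pow_left₀ (norm_nonneg _) h1 2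
  set w := ‖c‖ * y.t with hw
  have hcw : ‖c‖ = w / y.t := by rw [hw]; field_simp
  have hu0 : 0 ≤ u := norm_nonneg _
  have hw0 : 0 ≤ w := by positivity
  have hδ0 : 0 ≤ δ := norm_nonneg _
  set η := δ / y.t with hη
  have hη0 : 0 ≤ η := by positivity
  have h3 : ‖c‖ * δ = w * η := by rw [hcw, hη]; ring
  have h4 : ‖c‖ ^ 2 * x.t ^ 2 ≤ w ^ 2 + w ^ 2 * (|x.t ^ 2 - y.t ^ 2| / y.t ^ 2) := by
    have e : w ^ 2 + w ^ 2 * (|x.t ^ 2 - y.t ^ 2| / y.t ^ 2) =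
        ‖c‖ ^ 2 * (y.t ^ 2 + |x.t ^ 2 - y.t ^ 2|) := by rw [hw]; field_simp
    rw [e]
    refine mul_le_mul_of_nonneg_left ?_ (sq_nonneg _)
    linarith [le_abs_self (x.t ^ 2 - y.t ^ 2)]
  have h5 : 0 ≤ |x.t ^ 2 - y.t ^ 2| / y.t ^ 2 := by positivity
  have h6 : 2 * δ / y.t = 2 * η := by rw [hη]; ring
  rw [h6, hdx, hdy]
  have h7 : ‖c‖ ^ 2 * y.t ^ 2 = w ^ 2 := by rw [hw]; ring
  rw [h7]
  rw [h3] at h2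
  generalize |x.t ^ 2 - y.t ^ 2| / y.t ^ 2 = ε at *
  nlinarith [mul_nonneg (mul_nonneg hη0 hη0) (sq_nonneg u), mul_nonneg h5 (sq_nonneg u),
    mul_nonneg hη0 (sq_nonneg (u - w)), mul_nonneg hη0 (add_nonneg (sq_nonneg u) (sq_nonneg w)),
    mul_nonneg hη0 (mul_nonneg hu0 hw0)]

/-- Heights vary continuously, uniformly over all horospheres. -/
theorem H3.eventually_smul_t_lt {s : ℝ} (hs : 1 < s) (x : H3) :
    ∀ᶠ y in 𝓝 x, ∀ A : SL(2, ℂ), (A • y).t < s * (A • x).t := by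
  have hx := x.pos
  have hcont : ContinuousAt (fun y : H3 => y.t / x.t * (1 + 2 * ‖x.z - y.z‖ / y.t +
      (‖x.z - y.z‖ / y.t) ^ 2 + |x.t ^ 2 - y.t ^ 2| / y.t ^ 2)) x := by
    refine Continuous.continuousAt ?_
    have h1 : ∀ y : H3, y.t ≠ 0 := fun y => y.pos.ne'
    have h2 : ∀ y : H3, y.t ^ 2 ≠ 0 := fun y => pow_ne_zero 2 (h1 y)
    fun_prop (disch := first | exact h1 _ | exact h2 _ | assumption | exact hx.ne')
  have h1 : x.t / x.t * (1 + 2 * ‖x.z - x.z‖ / x.t +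
      (‖x.z - x.z‖ / x.t) ^ 2 + |x.t ^ 2 - x.t ^ 2| / x.t ^ 2) < s := by
    simpa [hx.ne'] using hs
  filter_upwards [hcont.eventually (gt_mem_nhds h1)] with y hy A
  have hden := H3.den_le A x y
  have hpx := H3.den_pos A x
  have hpy := H3.den_pos A y
  generalize (1 + 2 * ‖x.z - y.z‖ / y.t + (‖x.z - y.z‖ / y.t) ^ 2 +
    |x.t ^ 2 - y.t ^ 2| / y.t ^ 2) = C at *
  rw [smul_t, smul_t, div_lt_iff₀ hpy]
  have hyt := y.pos
  have h2 : y.t * C < s * x.t := by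
    rw [div_mul_eq_mul_div, div_lt_iff₀ hx] at hy
    exact hy
  have h3 : y.t * H3.den A x < s * x.t * H3.den A y := by
    calc y.t * H3.den A x ≤ y.t * (H3.den A y * C) := mul_le_mul_of_nonneg_left hden hyt.le
      _ = y.t * C * H3.den A y := by ring
      _ < _ := mul_lt_mul_of_pos_right h2 hpy
  rw [← lt_div_iff₀ hpx] at h3
  refine h3.trans_eq ?_
  ring

/-! ### Connectedness of the graph of horospheres and lifted arcs -/

variable {Γ : Subgroup PSL(2, ℂ)} {h k : ℕ} {μ : Fin h → PSL(2, ℂ)} {H H' : Fin k → PSL(2, ℂ)}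
  {m m' : PSL(2, ℂ)}

/-- The open horoballs bounded by the horospheres are disjoint. -/
theorem eq_of_one_lt_heightAt (hΓ : IsHyperbolicManifoldGroup Γ) (hμ : IsMeridianSystem Γ μ)
    (hm : m ∈ horospheres Γ μ) (hm' : m' ∈ horospheres Γ μ) {x : H3} (h1 : 1 < heightAt m x)
    (h2 : 1 ≤ heightAt m' x) : m = m' := by
  by_contra hne
  have hg := (horospheres_parabolic hμ hm).position_spec
  have hg' := (horospheres_parabolic hμ hm').position_spec
  have := heightAt_mul_heightAt_le hg hg' (one_le_norm_br hΓ hμ hm hm' hne hg hg') x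
  nlinarith

/-- Near x, every horoball reaching height s has height above 1 at x. Only one horoball does, so
locally the union is a single closed set. -/
theorem isClosed_horoballs (hΓ : IsHyperbolicManifoldGroup Γ) (hμ : IsMeridianSystem Γ μ)
    {S : Set PSL(2, ℂ)} (hS : S ⊆ horospheres Γ μ) {s : ℝ} (hs : 1 < s) :
    IsClosed {x : H3 | ∃ m ∈ S, s ≤ heightAt m x} := by
  rw [isClosed_iff_frequently]
  intro x hx
  have hev := H3.eventually_smul_t_lt hs x
  have key : ∀ y, (∀ A : SL(2, ℂ), (A • y).t < s * (A • x).t) → ∀ m, s ≤ heightAt m y →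
      1 < heightAt m x := by
    intro y hy m hm
    have := hm.trans_lt (hy (position m))
    change s < s * heightAt m x at this
    nlinarith
  obtain ⟨y, ⟨m, hm, hmy⟩, hy⟩ := (hx.and_eventually hev).exists
  have hmx := key y hy m hmy
  have hcl : IsClosed {y : H3 | s ≤ heightAt m y} :=
    isClosed_le continuous_const (continuous_heightAt m)
  refine ⟨m, hm, (isClosed_iff_frequently.1 hcl) x ?_⟩
  refine (hx.and_eventually hev).mono ?_
  rintro y' ⟨⟨m', hm', hmy'⟩, hy'⟩
  obtain rfl := eq_of_one_lt_heightAt hΓ hμ (hS hm) (hS hm') hmx (key y' hy' m' hmy').le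
  exact hmy'

theorem isClosed_translates (hΓ : DiscreteTopology (preim Γ)) {C : Set H3} (hC : IsCompact C)
    (P : PSL(2, ℂ) → Prop) :
    IsClosed {x : H3 | ∃ A ∈ preim Γ, P (toPSL A) ∧ ∃ y ∈ C, x = A • y} := by
  have e : {x : H3 | ∃ A ∈ preim Γ, P (toPSL A) ∧ ∃ y ∈ C, x = A • y} =
      ⋃ A : {A : SL(2, ℂ) // A ∈ preim Γ ∧ P (toPSL A)}, (fun y => A.1 • y) '' C := by
    ext x
    simp only [mem_ofPred_eq, mem_iUnion, mem_image, Subtype.exists]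
    constructor
    · rintro ⟨A, hA, hP, y, hy, rfl⟩; exact ⟨A, ⟨hA, hP⟩, y, hy, rfl⟩
    · rintro ⟨A, ⟨hA, hP⟩, y, hy, rfl⟩; exact ⟨A, hA, hP, y, hy, rfl⟩
  rw [e]
  refine LocallyFinite.isClosed_iUnion (fun x => ?_) fun A =>
    (hC.image (continuous_const_smul A.1)).isClosed
  obtain ⟨N, hN, hNx⟩ := exists_compact_mem_nhds x
  refine ⟨N, hNx, ((finite_meeting hΓ hC hN).preimage Subtype.val_injective.injOn).subset ?_⟩
  rintro ⟨A, hA, hP⟩ ⟨_, ⟨y, hy, rfl⟩, hyN⟩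
  exact ⟨hA, y, hy, hyN⟩

theorem exists_heightAt_eq_of_mem_cuspTori (hμ : IsMeridianSystem Γ μ) {s : ℝ} {x : H3}
    (hx : proj Γ x ∈ cuspTori Γ μ s) : ∃ m ∈ horospheres Γ μ, heightAt m x = s := by
  obtain ⟨y, ⟨m, hm, hmy⟩, hxy⟩ := hx
  obtain ⟨A, hA, rfl⟩ := proj_eq_proj_iff.1 hxy.symm
  exact ⟨_, horospheres_conj hm hA, by rw [heightAt_conj_smul (horospheres_parabolic hμ hm), hmy]⟩

/-- A connected set that lies over the cusp cross-sections lies in a single horosphere. -/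
theorem heightAt_eq_of_isPreconnected (hΓ : IsHyperbolicManifoldGroup Γ)
    (hμ : IsMeridianSystem Γ μ) {s : ℝ} (hs : 1 < s) (hm : m ∈ horospheres Γ μ) {V : Type}
    [TopologicalSpace V] {D : Set V} (hD : IsPreconnected D) {f : V → H3} (hf : ContinuousOn f D)
    (hfD : ∀ v ∈ D, proj Γ (f v) ∈ cuspTori Γ μ s) {v₀ : V} (hv₀ : v₀ ∈ D)
    (h0 : heightAt m (f v₀) = s) {v : V} (hv : v ∈ D) : heightAt m (f v) = s := by
  -- Over the tori the height relative to `m` is s, or else another horoball is present and it is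
  -- below 1. A connected set cannot cross this gap.
  have hval : ∀ v ∈ D, heightAt m (f v) = s ∨ heightAt m (f v) < 1 := by
    intro v hv
    obtain ⟨m', hm', hmv⟩ := exists_heightAt_eq_of_mem_cuspTori hμ (hfD v hv)
    by_contra! hcon
    have := eq_of_one_lt_heightAt hΓ hμ hm' hm (hmv ▸ hs) hcon.2
    exact hcon.1 (this ▸ hmv)
  rcases hval v hv with h1 | h1
  · exact h1
  · have h3 : (1 : ℝ) ∈ Icc (heightAt m (f v)) (heightAt m (f v₀)) :=
      ⟨h1.le, by rw [h0]; exact hs.le⟩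
    obtain ⟨w, hw, hw1⟩ := hD.intermediate_value hv hv₀
      ((continuous_heightAt m).comp_continuousOn hf) h3
    change heightAt m (f w) = 1 at hw1
    rcases hval w hw with h2 | h2 <;> linarith

/-- Any two lifts of cusp cross-sections are joined by a chain of lifts of the arcs of a tunnel
collection. -/
theorem horospheres_subset_of_closed (hΓ : IsHyperbolicManifoldGroup Γ)
    (hμ : IsMeridianSystem Γ μ) (hT : IsTunnelCollection Γ μ H H') {S : Set PSL(2, ℂ)}
    (hS : S ⊆ horospheres Γ μ) (hne : S.Nonempty)
    (hcl : ∀ A B, IsLiftOfArc Γ H H' A B → A ∈ S → B ∈ S) : horospheres Γ μ ⊆ S := by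
  obtain ⟨s, hs, c, T, hiso, htube, hdisj, hbody⟩ := hT.isotopy
  have cov := isCoveringMap_proj hΓ
  have := t2Space_mfd hΓ.discrete
  set K : Set (ℂ × ℝ) := Metric.closedBall 0 1 ×ˢ Icc 0 1 with hK
  have hKc : IsCompact K := (isCompact_closedBall _ _).prod isCompact_Icc
  have hpos : ∀ {m}, m ∈ horospheres Γ μ → IsPosition m (position m) := fun hm =>
    (horospheres_parabolic hμ hm).position_spec
  have hlift := fun j => exists_lift_of_tube cov (continuous_geodArc s (H j) (H' j)) (hiso j)
    (htube j).cont (htube j).core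
  choose T' hT'c hT' hT'0 hT'1 using hlift
  have hbr := fun j => one_le_norm_br hΓ hμ (hT.mem_left j) (hT.mem_right j) (hT.ne j)
    (hpos (hT.mem_left j)) (hpos (hT.mem_right j))
  have hbr0 := fun j => br_ne_zero hΓ hμ (hT.mem_left j) (hT.mem_right j) (hT.ne j)
    (hpos (hT.mem_left j)) (hpos (hT.mem_right j))
  have h0 : (0 : ℝ) ∈ Icc (0 : ℝ) 1 := by simp
  have h1 : (1 : ℝ) ∈ Icc (0 : ℝ) 1 := by simp
  have hb0 : (0 : ℂ) ∈ Metric.closedBall (0 : ℂ) 1 := by simp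
  have hs0 : 0 < s := by linarith
  have hball : IsPreconnected (Metric.closedBall (0 : ℂ) 1) :=
    (convex_closedBall 0 1).isPreconnected
  have hend0 : ∀ j, ∀ v ∈ Metric.closedBall (0 : ℂ) 1, heightAt (H j) (T' j (v, 0)) = s := by
    intro j v hv
    refine heightAt_eq_of_isPreconnected hΓ hμ hs (hT.mem_left j) hball (f := fun v => T' j (v, 0))
      ((hT'c j).comp (by fun_prop) fun v hv => ⟨hv, h0⟩) (fun v hv => ?_) hb0 ?_ hv
    · rw [hT' j _ ⟨hv, h0⟩]
      exact ((htube j).ends v hv 0 h0).2 (Or.inl rfl)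
    · rw [hT'0]
      exact heightAt_geodArc_zero hs0
        (adapted_spec (hpos (hT.mem_left j)) (hpos (hT.mem_right j)) (hbr0 j))
  have hend1 : ∀ j, ∀ v ∈ Metric.closedBall (0 : ℂ) 1, heightAt (H' j) (T' j (v, 1)) = s := by
    intro j v hv
    refine heightAt_eq_of_isPreconnected hΓ hμ hs (hT.mem_right j) hball (f := fun v => T' j (v, 1))
      ((hT'c j).comp (by fun_prop) fun v hv => ⟨hv, h1⟩) (fun v hv => ?_) hb0 ?_ hv
    · rw [hT' j _ ⟨hv, h1⟩]
      exact ((htube j).ends v hv 1 h1).2 (Or.inr rfl)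
    · rw [hT'1]
      exact heightAt_geodArc_one hs0 (hpos (hT.mem_left j)) (hpos (hT.mem_right j)) (hbr j)
  -- The horoballs of S together with all translates of lifted tubes whose initial horosphere lies
  -- in S.
  let thick : Set PSL(2, ℂ) → Set H3 := fun S => {x | ∃ m ∈ S, s ≤ heightAt m x} ∪
    ⋃ j, {x | ∃ A ∈ preim Γ, toPSL A * H j * (toPSL A)⁻¹ ∈ S ∧ ∃ y ∈ T' j '' K, x = A • y}
  have hthick : ∀ S ⊆ horospheres Γ μ, IsClosed (thick S) := fun S hS =>
    (isClosed_horoballs hΓ hμ hS hs).union (isClosed_iUnion_of_finite fun j =>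
      isClosed_translates hΓ.discrete (hKc.image_of_continuousOn (hT'c j))
        fun γ => γ * H j * γ⁻¹ ∈ S)
  -- A tube touches a closed horoball only in an end disc, so that horoball is at an end of the
  -- tube, and closure under arcs puts it in S.
  have hbt : ∀ (S : Set PSL(2, ℂ)), (∀ A B, IsLiftOfArc Γ H H' A B → A ∈ S → B ∈ S) →
      ∀ m ∈ horospheres Γ μ, ∀ j, ∀ A ∈ preim Γ, toPSL A * H j * (toPSL A)⁻¹ ∈ S →
      ∀ q ∈ K, s ≤ heightAt m (A • T' j q) → m ∈ S := by
    intro S hcl m hm j A hA hAS q hq hsm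
    have hA' : A⁻¹ ∈ preim Γ := inv_mem hA
    have hm₁ : toPSL A⁻¹ * m * (toPSL A⁻¹)⁻¹ ∈ horospheres Γ μ := horospheres_conj hm hA'
    have hht : heightAt (toPSL A⁻¹ * m * (toPSL A⁻¹)⁻¹) (T' j q) = heightAt m (A • T' j q) := by
      rw [← heightAt_conj_smul (horospheres_parabolic hμ hm) A⁻¹ (A • T' j q), inv_smul_smul]
    have hout : T j q ∉ cuspNbhd Γ μ s := (htube j).outside q.1 hq.1 q.2 hq.2
    rw [← hT' j q hq] at hout
    have heq : heightAt (toPSL A⁻¹ * m * (toPSL A⁻¹)⁻¹) (T' j q) = s := by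
      refine le_antisymm ?_ (hht ▸ hsm)
      by_contra! hlt
      exact hout ⟨_, ⟨_, hm₁, hlt⟩, rfl⟩
    have htori : T j q ∈ cuspTori Γ μ s := by
      rw [← hT' j q hq]
      exact ⟨_, ⟨_, hm₁, heq⟩, rfl⟩
    have hback : ∀ n, toPSL A⁻¹ * m * (toPSL A⁻¹)⁻¹ = n → m = toPSL A * n * (toPSL A)⁻¹ := by
      rintro n rfl
      rw [map_inv]; group
    rcases ((htube j).ends q.1 hq.1 q.2 hq.2).1 htori with hr | hr
    · have e := hend0 j q.1 hq.1
      rw [← hr] at e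
      rw [hback _ (eq_of_one_lt_heightAt hΓ hμ hm₁ (hT.mem_left j) (heq ▸ hs) (e ▸ hs.le))]
      exact hAS
    · have e := hend1 j q.1 hq.1
      rw [← hr] at e
      rw [hback _ (eq_of_one_lt_heightAt hΓ hμ hm₁ (hT.mem_right j) (heq ▸ hs) (e ▸ hs.le))]
      exact hcl _ _ ⟨j, toPSL A, hA, Or.inl ⟨rfl, rfl⟩⟩ hAS
  set S' := horospheres Γ μ \ S with hS'
  have hcl' : ∀ A B, IsLiftOfArc Γ H H' A B → A ∈ S' → B ∈ S' := fun A B hAB hA =>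
    ⟨hAB.symm.mem_left hT.mem_left hT.mem_right, fun hB => hA.2 (hcl _ _ hAB.symm hB)⟩
  have hdis : Disjoint (thick S) (thick S') := by
    rw [Set.disjoint_left]
    rintro x (⟨m, hm, hmx⟩ | hx) (⟨m', hm', hmx'⟩ | hx')
    · have := eq_of_one_lt_heightAt hΓ hμ (hS hm) hm'.1 (hs.trans_le hmx) (hs.le.trans hmx')
      exact hm'.2 (this ▸ hm)
    · obtain ⟨j, A, hA, hAS, _, ⟨q, hq, rfl⟩, rfl⟩ := mem_iUnion.1 hx'
      exact (hbt S' hcl' m (hS hm) j A hA hAS q hq hmx).2 hm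
    · obtain ⟨j, A, hA, hAS, _, ⟨q, hq, rfl⟩, rfl⟩ := mem_iUnion.1 hx
      exact hm'.2 (hbt S hcl m' hm'.1 j A hA hAS q hq hmx')
    · obtain ⟨j, A, hA, hAS, _, ⟨q, hq, rfl⟩, rfl⟩ := mem_iUnion.1 hx
      obtain ⟨j', A', hA', hAS', _, ⟨q', hq', rfl⟩, hxx⟩ := mem_iUnion.1 hx'
      have hproj : T j q = T j' q' := by
        rw [← hT' j q hq, ← hT' j' q' hq', ← proj_smul hA, hxx, proj_smul hA']
      obtain rfl : j = j' := by
        by_contra hjj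
        exact Set.disjoint_left.1 (hdisj j j' hjj) ⟨q, hq, rfl⟩ ⟨q', hq', hproj.symm⟩
      obtain rfl := (htube j).inj hq hq' hproj
      -- Two translates of the same lifted tube that meet coincide by freeness, so they belong to
      -- the same side.
      have hfix : (A⁻¹ * A') • T' j q = T' j q := by
        rw [mul_smul, ← hxx, inv_smul_smul]
      have hone := hΓ.free _ (mul_mem (inv_mem hA) hA') _ hfix
      rw [map_mul, map_inv, inv_mul_eq_one] at hone
      rw [← hone] at hAS'
      exact hAS'.2 hAS
  set N := cuspNbhd Γ μ s ∪ ⋃ j, T j '' (Metric.ball 0 1 ×ˢ Icc 0 1) with hN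
  have hWpre := isPreconnected_preimage_closure_compl cov hbody
  rw [compl_compl] at hWpre
  have hcover : proj Γ ⁻¹' closure N ⊆ thick S ∪ thick S' := by
    rw [cov.isOpenMap.preimage_closure_eq_closure_preimage cov.continuous]
    refine closure_minimal ?_ ((hthick S hS).union (hthick S' sdiff_subset))
    have hsplit : ∀ m ∈ horospheres Γ μ, m ∈ S ∨ m ∈ S' := fun m hm => by
      by_cases h : m ∈ S
      · exact Or.inl h
      · exact Or.inr ⟨hm, h⟩
    rintro x (⟨y, ⟨m, hm, hmy⟩, hxy⟩ | hx)
    · obtain ⟨A, hA, rfl⟩ := proj_eq_proj_iff.1 hxy.symm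
      have hht : s ≤ heightAt (toPSL A * m * (toPSL A)⁻¹) (A • y) := by
        rw [heightAt_conj_smul (horospheres_parabolic hμ hm)]; exact hmy.le
      exact (hsplit _ (horospheres_conj hm hA)).imp (fun h => Or.inl ⟨_, h, hht⟩)
        fun h => Or.inl ⟨_, h, hht⟩
    · obtain ⟨j, q, hq, hqx⟩ := mem_iUnion.1 hx
      have hqK : q ∈ K := ⟨Metric.ball_subset_closedBall hq.1, hq.2⟩
      rw [← hT' j q hqK] at hqx
      obtain ⟨A, hA, rfl⟩ := proj_eq_proj_iff.1 hqx.symm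
      exact (hsplit _ (horospheres_conj (hT.mem_left j) hA)).imp
        (fun h => Or.inr (mem_iUnion.2 ⟨j, A, hA, h, _, ⟨q, hqK, rfl⟩, rfl⟩))
        fun h => Or.inr (mem_iUnion.2 ⟨j, A, hA, h, _, ⟨q, hqK, rfl⟩, rfl⟩)
  have hpoint : ∀ S ⊆ horospheres Γ μ, S.Nonempty → (proj Γ ⁻¹' closure N ∩ thick S).Nonempty := by
    rintro S hS ⟨m, hm⟩
    have hht : heightAt m ((position m)⁻¹ • (⟨0, s + 1, by linarith⟩ : H3)) = s + 1 := by
      rw [heightAt, smul_inv_smul]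
    refine ⟨(position m)⁻¹ • ⟨0, s + 1, by linarith⟩, subset_closure (Or.inl ?_), Or.inl ?_⟩
    · exact ⟨_, ⟨m, hS hm, by rw [hht]; linarith⟩, rfl⟩
    · exact ⟨m, hm, by rw [hht]; linarith⟩
  by_contra hnot
  obtain ⟨m, hm, hmS⟩ := Set.not_subset.1 hnot
  obtain ⟨x, -, hx, hx'⟩ := isPreconnected_closed_iff.1 hWpre _ _ (hthick S hS)
    (hthick S' sdiff_subset) hcover (hpoint S hS hne) (hpoint S' sdiff_subset ⟨m, hm, hmS⟩)
  exact Set.disjoint_left.1 hdis hx hx'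

/-- A manifold with a tunnel collection has a cusp. -/
theorem horospheres_nonempty (hT : IsTunnelCollection Γ μ H H') : (horospheres Γ μ).Nonempty := by
  obtain ⟨s, -, c, T, -, -, -, hbody⟩ := hT.isotopy
  obtain ⟨y, hy⟩ := hbody.frontier_nonempty
  rw [frontier_compl, frontier_eq_closure_inter_closure] at hy
  obtain ⟨_, ⟨y, ⟨m, hm, -⟩, -⟩ | hx⟩ := closure_nonempty_iff.1 ⟨y, hy.1⟩
  · exact ⟨m, hm⟩
  · obtain ⟨j, -⟩ := mem_iUnion.1 hx
    exact ⟨_, hT.mem_left j⟩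

end HypThree

end

noncomputable section

namespace HypThree

/-! ### Generation of the invariant trace field -/

variable {Γ : Subgroup PSL(2, ℂ)} {h k : ℕ} {μ : Fin h → PSL(2, ℂ)} {H H' : Fin k → PSL(2, ℂ)}
  {m X Y : PSL(2, ℂ)} {F : IntermediateField ℚ ℂ}

theorem squares_le : squares Γ ≤ Γ := by
  refine (Subgroup.closure_le _).2 ?_
  rintro _ ⟨γ, hγ, rfl⟩
  exact pow_mem hγ 2

/-- If `Γ` fixes a horosphere, then its traces are rational. -/
theorem invariantTraceField_le_of_forall_conj_eq (hm : IsParabolic m)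
    (hfix : ∀ γ ∈ Γ, γ * m * γ⁻¹ = m) : invariantTraceField Γ ≤ F := by
  refine IntermediateField.adjoin_le_iff.2 ?_
  rintro _ ⟨A, hA, rfl⟩
  have hA' := squares_le hA
  obtain ⟨b, -, hb⟩ := exists_transl_of_conj_eq hm hA' (hfix _ hA')
  have htr : ((position m)⁻¹ * transl b * position m).1.trace = 2 := by
    rw [conj_transl_entries, Matrix.trace_fin_two]
    simp
    ring
  have h2 : (2 : ℂ) ∈ F := ofNat_mem _ 2
  rcases toPSL_eq_iff.1 hb with h | h
  · rw [h, htr]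
    exact h2
  · rw [h]
    change (-(_ : Matrix _ _ ℂ)).trace ∈ F
    rw [Matrix.trace_neg, htr]
    exact neg_mem h2

theorem IsLiftOfArc.br_sq_mem (hΓ : IsHyperbolicManifoldGroup Γ) (hμ : IsMeridianSystem Γ μ)
    (hH : ∀ j, H j ∈ horospheres Γ μ) (hH' : ∀ j, H' j ∈ horospheres Γ μ)
    (hne : ∀ j, H j ≠ H' j) (hw : ∀ j, intercuspParameter (H j) (H' j) ∈ F)
    (hl : IsLiftOfArc Γ H H' X Y) : br (position X) (position Y) ^ 2 ∈ F := by
  have hj : ∀ j, br (position (H j)) (position (H' j)) ^ 2 ∈ F := by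
    intro j
    have hg := (horospheres_parabolic hμ (hH j)).position_spec
    have hg' := (horospheres_parabolic hμ (hH' j)).position_spec
    have h0 := br_ne_zero hΓ hμ (hH j) (hH' j) (hne j) hg hg'
    have hwj := hw j
    rw [intercuspParameter_eq hg hg' (one_le_norm_br hΓ hμ (hH j) (hH' j) (hne j) hg hg')] at hwj
    have e : br (position (H j)) (position (H' j)) ^ 2 =
        -1 / (-1 / br (position (H j)) (position (H' j)) ^ 2) := by field_simp
    rw [e]
    exact div_mem (neg_mem (one_mem _)) hwj
  have hX := (horospheres_parabolic hμ (hl.mem_left hH hH')).position_spec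
  have hY := (horospheres_parabolic hμ (hl.symm.mem_left hH hH')).position_spec
  obtain ⟨j, γ, hγ, hl⟩ := hl
  obtain ⟨A, rfl⟩ := toPSL_surjective γ
  have hg := (horospheres_parabolic hμ (hH j)).position_spec.conj A
  have hg' := (horospheres_parabolic hμ (hH' j)).position_spec.conj A
  have hA := hj j
  rw [← br_mul_right _ _ A⁻¹] at hA
  rcases hl with ⟨rfl, rfl⟩ | ⟨rfl, rfl⟩
  · rwa [br_sq_eq hg hX hg' hY]
  · rwa [br_swap, neg_sq, br_sq_eq hg hY hg' hX]

/-- A field that contains the parameters of the lifts of the arcs of a tunnel collection contains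
the invariant trace field. -/
theorem invariantTraceField_le_of_parameters (hΓ : IsHyperbolicManifoldGroup Γ)
    (hμ : IsMeridianSystem Γ μ) (hT : IsTunnelCollection Γ μ H H')
    (hw : ∀ j, intercuspParameter (H j) (H' j) ∈ F)
    (hu : ∀ X Y Z, IsLiftOfArc Γ H H' X Y → IsLiftOfArc Γ H H' Y Z →
      translationParameter X Y Z ∈ F) : invariantTraceField Γ ≤ F := by
  have hhoro : ∀ {X Y}, IsLiftOfArc Γ H H' X Y → X ∈ horospheres Γ μ := fun hl =>
    hl.mem_left hT.mem_left hT.mem_right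
  have hpos : ∀ {m}, m ∈ horospheres Γ μ → IsPosition m (position m) := fun hm =>
    (horospheres_parabolic hμ hm).position_spec
  have hbr : ∀ {X Y}, IsLiftOfArc Γ H H' X Y → br (position X) (position Y) ≠ 0 := fun hl =>
    br_ne_zero hΓ hμ (hhoro hl) (hhoro hl.symm) (hl.ne hT.ne) (hpos (hhoro hl))
      (hpos (hhoro hl.symm))
  have hsq : ∀ {X Y}, IsLiftOfArc Γ H H' X Y → br (position X) (position Y) ^ 2 ∈ F := fun hl =>
    hl.br_sq_mem hΓ hμ hT.mem_left hT.mem_right hT.ne hw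
  rcases k.eq_zero_or_pos with rfl | hk
  -- Without arcs there is just one horosphere. All of Γ fixes it, and every trace is ±2.
  · obtain ⟨m, hm⟩ := horospheres_nonempty hT
    have hall : horospheres Γ μ ⊆ {m} :=
      horospheres_subset_of_closed hΓ hμ hT (singleton_subset_iff.2 hm) (singleton_nonempty m)
        fun _ _ ⟨j, _⟩ => j.elim0
    exact invariantTraceField_le_of_forall_conj_eq (horospheres_parabolic hμ hm)
      fun γ hγ => hall (horospheres_conj hm hγ)
  have hturn : ∀ {m X Y}, IsLiftOfArc Γ H H' m X → IsLiftOfArc Γ H H' m Y →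
      ProjRational F (frame (position m) (position X)) (frame (position m) (position Y)) := by
    intro m X Y hX hY
    refine frame_turn (hbr hX) (hsq hX) (hsq hY) (hbr hY) ?_
    rw [← translationParameter_eq (hpos (hhoro hX.symm)) (hpos (hhoro hX)) (hpos (hhoro hY.symm))
      (hbr hX.symm) (hbr hY)]
    exact hu _ _ _ hX.symm hY
  set A₀ := H ⟨0, hk⟩
  set B₀ := H' ⟨0, hk⟩
  have hl₀ : IsLiftOfArc Γ H H' A₀ B₀ := ⟨⟨0, hk⟩, 1, one_mem _, Or.inl (by simp [A₀, B₀])⟩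
  have hA₀ := hpos (hhoro hl₀)
  have hB₀ := hpos (hhoro hl₀.symm)
  set P := frame (position A₀) (position B₀)
  have hP : P.det ≠ 0 := by
    rw [det_frame]
    exact pow_ne_zero 2 (hbr hl₀)
  -- The induction along chains carries comparability with `P` for all arcs leaving m, so one step
  -- is to traverse an arc, reverse it and turn.
  have hall : horospheres Γ μ ⊆ {m | m ∈ horospheres Γ μ ∧ ∀ n, IsLiftOfArc Γ H H' m n →
      ProjRational F P (frame (position m) (position n))} :=
    horospheres_subset_of_closed hΓ hμ hT (fun m hm => hm.1)
      ⟨A₀, hhoro hl₀, fun n hn => hturn hl₀ hn⟩ fun m n hmn hm =>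
        ⟨hhoro hmn.symm, fun x hx => ((hm.2 n hmn).trans
          (frame_swap (hbr hmn) (hsq hmn))).trans (hturn hmn.symm hx)⟩
  -- `P * A` is, up to sign, the frame of the base arc translated by A⁻¹, which is again a lift.
  refine invariantTraceField_le hP fun A hA => ?_
  have hl := hl₀.conj (inv_mem (mem_preim.1 hA))
  rw [← map_inv] at hl
  have hr := (hall (hhoro hl)).2 _ hl
  have hcA := hA₀.conj A⁻¹
  have hcB := hB₀.conj A⁻¹
  rw [inv_inv] at hcA hcB
  rw [← frame_mul]
  rcases frame_eq_or (hpos (hhoro hl)) hcA (hpos (hhoro hl.symm)) hcB with e | e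
  · rwa [e]
  · rw [e]
    exact hr.neg_right

end HypThree

end

/-! ### The two inclusions of fields -/

theorem mainTheorem3 (Γ : Subgroup PSL(2, ℂ)) (hΓ : HypThree.IsHyperbolicManifoldGroup Γ)
    (h : ℕ) (μ : Fin h → PSL(2, ℂ)) (hμ : HypThree.IsMeridianSystem Γ μ)
    (k : ℕ) (H H' : Fin k → PSL(2, ℂ)) (hT : HypThree.IsTunnelCollection Γ μ H H') :
    ∃ A B C : Fin (2 * k) → PSL(2, ℂ),
      (∀ l, HypThree.IsLiftOfArc Γ H H' (A l) (B l) ∧ HypThree.IsLiftOfArc Γ H H' (B l) (C l)) ∧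
      HypThree.invariantTraceField Γ = IntermediateField.adjoin ℚ
        (Set.range (fun j => HypThree.intercuspParameter (H j) (H' j)) ∪
          Set.range (fun l => HypThree.translationParameter (A l) (B l) (C l))) := by
  obtain ⟨A, B, C, hl, hF⟩ :=
    HypThree.exists_translationParameters hΓ hμ hT.mem_left hT.mem_right hT.ne
  refine ⟨A, B, C, hl, le_antisymm ?_ ?_⟩
  · exact HypThree.invariantTraceField_le_of_parameters hΓ hμ hT
      (fun j => IntermediateField.subset_adjoin _ _ (Or.inl ⟨j, rfl⟩))
      (hF _ fun l => IntermediateField.subset_adjoin _ _ (Or.inr ⟨l, rfl⟩))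
  · refine IntermediateField.adjoin_le_iff.2 ?_
    rintro _ (⟨j, rfl⟩ | ⟨l, rfl⟩)
    · exact HypThree.intercuspParameter_mem hΓ hμ (hT.mem_left j) (hT.mem_right j) (hT.ne j)
    · exact HypThree.translationParameter_mem hΓ hμ
        ((hl l).1.mem_left hT.mem_left hT.mem_right) ((hl l).2.mem_left hT.mem_left hT.mem_right)
        ((hl l).2.symm.mem_left hT.mem_left hT.mem_right) ((hl l).1.ne hT.ne) ((hl l).2.ne hT.ne)
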